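/- **Setting.** Let $\Bbbk$ be a commutative ring and let $Z$, $A$ be $\mathbb Z$-graded $\Bbbk$-modules. A cochain $D\in C^n$ of degree $|D|=n$ is a family of multilinear maps $D_{\ell,k}(z_1,\dots,z_\ell;a_1,\dots,a_k)\in A$, for all $\ell,k\ge 0$ (including $(0,0)$), of degree $n$ (so $|D(z;a)|=n+\sum|z_i|+\sum|a_j|$) and graded symmetric in the $z_i$. For a partition $\{1,\dots,\ell\}=J_0\sqcup\dots\sqcup J_r$ into ordered (possibly empty) subsets let $\epsilon$ be the Koszul sign, $z_{[\ell]}=(-1)^\epsilon z_{J_0}\wedge\dots\wedge z_{J_r}$. Words $a_1\dots a_k$ are cut into consecutive, possibly empty pieces. Put $$D\{E\}(z;a)=\sum(-1)^{|a_{I_0}|(|E|+|z_L|)+|z_J||E|+\epsilon}\,D(z_J;a_{I_0},E(z_L;a_K),a_{I_1}),$$ $$D\{E,F\}(z;a)=\sum(-1)^{*}\,D(z_J;a_{I_0},E(z_L;a_K),a_{I_1},F(z_M;a_N),a_{I_2}),$$ $$*=|a_{I_0}|(|E|+|z_L|)+(|a_{I_0}|+|a_K|+|a_{I_1}|)(|F|+|z_M|)+|z_J||E|+(|z_J|+|z_L|)|F|+\epsilon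 ,$$ and $[D,E]=D\{E\}-(-1)^{|D||E|}E\{D\}$. An OCHA $(\mathfrak l,\mathfrak q)$ consists of an $L_\infty$ structure $\mathfrak l=\{\mathfrak l_\ell\}_{\ell\ge1}$ on $Z$ (graded symmetric operations of degree $1$ with $\sum(-1)^\epsilon\mathfrak l(\mathfrak l(z_J)\wedge z_L)=0$) and a cochain $\mathfrak q$ of degree $1$ with $\mathfrak q_{0,0}=0$ and $\mathfrak q\{\mathfrak q\}=\widehat{\mathfrak l}(\mathfrak q)$, where $\widehat{\mathfrak l}(D)(z;a)=\sum(-1)^\epsilon D(\mathfrak l(z_J)\wedge z_L;a)$. Its Hochschild differential is $\delta D=\mathfrak q\{D\}-(-1)^{|D|}D\{\mathfrak q\}+(-1)^{|D|}\widehat{\mathfrak l}(D)$. Let $\omega:A\otimes A\to\Bbbk$ be a bilinear form of degree $|\omega|\in\mathbb Z$ (that is, $\omega(a,b)=0$ unless $|a|+|b|+|\omega|=0$) with $\omega(a,b)=(-1)^{|a||b|+1}\omega(b,a)$, nondegenerate in the sense that $A_d\to\mathrm{Hom}(A_{-|\omega|-d},\Bbbk)$, $a\mapsto\omega(a,\cdot)$,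 is bijective for every $d$. Assume that the OCHA is $\omega$-cyclic, i.e. for $k\ge1$ $$\omega(\mathfrak q(z;a_1,\dots,a_k),a_0)=(-1)^{|a_0|\sum_{i\ge1}|a_i|}\,\omega(\mathfrak q(z;a_0,\dots,a_{k-1}),a_k),$$ and unital with unit $\mathbf 1\in A_{-1}$, i.e. $\mathfrak q_{0,2}(\mathbf 1,a)=(-1)^{|a|-1}\mathfrak q_{0,2}(a,\mathbf 1)=a$, and $\mathfrak q_{\ell,k}$ vanishes whenever $\mathbf 1$ is among its inputs from $A$, for $(\ell,k)\ne(0,2)$. Define cochains $\Delta D$ of degree $|D|-1$ and $D\{E,\Delta\}$ of degree $|D|+|E|-1$ by requiring, for all $a_0$ (and all $\ell,k\ge 0$), $$\omega(\Delta D(z;a_{[k]}),a_0)=\sum_{i=0}^k(-1)^{|a_{[1,i]}|(|a_{[i+1,k]}|+|a_0|)}\,\omega(D(z;a_{i+1},\dots,a_k,a_0,a_1,\dots,a_i),\mathbf 1),$$ $$\omega(D\{E,\Delta\}(z;a_{[k]}),a_0)=\sum(-1)^{\star}\,\omega(D(z_J;a_{r+1},\dots,a_j,E(z_L;a_{j+1},\dots,a_i),a_{i+1},\dots,a_k,a_0,a_1,\dots,a_r),\mathbf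 1),$$ the last sum over $J\sqcup L=\{1,\dots,\ell\}$ and $0\le r\le j\le i\le k$, with $\star=|a_{[r+1,j]}|(|E|+|z_L|)+|z_J||E|+\epsilon+|a_{[1,r]}|(|a_{[r+1,k]}|+|a_0|)$. **Theorem.** (1) For all cochains $D$, $E$ of degrees $|D|$, $|E|$, $$\begin{aligned}(-1)^{|\omega|}[D,E]={}&\Delta(\mathfrak q\{D,E\})+\mathfrak q\{\Delta D,E\}-(-1)^{|D||E|}\mathfrak q\{\Delta E,D\}\\&+\delta(D\{E,\Delta\})-(-1)^{|D||E|}\delta(E\{D,\Delta\})\\&+(\delta D)\{E,\Delta\}-(-1)^{|D||E|}(\delta E)\{D,\Delta\}\\&+(-1)^{|D|}D\{\delta E,\Delta\}-(-1)^{|E|+|D||E|}E\{\delta D,\Delta\}.\end{aligned}$$ (2) Let $\overline{HH}{}^n$ be the normalized open-closed Hochschild cohomology: normalized cochains $D$ of degree $n$ (those vanishing when $\mathbf 1$ is among the inputs from $A$) with $\delta D=0$, modulo $\delta$ of normalized cochains. Then $[D,E]$, $D\smallsmile E:=\mathfrak q\{D,E\}$ and $\Delta D$ induce well-defined (bi)linear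 operations on $\overline{HH}$, and there $$(-1)^{|\omega|}[D,E]=\Delta(D\smallsmile E)+\Delta D\smallsmile E-(-1)^{|D||E|}\Delta E\smallsmile D .$$ (3) If $D$, $E$ are normalized cocycles with $D_{0,0}=E_{0,0}=0$, the two sides of the relation in (2), as cochains, differ by $\delta B$ for a normalized cochain $B$ with $B_{0,0}=0$; so the relation also holds in the cohomology of the normalized cochains without $(0,0)$ component. -/

import Mathlib

set_option linter.unusedSectionVars false

namespace OpenClosed

section Lists

variable {k V W : Type*} [CommRing k] [AddCommGroup V] [Module k V] [AddCommGroup W] [Module k W]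

/-- A homogeneous element of a graded module, recorded together with its degree. -/
abbrev Homog (𝒱 : ℤ → Submodule k V) : Type _ := Σ d : ℤ, 𝒱 d

/-- The sum of the degrees in a word of homogeneous elements. -/
def totalDeg {𝒱 : ℤ → Submodule k V} (l : List (Homog 𝒱)) : ℤ := (l.map Sigma.fst).sum

/-- A function on words of homogeneous elements is multilinear if it is linear in each letter. -/
def IsMultilin {𝒱 : ℤ → Submodule k V} (f : List (Homog 𝒱) → W) : Prop :=
  ∀ (pre post : List (Homog 𝒱)) (d : ℤ),
    IsLinearMap k (fun x : 𝒱 d => f (pre ++ (⟨d, x⟩ : Homog 𝒱) :: post))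

/-- Graded symmetry, stated for the adjacent transpositions (which generate all permutations):
exchanging neighbours `x`, `y` costs the sign `(-1)^{|x||y|}`. -/
def IsGradedSymm {𝒱 : ℤ → Submodule k V} (f : List (Homog 𝒱) → W) : Prop :=
  ∀ (pre post : List (Homog 𝒱)) (x y : Homog 𝒱),
    f (pre ++ x :: y :: post) = (x.1 * y.1).negOnePow • f (pre ++ y :: x :: post)

/-- `splitSum g w` is the sum of `g p s` over all ways of cutting the word `w` into a
(possibly empty) initial piece `p` and the remaining piece `s`. -/
def splitSum {α : Type*} (g : List α → List α → W) : List α → W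
  | [] => g [] []
  | a :: l => g [] (a :: l) + splitSum (fun p s => g (a :: p) s) l

/-- `shuffleSum g (z₁ … z_ℓ)` is the sum of `(-1)^ε g z_J z_L` over all partitions of
`{1, …, ℓ}` into ordered, possibly empty subsets `J`, `L`, where `ε` is the Koszul sign in
`z₁ ∧ … ∧ z_ℓ = (-1)^ε z_J ∧ z_L`. In the recursion the first letter either goes to `J`, or goes
to `L` and is moved past all of `z_J`. -/
def shuffleSum {𝒱 : ℤ → Submodule k V} (g : List (Homog 𝒱) → List (Homog 𝒱) → W) :
    List (Homog 𝒱) → W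
  | [] => g [] []
  | z :: l => shuffleSum (fun J L => g (z :: J) L) l +
      shuffleSum (fun J L => (z.1 * totalDeg J).negOnePow • g J (z :: L)) l

variable {𝒱 : ℤ → Submodule k V}

theorem homog_ext {x y : Homog 𝒱} (h : x.1 = y.1) (h' : (x.2 : V) = y.2) : x = y := by
  obtain ⟨d, x, hx⟩ := x
  obtain ⟨e, y, hy⟩ := y
  subst h
  simp only at h'
  subst h'
  rfl

@[simp] theorem totalDeg_nil : totalDeg ([] : List (Homog 𝒱)) = 0 := rfl

@[simp] theorem totalDeg_cons (x : Homog 𝒱) (l : List (Homog 𝒱)) :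
    totalDeg (x :: l) = x.1 + totalDeg l := by simp [totalDeg]

@[simp] theorem totalDeg_append (l l' : List (Homog 𝒱)) :
    totalDeg (l ++ l') = totalDeg l + totalDeg l' := by simp [totalDeg]

theorem units_smul_mem (S : Submodule k W) (u : ℤˣ) {x : W} (h : x ∈ S) : u • x ∈ S := by
  rcases Int.units_eq_one_or u with rfl | rfl
  · simpa using h
  · simpa using h

theorem isLinearMap_add {f g : V → W} (hf : IsLinearMap k f) (hg : IsLinearMap k g) :
    IsLinearMap k (fun x => f x + g x) :=
  ⟨fun x y => by rw [hf.map_add, hg.map_add]; abel,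
    fun c x => by rw [hf.map_smul, hg.map_smul, smul_add]⟩

theorem isLinearMap_units_smul {f : V → W} (u : ℤˣ) (hf : IsLinearMap k f) :
    IsLinearMap k (fun x => u • f x) :=
  ⟨fun x y => by rw [hf.map_add, smul_add],
    fun c x => by rw [hf.map_smul]; exact smul_comm _ _ _⟩

theorem isLinearMap_map_units_smul {f : V → W} (hf : IsLinearMap k f) (u : ℤˣ) (x : V) :
    f (u • x) = u • f x := by
  rcases Int.units_eq_one_or u with rfl | rfl
  · simp
  · simp [hf.map_neg]

theorem splitSum_isLinearMap {α : Type*} {U : Type*} [AddCommGroup U] [Module k U] (l : List α)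
    {g : U → List α → List α → W} (h : ∀ p s, IsLinearMap k (fun x => g x p s)) :
    IsLinearMap k (fun x => splitSum (g x) l) := by
  induction l generalizing g with
  | nil => exact h [] []
  | cons a l ih => exact isLinearMap_add (h _ _) (ih fun p s => h (a :: p) s)

theorem shuffleSum_isLinearMap {U : Type*} [AddCommGroup U] [Module k U] (l : List (Homog 𝒱))
    {g : U → List (Homog 𝒱) → List (Homog 𝒱) → W}
    (h : ∀ p s, IsLinearMap k (fun x => g x p s)) :
    IsLinearMap k (fun x => shuffleSum (g x) l) := by
  induction l generalizing g with
  | nil => exact h [] []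
  | cons a l ih =>
    exact isLinearMap_add (ih fun p s => h (a :: p) s)
      (ih fun p s => isLinearMap_units_smul _ (h p (a :: s)))

theorem splitSum_mem {α : Type*} (S : Submodule k W) {g : List α → List α → W} (l : List α)
    (h : ∀ p s, p ++ s = l → g p s ∈ S) : splitSum g l ∈ S := by
  induction l generalizing g with
  | nil => exact h [] [] rfl
  | cons a l ih =>
    exact S.add_mem (h _ _ rfl) (ih fun p s e => h _ _ (by simp [e]))

theorem shuffleSum_mem (S : Submodule k W) {g : List (Homog 𝒱) → List (Homog 𝒱) → W}
    (l : List (Homog 𝒱)) (h : ∀ p s, totalDeg p + totalDeg s = totalDeg l → g p s ∈ S) :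
    shuffleSum g l ∈ S := by
  induction l generalizing g with
  | nil => exact h [] [] rfl
  | cons a l ih =>
    refine S.add_mem (ih fun p s e => h _ _ ?_)
      (ih fun p s e => units_smul_mem _ _ (h _ _ ?_)) <;> simp <;> omega

theorem splitSum_units_smul {α : Type*} (u : ℤˣ) (g : List α → List α → W) (l : List α) :
    splitSum (fun p s => u • g p s) l = u • splitSum g l := by
  induction l generalizing g with
  | nil => rfl
  | cons a l ih => simp only [splitSum, ih, smul_add]

theorem shuffleSum_units_smul (u : ℤˣ) (g : List (Homog 𝒱) → List (Homog 𝒱) → W)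
    (l : List (Homog 𝒱)) :
    shuffleSum (fun p s => u • g p s) l = u • shuffleSum g l := by
  induction l generalizing g with
  | nil => rfl
  | cons a l ih =>
    simp only [shuffleSum, ih, smul_add]
    congr 1
    rw [← ih]
    congr 1
    funext J L
    exact smul_comm _ _ _

namespace IsMultilin

variable {f : List (Homog 𝒱) → W}

theorem append_left (hf : IsMultilin f) (t : List (Homog 𝒱)) :
    IsMultilin (fun l => f (t ++ l)) := fun pre post d => by
  simpa using hf (t ++ pre) post d

theorem append_right (hf : IsMultilin f) (t : List (Homog 𝒱)) :
    IsMultilin (fun l => f (l ++ t)) := fun pre post d => by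
  simpa using hf pre (post ++ t) d

theorem sign (hf : IsMultilin f) (e : ℤ → ℤ) :
    IsMultilin (fun l => (e (totalDeg l)).negOnePow • f l) := fun pre post d => by
  simpa using isLinearMap_units_smul (e (totalDeg pre + (d + totalDeg post))).negOnePow
    (hf pre post d)

theorem splitSum {g : List (Homog 𝒱) → List (Homog 𝒱) → W}
    (h₁ : ∀ s, IsMultilin (fun p => g p s)) (h₂ : ∀ p, IsMultilin (g p)) :
    IsMultilin (OpenClosed.splitSum g) := by
  intro pre post d
  induction pre generalizing g with
  | nil =>
    exact isLinearMap_add (h₂ [] [] post d)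
      (splitSum_isLinearMap post fun p s => h₁ s [] p d)
  | cons a pre ih =>
    exact isLinearMap_add (h₂ [] (a :: pre) post d)
      (ih (fun s => (h₁ s).append_left [a]) fun p => h₂ (a :: p))

theorem shuffleSum {g : List (Homog 𝒱) → List (Homog 𝒱) → W}
    (h₁ : ∀ s, IsMultilin (fun p => g p s)) (h₂ : ∀ p, IsMultilin (g p)) :
    IsMultilin (OpenClosed.shuffleSum g) := by
  intro pre post d
  induction pre generalizing g with
  | nil =>
    exact isLinearMap_add (shuffleSum_isLinearMap post fun p s => h₁ s [] p d)
      (shuffleSum_isLinearMap post fun p s =>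
        isLinearMap_units_smul (d * totalDeg p).negOnePow (h₂ p [] s d))
  | cons a pre ih =>
    refine isLinearMap_add (ih (fun s => (h₁ s).append_left [a]) fun p => h₂ (a :: p))
      (ih (fun s => (h₁ (a :: s)).sign fun e => a.1 * e) fun p pre post d =>
        isLinearMap_units_smul _ ((h₂ p).append_left [a] pre post d))

theorem splitSum_param {α : Type*} (l : List α) {g : List (Homog 𝒱) → List α → List α → W}
    (h : ∀ p s, IsMultilin (fun x => g x p s)) :
    IsMultilin (fun x => OpenClosed.splitSum (g x) l) := fun pre post d =>
  splitSum_isLinearMap l fun p s => h p s pre post d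

theorem shuffleSum_param {V' : Type*} [AddCommGroup V'] [Module k V']
    {𝒱' : ℤ → Submodule k V'} (l : List (Homog 𝒱'))
    {g : List (Homog 𝒱) → List (Homog 𝒱') → List (Homog 𝒱') → W}
    (h : ∀ p s, IsMultilin (fun x => g x p s)) :
    IsMultilin (fun x => OpenClosed.shuffleSum (g x) l) := fun pre post d =>
  shuffleSum_isLinearMap l fun p s => h p s pre post d

/-- Feeding a multilinear homogeneous function into one slot of a multilinear function. -/
theorem comp {V' : Type*} [AddCommGroup V'] [Module k V'] {𝒱' : ℤ → Submodule k V'}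
    (hf : IsMultilin f) {u : List (Homog 𝒱') → V} (hu : IsMultilin u) (e : ℤ → ℤ)
    (p s : List (Homog 𝒱)) (v : List (Homog 𝒱') → Homog 𝒱)
    (hv : ∀ l, (v l).1 = e (totalDeg l)) (hv' : ∀ l, ((v l).2 : V) = u l) :
    IsMultilin (fun l => f (p ++ v l :: s)) := by
  intro pre post d
  set c := e (totalDeg pre + (d + totalDeg post)) with hc
  have hd : ∀ x : 𝒱' d, (v (pre ++ (⟨d, x⟩ : Homog 𝒱') :: post)).1 = c := fun x => by
    rw [hv]; simp [hc]
  have hm : ∀ x : 𝒱' d, u (pre ++ (⟨d, x⟩ : Homog 𝒱') :: post) ∈ 𝒱 c := fun x => by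
    rw [← hv', ← hd x]; exact (v _).2.2
  have he : ∀ x : 𝒱' d, v (pre ++ (⟨d, x⟩ : Homog 𝒱') :: post) = ⟨c, ⟨_, hm x⟩⟩ := fun x =>
    homog_ext (hd x) (hv' _)
  simp only [he]
  constructor
  · intro x y
    rw [← (hf p s c).map_add]
    congr 4
    exact Subtype.ext ((hu pre post d).map_add x y)
  · intro r x
    rw [← (hf p s c).map_smul]
    congr 4
    exact Subtype.ext ((hu pre post d).map_smul r x)

end IsMultilin

namespace IsGradedSymm

variable {f : List (Homog 𝒱) → W}

theorem append_left (hf : IsGradedSymm f) (t : List (Homog 𝒱)) :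
    IsGradedSymm (fun l => f (t ++ l)) := fun pre post x y => by
  simpa using hf (t ++ pre) post x y

theorem sign (hf : IsGradedSymm f) (e : ℤ → ℤ) :
    IsGradedSymm (fun l => (e (totalDeg l)).negOnePow • f l) := fun pre post x y => by
  have h : totalDeg (pre ++ x :: y :: post) = totalDeg (pre ++ y :: x :: post) := by
    simp; omega
  simp only [h]
  rw [hf pre post x y]
  exact smul_comm _ _ _

theorem units_smul (hf : IsGradedSymm f) (u : ℤˣ) : IsGradedSymm (fun l => u • f l) :=
  fun pre post x y => by
  simp only
  rw [hf pre post x y]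
  exact smul_comm _ _ _

theorem shuffleSum {g : List (Homog 𝒱) → List (Homog 𝒱) → W}
    (h₁ : ∀ s, IsGradedSymm (fun p => g p s)) (h₂ : ∀ p, IsGradedSymm (g p)) :
    IsGradedSymm (OpenClosed.shuffleSum g) := by
  intro pre post x y
  induction pre generalizing g with
  | nil =>
    simp only [List.nil_append, OpenClosed.shuffleSum, smul_add, ← shuffleSum_units_smul]
    have e₁ : ∀ J L, g (x :: y :: J) L = (x.1 * y.1).negOnePow • g (y :: x :: J) L :=
      fun J L => h₁ L [] J x y
    have e₂ : ∀ J L, g J (x :: y :: L) = (x.1 * y.1).negOnePow • g J (y :: x :: L) :=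
      fun J L => h₂ J [] L x y
    simp only [e₁, e₂, smul_smul, ← Int.negOnePow_add, totalDeg_cons]
    have a₁ : ∀ J : List (Homog 𝒱), (x.1 * (y.1 + totalDeg J)).negOnePow =
        (x.1 * y.1 + x.1 * totalDeg J).negOnePow := fun J => by rw [mul_add]
    have a₂ : ∀ J : List (Homog 𝒱), (x.1 * y.1 + y.1 * (x.1 + totalDeg J)).negOnePow =
        (y.1 * totalDeg J).negOnePow := fun J => by
      rw [Int.negOnePow_eq_iff]; exact ⟨x.1 * y.1, by ring⟩
    have a₃ : ∀ J : List (Homog 𝒱), y.1 * totalDeg J + (x.1 * totalDeg J + x.1 * y.1) =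
        x.1 * y.1 + (x.1 * totalDeg J + y.1 * totalDeg J) := fun J => by ring
    simp only [a₁, a₂, add_assoc, a₃]
    abel
  | cons a pre ih =>
    simp only [List.cons_append, OpenClosed.shuffleSum, smul_add]
    congr 1
    · exact ih (fun s => (h₁ s).append_left [a]) fun p => h₂ (a :: p)
    · exact ih (fun s => (h₁ (a :: s)).sign fun e => a.1 * e) fun p =>
        ((h₂ p).append_left [a]).units_smul _

theorem splitSum_param {α : Type*} (l : List α) {g : List (Homog 𝒱) → List α → List α → W}
    (h : ∀ p s, IsGradedSymm (fun x => g x p s)) :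
    IsGradedSymm (fun x => OpenClosed.splitSum (g x) l) := fun pre post x y => by
  simp only [← splitSum_units_smul]
  congr 1
  funext p s
  exact h p s pre post x y

theorem shuffleSum_param {V' : Type*} [AddCommGroup V'] [Module k V']
    {𝒱' : ℤ → Submodule k V'} (l : List (Homog 𝒱'))
    {g : List (Homog 𝒱) → List (Homog 𝒱') → List (Homog 𝒱') → W}
    (h : ∀ p s, IsGradedSymm (fun x => g x p s)) :
    IsGradedSymm (fun x => OpenClosed.shuffleSum (g x) l) := fun pre post x y => by
  simp only [← shuffleSum_units_smul]
  congr 1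
  funext p s
  exact h p s pre post x y

theorem comp {V' : Type*} [AddCommGroup V'] [Module k V'] {𝒱' : ℤ → Submodule k V'}
    (hf : IsMultilin f) {u : List (Homog 𝒱') → V} (hu : IsGradedSymm u) (e : ℤ → ℤ)
    (p s : List (Homog 𝒱)) (v : List (Homog 𝒱') → Homog 𝒱)
    (hv : ∀ l, (v l).1 = e (totalDeg l)) (hv' : ∀ l, ((v l).2 : V) = u l) :
    IsGradedSymm (fun l => f (p ++ v l :: s)) := by
  intro pre post x y
  have h : (v (pre ++ x :: y :: post)) =
      ⟨(v (pre ++ y :: x :: post)).1,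
        (x.1 * y.1).negOnePow • (v (pre ++ y :: x :: post)).2⟩ := by
    refine homog_ext ?_ ?_
    · simp only [hv]; congr 1; simp; omega
    · rw [hv', hu pre post x y, ← hv']
      rcases Int.units_eq_one_or (x.1 * y.1).negOnePow with h | h <;> simp [h]
  simp only [h]
  exact isLinearMap_map_units_smul (hf p s _) _ _

end IsGradedSymm

end Lists

section Cochains

variable {k Z A : Type*} [CommRing k] [AddCommGroup Z] [Module k Z] [AddCommGroup A] [Module k A]

/-- The open-closed Hochschild cochains of degree `n`: a cochain `D` assigns to words
`z₁ … z_ℓ` and `a₁ … a_k` of homogeneous elements (`ℓ, k ≥ 0`) an element `D(z₁,…,z_ℓ; a₁,…,a_k)`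
of degree `n + ∑ |zᵢ| + ∑ |aⱼ|`, multilinear in all the inputs and graded symmetric in the `zᵢ`. -/
def cochains (𝒵 : ℤ → Submodule k Z) (𝒜 : ℤ → Submodule k A) (n : ℤ) :
    Submodule k (List (Homog 𝒵) → List (Homog 𝒜) → A) where
  carrier := {f | (∀ zs as, f zs as ∈ 𝒜 (n + totalDeg zs + totalDeg as)) ∧
    (∀ as, IsMultilin (fun zs => f zs as)) ∧ (∀ zs, IsMultilin (f zs)) ∧
    ∀ as, IsGradedSymm (fun zs => f zs as)}
  add_mem' := by
    rintro f g ⟨h₁, h₂, h₃, h₄⟩ ⟨h₁', h₂', h₃', h₄'⟩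
    refine ⟨fun zs as => (𝒜 _).add_mem (h₁ zs as) (h₁' zs as),
      fun as pre post d => isLinearMap_add (h₂ as pre post d) (h₂' as pre post d),
      fun as pre post d => isLinearMap_add (h₃ as pre post d) (h₃' as pre post d),
      fun as pre post x y => ?_⟩
    simp only [Pi.add_apply, smul_add]
    rw [← h₄ as pre post x y, ← h₄' as pre post x y]
  zero_mem' := ⟨fun _ _ => (𝒜 _).zero_mem, fun _ _ _ _ => ⟨by simp, by simp⟩,
    fun _ _ _ _ => ⟨by simp, by simp⟩, fun _ _ _ _ _ => by simp⟩
  smul_mem' := by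
    rintro c f ⟨h₁, h₂, h₃, h₄⟩
    refine ⟨fun zs as => (𝒜 _).smul_mem c (h₁ zs as), fun as pre post d => ⟨fun x y => ?_, fun r x => ?_⟩,
      fun as pre post d => ⟨fun x y => ?_, fun r x => ?_⟩, fun as pre post x y => ?_⟩
    · simp only [Pi.smul_apply, (h₂ as pre post d).map_add, smul_add]
    · simp only [Pi.smul_apply, (h₂ as pre post d).map_smul]
      exact smul_comm _ _ _
    · simp only [Pi.smul_apply, (h₃ as pre post d).map_add, smul_add]
    · simp only [Pi.smul_apply, (h₃ as pre post d).map_smul]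
      exact smul_comm _ _ _
    · simp only [Pi.smul_apply]
      rw [show f (pre ++ x :: y :: post) as = _ from h₄ as pre post x y]
      exact smul_comm _ _ _

variable {𝒵 : ℤ → Submodule k Z} {𝒜 : ℤ → Submodule k A} {m n p : ℤ}

/-- The value `D(z; a)` as a homogeneous element of degree `|D| + |z| + |a|`. -/
def out (D : cochains 𝒵 𝒜 n) (zs : List (Homog 𝒵)) (as : List (Homog 𝒜)) : Homog 𝒜 :=
  ⟨n + totalDeg zs + totalDeg as, ⟨D.1 zs as, D.2.1 zs as⟩⟩

theorem multilin_out {W : Type*} [AddCommGroup W] [Module k W] {f : List (Homog 𝒜) → W}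
    (hf : IsMultilin f) (E : cochains 𝒵 𝒜 n) (zs : List (Homog 𝒵)) (p s : List (Homog 𝒜)) :
    IsMultilin (fun as => f (p ++ out E zs as :: s)) :=
  hf.comp (E.2.2.2.1 zs) (fun e => n + totalDeg zs + e) p s _ (fun _ => rfl) (fun _ => rfl)

theorem multilin_out' {W : Type*} [AddCommGroup W] [Module k W] {f : List (Homog 𝒜) → W}
    (hf : IsMultilin f) (E : cochains 𝒵 𝒜 n) (as : List (Homog 𝒜)) (p s : List (Homog 𝒜)) :
    IsMultilin (fun zs => f (p ++ out E zs as :: s)) :=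
  hf.comp (E.2.2.1 as) (fun e => n + e + totalDeg as) p s _ (fun _ => rfl) (fun _ => rfl)

theorem symm_out {W : Type*} [AddCommGroup W] [Module k W] {f : List (Homog 𝒜) → W}
    (hf : IsMultilin f) (E : cochains 𝒵 𝒜 n) (as : List (Homog 𝒜)) (p s : List (Homog 𝒜)) :
    IsGradedSymm (fun zs => f (p ++ out E zs as :: s)) :=
  IsGradedSymm.comp hf (E.2.2.2.2 as) (fun e => n + e + totalDeg as) p s _ (fun _ => rfl)
    (fun _ => rfl)

/-- The brace `D{E}`:
`∑ (-1)^* D(z_J; a_{I₀}, E(z_L; a_K), a_{I₁})` with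
`* = |a_{I₀}| (|E| + |z_L|) + |z_J| |E| + ε`. -/
def braceFun (D : cochains 𝒵 𝒜 m) (E : cochains 𝒵 𝒜 n) (zs : List (Homog 𝒵))
    (as : List (Homog 𝒜)) : A :=
  shuffleSum (fun J L =>
    splitSum (fun I₀ r =>
      splitSum (fun K I₁ =>
        (totalDeg I₀ * (n + totalDeg L) + totalDeg J * n).negOnePow •
          D.1 J (I₀ ++ out E L K :: I₁)) r) as) zs

/-- The brace `D{E, F}`:
`∑ (-1)^* D(z_J; a_{I₀}, E(z_L; a_K), a_{I₁}, F(z_M; a_N), a_{I₂})` with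
`* = |a_{I₀}| (|E| + |z_L|) + (|a_{I₀}| + |a_K| + |a_{I₁}|) (|F| + |z_M|) + |z_J| |E|`
`+ (|z_J| + |z_L|) |F| + ε`. -/
def brace₂Fun (D : cochains 𝒵 𝒜 m) (E : cochains 𝒵 𝒜 n) (F : cochains 𝒵 𝒜 p)
    (zs : List (Homog 𝒵)) (as : List (Homog 𝒜)) : A :=
  shuffleSum (fun J R =>
    shuffleSum (fun L M =>
      splitSum (fun I₀ r =>
        splitSum (fun K r' =>
          splitSum (fun I₁ r'' =>
            splitSum (fun N I₂ =>
              (totalDeg I₀ * (n + totalDeg L)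
                + (totalDeg I₀ + totalDeg K + totalDeg I₁) * (p + totalDeg M)
                + totalDeg J * n + (totalDeg J + totalDeg L) * p).negOnePow •
                D.1 J (I₀ ++ out E L K :: (I₁ ++ out F M N :: I₂))) r'') r') r) as) R) zs

theorem braceFun_mem (D : cochains 𝒵 𝒜 m) (E : cochains 𝒵 𝒜 n) :
    braceFun D E ∈ cochains 𝒵 𝒜 (m + n) := by
  refine ⟨fun zs as => ?_, fun as => ?_, fun zs => ?_, fun as => ?_⟩
  · refine shuffleSum_mem _ _ fun J L hJ => splitSum_mem _ _ fun I₀ r hr =>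
      splitSum_mem _ _ fun K I₁ hK => units_smul_mem _ _ ?_
    have h := D.2.1 J (I₀ ++ out E L K :: I₁)
    have e : m + totalDeg J + totalDeg (I₀ ++ out E L K :: I₁) =
        m + n + totalDeg zs + totalDeg as := by
      subst hr hK
      simp [out]; omega
    rwa [e] at h
  · refine IsMultilin.shuffleSum (fun L => ?_) fun J => ?_
    · refine IsMultilin.splitSum_param _ fun I₀ r => IsMultilin.splitSum_param _ fun K I₁ => ?_
      exact (D.2.2.1 _).sign fun e => totalDeg I₀ * (n + totalDeg L) + e * n
    · refine IsMultilin.splitSum_param _ fun I₀ r => IsMultilin.splitSum_param _ fun K I₁ => ?_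
      exact (multilin_out' (D.2.2.2.1 J) E K I₀ I₁).sign
        fun e => totalDeg I₀ * (n + e) + totalDeg J * n
  · refine IsMultilin.shuffleSum_param _ fun J L => IsMultilin.splitSum (fun r => ?_) fun I₀ => ?_
    · refine IsMultilin.splitSum_param _ fun K I₁ => ?_
      exact ((D.2.2.2.1 J).append_right _).sign fun e => e * (n + totalDeg L) + totalDeg J * n
    · refine IsMultilin.splitSum (fun I₁ => ?_) fun K => ?_
      · exact (multilin_out (D.2.2.2.1 J) E L I₀ I₁).sign
          fun _ => totalDeg I₀ * (n + totalDeg L) + totalDeg J * n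
      · have h := ((D.2.2.2.1 J).append_left (I₀ ++ [out E L K])).sign
          fun _ => totalDeg I₀ * (n + totalDeg L) + totalDeg J * n
        simpa using h
  · refine IsGradedSymm.shuffleSum (fun L => ?_) fun J => ?_
    · refine IsGradedSymm.splitSum_param _ fun I₀ r =>
        IsGradedSymm.splitSum_param _ fun K I₁ => ?_
      exact (D.2.2.2.2 _).sign fun e => totalDeg I₀ * (n + totalDeg L) + e * n
    · refine IsGradedSymm.splitSum_param _ fun I₀ r =>
        IsGradedSymm.splitSum_param _ fun K I₁ => ?_
      exact (symm_out (D.2.2.2.1 J) E K I₀ I₁).sign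
        fun e => totalDeg I₀ * (n + e) + totalDeg J * n

theorem brace₂Fun_mem (D : cochains 𝒵 𝒜 m) (E : cochains 𝒵 𝒜 n) (F : cochains 𝒵 𝒜 p) :
    brace₂Fun D E F ∈ cochains 𝒵 𝒜 (m + n + p) := by
  refine ⟨fun zs as => ?_, fun as => ?_, fun zs => ?_, fun as => ?_⟩
  · refine shuffleSum_mem _ _ fun J R hJ => shuffleSum_mem _ _ fun L M hL =>
      splitSum_mem _ _ fun I₀ r hr => splitSum_mem _ _ fun K r' hK =>
      splitSum_mem _ _ fun I₁ r'' hI => splitSum_mem _ _ fun N I₂ hN => units_smul_mem _ _ ?_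
    have h := D.2.1 J (I₀ ++ out E L K :: (I₁ ++ out F M N :: I₂))
    have e : m + totalDeg J + totalDeg (I₀ ++ out E L K :: (I₁ ++ out F M N :: I₂)) =
        m + n + p + totalDeg zs + totalDeg as := by
      subst hr hK hI hN
      simp [out]; omega
    rwa [e] at h
  · refine IsMultilin.shuffleSum (fun R => ?_) fun J => ?_
    · refine IsMultilin.shuffleSum_param _ fun L M => IsMultilin.splitSum_param _ fun I₀ r =>
        IsMultilin.splitSum_param _ fun K r' => IsMultilin.splitSum_param _ fun I₁ r'' =>
        IsMultilin.splitSum_param _ fun N I₂ => ?_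
      exact (D.2.2.1 _).sign fun e => totalDeg I₀ * (n + totalDeg L)
        + (totalDeg I₀ + totalDeg K + totalDeg I₁) * (p + totalDeg M)
        + e * n + (e + totalDeg L) * p
    · refine IsMultilin.shuffleSum (fun M => ?_) fun L => ?_
      · refine IsMultilin.splitSum_param _ fun I₀ r =>
          IsMultilin.splitSum_param _ fun K r' => IsMultilin.splitSum_param _ fun I₁ r'' =>
          IsMultilin.splitSum_param _ fun N I₂ => ?_
        exact (multilin_out' (D.2.2.2.1 J) E K I₀ _).sign fun e => totalDeg I₀ * (n + e)
          + (totalDeg I₀ + totalDeg K + totalDeg I₁) * (p + totalDeg M)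
          + totalDeg J * n + (totalDeg J + e) * p
      · refine IsMultilin.splitSum_param _ fun I₀ r =>
          IsMultilin.splitSum_param _ fun K r' => IsMultilin.splitSum_param _ fun I₁ r'' =>
          IsMultilin.splitSum_param _ fun N I₂ => ?_
        have h := (multilin_out' (D.2.2.2.1 J) F N (I₀ ++ out E L K :: I₁) I₂).sign
          fun e => totalDeg I₀ * (n + totalDeg L)
          + (totalDeg I₀ + totalDeg K + totalDeg I₁) * (p + e)
          + totalDeg J * n + (totalDeg J + totalDeg L) * p
        simpa using h
  · refine IsMultilin.shuffleSum_param _ fun J R => IsMultilin.shuffleSum_param _ fun L M =>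
      IsMultilin.splitSum (fun r => ?_) fun I₀ => ?_
    · refine IsMultilin.splitSum_param _ fun K r' => IsMultilin.splitSum_param _ fun I₁ r'' =>
        IsMultilin.splitSum_param _ fun N I₂ => ?_
      exact ((D.2.2.2.1 J).append_right _).sign fun e => e * (n + totalDeg L)
        + (e + totalDeg K + totalDeg I₁) * (p + totalDeg M)
        + totalDeg J * n + (totalDeg J + totalDeg L) * p
    · refine IsMultilin.splitSum (fun r' => ?_) fun K => ?_
      · refine IsMultilin.splitSum_param _ fun I₁ r'' => IsMultilin.splitSum_param _ fun N I₂ => ?_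
        exact (multilin_out (D.2.2.2.1 J) E L I₀ _).sign fun e =>
          totalDeg I₀ * (n + totalDeg L)
          + (totalDeg I₀ + e + totalDeg I₁) * (p + totalDeg M)
          + totalDeg J * n + (totalDeg J + totalDeg L) * p
      · refine IsMultilin.splitSum (fun r'' => ?_) fun I₁ => ?_
        · refine IsMultilin.splitSum_param _ fun N I₂ => ?_
          have h := (((D.2.2.2.1 J).append_left (I₀ ++ [out E L K])).append_right
            (out F M N :: I₂)).sign fun e => totalDeg I₀ * (n + totalDeg L)
            + (totalDeg I₀ + totalDeg K + e) * (p + totalDeg M)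
            + totalDeg J * n + (totalDeg J + totalDeg L) * p
          simpa using h
        · refine IsMultilin.splitSum (fun I₂ => ?_) fun N => ?_
          · have h := (multilin_out (D.2.2.2.1 J) F M (I₀ ++ out E L K :: I₁) I₂).sign
              fun _ => totalDeg I₀ * (n + totalDeg L)
              + (totalDeg I₀ + totalDeg K + totalDeg I₁) * (p + totalDeg M)
              + totalDeg J * n + (totalDeg J + totalDeg L) * p
            simpa using h
          · have h := ((D.2.2.2.1 J).append_left
              (I₀ ++ out E L K :: (I₁ ++ [out F M N]))).sign
              fun _ => totalDeg I₀ * (n + totalDeg L)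
              + (totalDeg I₀ + totalDeg K + totalDeg I₁) * (p + totalDeg M)
              + totalDeg J * n + (totalDeg J + totalDeg L) * p
            simpa using h
  · refine IsGradedSymm.shuffleSum (fun R => ?_) fun J => ?_
    · refine IsGradedSymm.shuffleSum_param _ fun L M => IsGradedSymm.splitSum_param _ fun I₀ r =>
        IsGradedSymm.splitSum_param _ fun K r' => IsGradedSymm.splitSum_param _ fun I₁ r'' =>
        IsGradedSymm.splitSum_param _ fun N I₂ => ?_
      exact (D.2.2.2.2 _).sign fun e => totalDeg I₀ * (n + totalDeg L)
        + (totalDeg I₀ + totalDeg K + totalDeg I₁) * (p + totalDeg M)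
        + e * n + (e + totalDeg L) * p
    · refine IsGradedSymm.shuffleSum (fun M => ?_) fun L => ?_
      · refine IsGradedSymm.splitSum_param _ fun I₀ r =>
          IsGradedSymm.splitSum_param _ fun K r' => IsGradedSymm.splitSum_param _ fun I₁ r'' =>
          IsGradedSymm.splitSum_param _ fun N I₂ => ?_
        exact (symm_out (D.2.2.2.1 J) E K I₀ _).sign fun e => totalDeg I₀ * (n + e)
          + (totalDeg I₀ + totalDeg K + totalDeg I₁) * (p + totalDeg M)
          + totalDeg J * n + (totalDeg J + e) * p
      · refine IsGradedSymm.splitSum_param _ fun I₀ r =>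
          IsGradedSymm.splitSum_param _ fun K r' => IsGradedSymm.splitSum_param _ fun I₁ r'' =>
          IsGradedSymm.splitSum_param _ fun N I₂ => ?_
        have h := (symm_out (D.2.2.2.1 J) F N (I₀ ++ out E L K :: I₁) I₂).sign
          fun e => totalDeg I₀ * (n + totalDeg L)
          + (totalDeg I₀ + totalDeg K + totalDeg I₁) * (p + e)
          + totalDeg J * n + (totalDeg J + totalDeg L) * p
        simpa using h

/-- `D{E}` as a cochain of degree `|D| + |E|`. -/
def brace (D : cochains 𝒵 𝒜 m) (E : cochains 𝒵 𝒜 n) : cochains 𝒵 𝒜 (m + n) :=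
  ⟨braceFun D E, braceFun_mem D E⟩

/-- `D{E, F}` as a cochain of degree `|D| + |E| + |F|`. -/
def brace₂ (D : cochains 𝒵 𝒜 m) (E : cochains 𝒵 𝒜 n) (F : cochains 𝒵 𝒜 p) :
    cochains 𝒵 𝒜 (m + n + p) :=
  ⟨brace₂Fun D E F, brace₂Fun_mem D E F⟩

/-- The Gerstenhaber bracket `[D, E] = D{E} - (-1)^{|D||E|} E{D}`. -/
def bracketFun (D : cochains 𝒵 𝒜 m) (E : cochains 𝒵 𝒜 n) :
    List (Homog 𝒵) → List (Homog 𝒜) → A :=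
  (brace D E).1 - (m * n).negOnePow • (brace E D).1

/-- An `L_∞` algebra structure on the graded module `Z`, in the degree convention in which all
operations `l_ℓ`, `ℓ ≥ 1`, are graded symmetric of degree one. -/
structure LInfinity (𝒵 : ℤ → Submodule k Z) where
  /-- the operations `l_ℓ(z₁, …, z_ℓ)`, for all `ℓ` at once -/
  op : List (Homog 𝒵) → Z
  op_mem : ∀ zs, op zs ∈ 𝒵 (1 + totalDeg zs)
  op_multilin : IsMultilin op
  op_symm : IsGradedSymm op
  /-- there is no operation without inputs -/
  op_nil : op [] = 0
  /-- `∑ (-1)^ε l (l (z_J) ∧ z_L) = 0` -/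
  jacobi : ∀ zs, shuffleSum (fun J L =>
    op ((⟨1 + totalDeg J, ⟨op J, op_mem J⟩⟩ : Homog 𝒵) :: L)) zs = 0

/-- The value `l(z)` as a homogeneous element of degree `1 + |z|`. -/
def LInfinity.out (l : LInfinity 𝒵) (zs : List (Homog 𝒵)) : Homog 𝒵 :=
  ⟨1 + totalDeg zs, ⟨l.op zs, l.op_mem zs⟩⟩

/-- The closed string action `(z; a) ↦ ∑ (-1)^ε D(l(z_J) ∧ z_L; a)`. -/
def closedFun (l : LInfinity 𝒵) (D : cochains 𝒵 𝒜 n) (zs : List (Homog 𝒵))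
    (as : List (Homog 𝒜)) : A :=
  shuffleSum (fun J L => D.1 (l.out J :: L) as) zs

theorem closedFun_mem (l : LInfinity 𝒵) (D : cochains 𝒵 𝒜 n) :
    closedFun l D ∈ cochains 𝒵 𝒜 (n + 1) := by
  refine ⟨fun zs as => ?_, fun as => ?_, fun zs => ?_, fun as => ?_⟩
  · refine shuffleSum_mem _ _ fun J L hJ => ?_
    have h := D.2.1 (l.out J :: L) as
    have e : n + totalDeg (l.out J :: L) + totalDeg as = n + 1 + totalDeg zs + totalDeg as := by
      simp [LInfinity.out]; omega
    rwa [e] at h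
  · refine IsMultilin.shuffleSum (fun L => ?_) fun J => (D.2.2.1 as).append_left [l.out J]
    exact (D.2.2.1 as).comp l.op_multilin (fun e => 1 + e) [] L _ (fun _ => rfl) fun _ => rfl
  · exact IsMultilin.shuffleSum_param _ fun J L => D.2.2.2.1 _
  · refine IsGradedSymm.shuffleSum (fun L => ?_) fun J => (D.2.2.2.2 as).append_left [l.out J]
    exact IsGradedSymm.comp (D.2.2.1 as) l.op_symm (fun e => 1 + e) [] L _ (fun _ => rfl)
      fun _ => rfl

/-- The closed string action of `l` on a cochain of degree `n`, a cochain of degree `n + 1`. -/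
def closed (l : LInfinity 𝒵) (D : cochains 𝒵 𝒜 n) : cochains 𝒵 𝒜 (n + 1) :=
  ⟨closedFun l D, closedFun_mem l D⟩

/-- An open-closed homotopy algebra `(Z, A, l, q)`: an `L_∞` algebra `l` on `Z` and a cochain `q`
of degree one with vanishing component `q_{0,0}` such that `q{q}` is the closed string action of
`l` on `q`. -/
structure OCHA (𝒵 : ℤ → Submodule k Z) (𝒜 : ℤ → Submodule k A) where
  l : LInfinity 𝒵
  q : cochains 𝒵 𝒜 1
  q_nil : q.1 [] [] = 0
  q_rel : (brace q q).1 = (closed l q).1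

/-- A constant symplectic structure of degree `deg` on the graded module `A`. Nondegeneracy means
that each `A_d → Hom(A_{-deg-d}, k)`, `a ↦ ω(a, ·)`, is bijective. -/
structure SymplecticForm (𝒜 : ℤ → Submodule k A) where
  form : A →ₗ[k] A →ₗ[k] k
  deg : ℤ
  skew : ∀ (d e : ℤ) (a : 𝒜 d) (b : 𝒜 e), form a b = (d * e + 1).negOnePow • form b a
  form_eq_zero : ∀ (d e : ℤ) (a : 𝒜 d) (b : 𝒜 e), d + e + deg ≠ 0 → form a b = 0
  nondeg : ∀ d : ℤ, Function.Bijective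
    ((LinearMap.lcomp k k (𝒜 (-deg - d)).subtype).comp (form.comp (𝒜 d).subtype))

/-- The element `x` of degree `e` with `ω(x, a₀) = φ(a₀)` for all `a₀` of the complementary
degree. -/
noncomputable def SymplecticForm.dual (ω : SymplecticForm 𝒜) (e : ℤ)
    (φ : 𝒜 (-ω.deg - e) →ₗ[k] k) : 𝒜 e :=
  (LinearEquiv.ofBijective _ (ω.nondeg e)).symm φ

theorem SymplecticForm.form_dual (ω : SymplecticForm 𝒜) (e : ℤ)
    (φ : 𝒜 (-ω.deg - e) →ₗ[k] k) (a : 𝒜 (-ω.deg - e)) : ω.form (ω.dual e φ) a = φ a :=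
  LinearMap.congr_fun ((LinearEquiv.ofBijective _ (ω.nondeg e)).apply_symm_apply φ) a

theorem SymplecticForm.eq_of_form_eq (ω : SymplecticForm 𝒜) {e : ℤ} {x y : A} (hx : x ∈ 𝒜 e)
    (hy : y ∈ 𝒜 e) (h : ∀ a : 𝒜 (-ω.deg - e), ω.form x a = ω.form y a) : x = y :=
  congrArg Subtype.val ((ω.nondeg e).1 (a₁ := ⟨x, hx⟩) (a₂ := ⟨y, hy⟩) (LinearMap.ext h))

/-- Solving `ω(x, a₀) = φ(w, a₀)` for `x` yields a multilinear function of the word `w`, if the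
right hand side is multilinear. -/
theorem SymplecticForm.dual_multilin (ω : SymplecticForm 𝒜) {V : Type*} [AddCommGroup V]
    [Module k V] {𝒱 : ℤ → Submodule k V} (e : ℤ → ℤ) (φ : List (Homog 𝒱) → Homog 𝒜 → k)
    (hφ : ∀ w d, IsLinearMap k (fun a : 𝒜 d => φ w ⟨d, a⟩))
    (h : ∀ a, IsMultilin (fun w => φ w a)) :
    IsMultilin (fun w => (ω.dual (e (totalDeg w)) (IsLinearMap.mk' _ (hφ w _)) : A)) := by
  intro pre post d
  set c := e (totalDeg pre + (d + totalDeg post)) with hc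
  have key : ∀ x : 𝒱 d, ∃ y ∈ 𝒜 c, y = (ω.dual (e (totalDeg (pre ++ (⟨d, x⟩ : Homog 𝒱) :: post)))
      (IsLinearMap.mk' _ (hφ (pre ++ (⟨d, x⟩ : Homog 𝒱) :: post) _)) : A) ∧
      ∀ a : 𝒜 (-ω.deg - c), ω.form y a = φ (pre ++ (⟨d, x⟩ : Homog 𝒱) :: post) ⟨_, a⟩ := by
    intro x
    have hd : e (totalDeg (pre ++ (⟨d, x⟩ : Homog 𝒱) :: post)) = c := by simp [hc]
    generalize e (totalDeg (pre ++ (⟨d, x⟩ : Homog 𝒱) :: post)) = c' at hd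
    subst hd
    exact ⟨_, Subtype.property _, rfl, fun a => ω.form_dual _ _ a⟩
  choose y hy hy' hya using key
  simp only [← hy']
  refine ⟨fun x x' => ?_, fun r x => ?_⟩
  · refine ω.eq_of_form_eq (hy _) ((𝒜 c).add_mem (hy _) (hy _)) fun a => ?_
    simp only [map_add, LinearMap.add_apply, hya]
    exact (h _ pre post d).map_add x x'
  · refine ω.eq_of_form_eq (hy _) ((𝒜 c).smul_mem r (hy _)) fun a => ?_
    simp only [map_smul, LinearMap.smul_apply, hya]
    exact (h _ pre post d).map_smul r x

theorem SymplecticForm.dual_symm (ω : SymplecticForm 𝒜) {V : Type*} [AddCommGroup V]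
    [Module k V] {𝒱 : ℤ → Submodule k V} (e : ℤ → ℤ) (φ : List (Homog 𝒱) → Homog 𝒜 → k)
    (hφ : ∀ w d, IsLinearMap k (fun a : 𝒜 d => φ w ⟨d, a⟩))
    (h : ∀ a, IsGradedSymm (fun w => φ w a)) :
    IsGradedSymm (fun w => (ω.dual (e (totalDeg w)) (IsLinearMap.mk' _ (hφ w _)) : A)) := by
  intro pre post x y
  have hd : e (totalDeg (pre ++ x :: y :: post)) = e (totalDeg (pre ++ y :: x :: post)) := by
    congr 1; simp; omega
  simp only
  generalize_proofs h₁ h₂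
  revert h₁ h₂
  rw [hd]
  intro h₁ h₂
  refine ω.eq_of_form_eq (Subtype.property _) (units_smul_mem _ _ (Subtype.property _))
    fun a => ?_
  rw [ω.form_dual]
  have : ω.form ((x.1 * y.1).negOnePow • ((ω.dual (e (totalDeg (pre ++ y :: x :: post)))
      (IsLinearMap.mk' _ h₂) : 𝒜 _) : A)) a = (x.1 * y.1).negOnePow •
      ω.form ((ω.dual (e (totalDeg (pre ++ y :: x :: post))) (IsLinearMap.mk' _ h₂) : 𝒜 _) : A) a := by
    rcases Int.units_eq_one_or (x.1 * y.1).negOnePow with h | h <;> simp [h]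
  rw [this, ω.form_dual]
  exact h _ pre post x y

/-- The right hand side of the equation that defines `Δ D`:
`∑_i (-1)^{|a_{[1,i]}| (|a_{[i+1,k]}| + |a₀|)} ω(D(z; a_{i+1}, …, a_k, a₀, a₁, …, a_i), 1)`. -/
def deltaForm (ω : SymplecticForm 𝒜) (one : 𝒜 (-1)) (D : cochains 𝒵 𝒜 m)
    (zs : List (Homog 𝒵)) (as : List (Homog 𝒜)) (a₀ : Homog 𝒜) : k :=
  splitSum (fun p s =>
    (totalDeg p * (totalDeg s + a₀.1)).negOnePow • ω.form (D.1 zs (s ++ a₀ :: p)) one) as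

/-- The right hand side of the equation that defines the cyclic brace `D{E, Δ}`:
`∑ (-1)^* ω(D(z_J; a_{r+1}, …, a_j, E(z_L; a_{j+1}, …, a_i), a_{i+1}, …, a_k, a₀, a₁, …, a_r), 1)`
with `* = |a_{[r+1,j]}| (|E| + |z_L|) + |z_J| |E| + ε + |a_{[1,r]}| (|a_{[r+1,k]}| + |a₀|)`. -/
def cyclicForm (ω : SymplecticForm 𝒜) (one : 𝒜 (-1)) (D : cochains 𝒵 𝒜 m)
    (E : cochains 𝒵 𝒜 n) (zs : List (Homog 𝒵)) (as : List (Homog 𝒜)) (a₀ : Homog 𝒜) : k :=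
  shuffleSum (fun J L =>
    splitSum (fun p r =>
      splitSum (fun I r' =>
        splitSum (fun K I' =>
          (totalDeg I * (n + totalDeg L) + totalDeg J * n
            + totalDeg p * (totalDeg r + a₀.1)).negOnePow •
            ω.form (D.1 J (I ++ out E L K :: (I' ++ a₀ :: p))) one) r') r) as) zs

theorem isMultilin_form (ω : SymplecticForm 𝒜) (b : A) {V : Type*} [AddCommGroup V]
    [Module k V] {𝒱 : ℤ → Submodule k V} {f : List (Homog 𝒱) → A} (hf : IsMultilin f) :
    IsMultilin (fun w => ω.form (f w) b) := fun pre post d =>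
  ⟨fun x y => by simp [(hf pre post d).map_add], fun c x => by simp [(hf pre post d).map_smul]⟩

theorem isGradedSymm_form (ω : SymplecticForm 𝒜) (b : A) {V : Type*} [AddCommGroup V]
    [Module k V] {𝒱 : ℤ → Submodule k V} {f : List (Homog 𝒱) → A} (hf : IsGradedSymm f) :
    IsGradedSymm (fun w => ω.form (f w) b) := fun pre post x y => by
  simp only [hf pre post x y]
  rcases Int.units_eq_one_or (x.1 * y.1).negOnePow with h | h <;> simp [h]

theorem deltaForm_linear (ω : SymplecticForm 𝒜) (one : 𝒜 (-1)) (D : cochains 𝒵 𝒜 m)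
    (zs : List (Homog 𝒵)) (as : List (Homog 𝒜)) (d : ℤ) :
    IsLinearMap k (fun a : 𝒜 d => deltaForm ω one D zs as ⟨d, a⟩) :=
  splitSum_isLinearMap _ fun p s =>
    isLinearMap_units_smul (totalDeg p * (totalDeg s + d)).negOnePow
    (isMultilin_form ω one (D.2.2.2.1 zs) s p d)

theorem cyclicForm_linear (ω : SymplecticForm 𝒜) (one : 𝒜 (-1)) (D : cochains 𝒵 𝒜 m)
    (E : cochains 𝒵 𝒜 n) (zs : List (Homog 𝒵)) (as : List (Homog 𝒜)) (d : ℤ) :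
    IsLinearMap k (fun a : 𝒜 d => cyclicForm ω one D E zs as ⟨d, a⟩) :=
  shuffleSum_isLinearMap _ fun J L => splitSum_isLinearMap _ fun p r =>
    splitSum_isLinearMap _ fun I r' => splitSum_isLinearMap _ fun K I' => by
      have h := isMultilin_form ω one (D.2.2.2.1 J) (I ++ out E L K :: I') p d
      simp only [List.append_assoc, List.cons_append] at h
      exact isLinearMap_units_smul (totalDeg I * (n + totalDeg L) + totalDeg J * n
        + totalDeg p * (totalDeg r + d)).negOnePow h

/-- `(Δ D)(z; a)`: the element of degree `|D| - 1 + |z| + |a|` whose pairing with every `a₀` is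
the sum `deltaForm`. -/
noncomputable def deltaFun (ω : SymplecticForm 𝒜) (one : 𝒜 (-1)) (D : cochains 𝒵 𝒜 m)
    (zs : List (Homog 𝒵)) (as : List (Homog 𝒜)) : A :=
  ω.dual (m - 1 + totalDeg zs + totalDeg as)
    (IsLinearMap.mk' _ (deltaForm_linear ω one D zs as _))

/-- `D{E, Δ}(z; a)`: the element of degree `|D| + |E| - 1 + |z| + |a|` whose pairing with every
`a₀` is the sum `cyclicForm`. -/
noncomputable def cyclicFun (ω : SymplecticForm 𝒜) (one : 𝒜 (-1)) (D : cochains 𝒵 𝒜 m)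
    (E : cochains 𝒵 𝒜 n) (zs : List (Homog 𝒵)) (as : List (Homog 𝒜)) : A :=
  ω.dual (m + n - 1 + totalDeg zs + totalDeg as)
    (IsLinearMap.mk' _ (cyclicForm_linear ω one D E zs as _))

theorem deltaForm_multilin (ω : SymplecticForm 𝒜) (one : 𝒜 (-1)) (D : cochains 𝒵 𝒜 m)
    (zs : List (Homog 𝒵)) (a₀ : Homog 𝒜) :
    IsMultilin (fun as => deltaForm ω one D zs as a₀) := by
  refine IsMultilin.splitSum (fun s => ?_) fun p => ?_
  · have h := (isMultilin_form ω one ((D.2.2.2.1 zs).append_left (s ++ [a₀]))).sign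
      fun e => e * (totalDeg s + a₀.1)
    simpa using h
  · exact (isMultilin_form ω one ((D.2.2.2.1 zs).append_right (a₀ :: p))).sign
      fun e => totalDeg p * (e + a₀.1)

theorem cyclicForm_multilin (ω : SymplecticForm 𝒜) (one : 𝒜 (-1)) (D : cochains 𝒵 𝒜 m)
    (E : cochains 𝒵 𝒜 n) (zs : List (Homog 𝒵)) (a₀ : Homog 𝒜) :
    IsMultilin (fun as => cyclicForm ω one D E zs as a₀) := by
  refine IsMultilin.shuffleSum_param _ fun J L => IsMultilin.splitSum (fun r => ?_) fun p => ?_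
  · refine IsMultilin.splitSum_param _ fun I r' => IsMultilin.splitSum_param _ fun K I' => ?_
    have h := (isMultilin_form ω one ((D.2.2.2.1 J).append_left
      (I ++ out E L K :: (I' ++ [a₀])))).sign fun e => totalDeg I * (n + totalDeg L)
      + totalDeg J * n + e * (totalDeg r + a₀.1)
    simpa using h
  · have key : IsMultilin (splitSum (fun I r' => splitSum (fun K I' =>
        (totalDeg I * (n + totalDeg L) + totalDeg J * n).negOnePow •
          ω.form (D.1 J (I ++ out E L K :: (I' ++ a₀ :: p))) one) r')) := by
      refine IsMultilin.splitSum (fun r' => ?_) fun I => ?_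
      · refine IsMultilin.splitSum_param _ fun K I' => ?_
        exact (isMultilin_form ω one ((D.2.2.2.1 J).append_right _)).sign
          fun e => e * (n + totalDeg L) + totalDeg J * n
      · refine IsMultilin.splitSum (fun I' => ?_) fun K => ?_
        · exact (isMultilin_form ω one (multilin_out (D.2.2.2.1 J) E L I _)).sign
            fun _ => totalDeg I * (n + totalDeg L) + totalDeg J * n
        · have h := (isMultilin_form ω one (((D.2.2.2.1 J).append_left
            (I ++ [out E L K])).append_right (a₀ :: p))).sign
            fun _ => totalDeg I * (n + totalDeg L) + totalDeg J * n
          simpa using h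
    have h := key.sign fun e => totalDeg p * (e + a₀.1)
    simp only [← splitSum_units_smul, smul_smul, ← Int.negOnePow_add] at h
    simpa only [add_comm] using h

theorem deltaFun_mem (ω : SymplecticForm 𝒜) (one : 𝒜 (-1)) (D : cochains 𝒵 𝒜 m) :
    deltaFun ω one D ∈ cochains 𝒵 𝒜 (m - 1) := by
  refine ⟨fun zs as => Subtype.property _, fun as => ?_, fun zs => ?_, fun as => ?_⟩
  · exact ω.dual_multilin (fun e => m - 1 + e + totalDeg as)
      (fun zs => deltaForm ω one D zs as) (fun zs => deltaForm_linear ω one D zs as)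
      fun a₀ => IsMultilin.splitSum_param _ fun p s pre post d =>
        isLinearMap_units_smul _ (isMultilin_form ω one (D.2.2.1 _) pre post d)
  · exact ω.dual_multilin (fun e => m - 1 + totalDeg zs + e) (deltaForm ω one D zs)
      (deltaForm_linear ω one D zs) (deltaForm_multilin ω one D zs)
  · exact ω.dual_symm (fun e => m - 1 + e + totalDeg as)
      (fun zs => deltaForm ω one D zs as) (fun zs => deltaForm_linear ω one D zs as)
      fun a₀ => IsGradedSymm.splitSum_param _ fun p s =>
        (isGradedSymm_form ω one (D.2.2.2.2 _)).units_smul _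

theorem cyclicFun_mem (ω : SymplecticForm 𝒜) (one : 𝒜 (-1)) (D : cochains 𝒵 𝒜 m)
    (E : cochains 𝒵 𝒜 n) : cyclicFun ω one D E ∈ cochains 𝒵 𝒜 (m + n - 1) := by
  refine ⟨fun zs as => Subtype.property _, fun as => ?_, fun zs => ?_, fun as => ?_⟩
  · refine ω.dual_multilin (fun e => m + n - 1 + e + totalDeg as)
      (fun zs => cyclicForm ω one D E zs as) (fun zs => cyclicForm_linear ω one D E zs as)
      fun a₀ => IsMultilin.shuffleSum (fun L => ?_) fun J => ?_
    · refine IsMultilin.splitSum_param _ fun p r => IsMultilin.splitSum_param _ fun I r' =>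
        IsMultilin.splitSum_param _ fun K I' => ?_
      exact (isMultilin_form ω one (D.2.2.1 _)).sign fun e => totalDeg I * (n + totalDeg L)
        + e * n + totalDeg p * (totalDeg r + a₀.1)
    · refine IsMultilin.splitSum_param _ fun p r => IsMultilin.splitSum_param _ fun I r' =>
        IsMultilin.splitSum_param _ fun K I' => ?_
      exact (isMultilin_form ω one (multilin_out' (D.2.2.2.1 J) E K I _)).sign fun e =>
        totalDeg I * (n + e) + totalDeg J * n + totalDeg p * (totalDeg r + a₀.1)
  · exact ω.dual_multilin (fun e => m + n - 1 + totalDeg zs + e) (cyclicForm ω one D E zs)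
      (cyclicForm_linear ω one D E zs) (cyclicForm_multilin ω one D E zs)
  · refine ω.dual_symm (fun e => m + n - 1 + e + totalDeg as)
      (fun zs => cyclicForm ω one D E zs as) (fun zs => cyclicForm_linear ω one D E zs as)
      fun a₀ => IsGradedSymm.shuffleSum (fun L => ?_) fun J => ?_
    · refine IsGradedSymm.splitSum_param _ fun p r => IsGradedSymm.splitSum_param _ fun I r' =>
        IsGradedSymm.splitSum_param _ fun K I' => ?_
      exact (isGradedSymm_form ω one (D.2.2.2.2 _)).sign fun e =>
        totalDeg I * (n + totalDeg L) + e * n + totalDeg p * (totalDeg r + a₀.1)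
    · refine IsGradedSymm.splitSum_param _ fun p r => IsGradedSymm.splitSum_param _ fun I r' =>
        IsGradedSymm.splitSum_param _ fun K I' => ?_
      exact (isGradedSymm_form ω one (symm_out (D.2.2.2.1 J) E K I _)).sign fun e =>
        totalDeg I * (n + e) + totalDeg J * n + totalDeg p * (totalDeg r + a₀.1)

/-- The BV operator `Δ`, of degree `-1`. -/
noncomputable def bvDelta (ω : SymplecticForm 𝒜) (one : 𝒜 (-1)) (D : cochains 𝒵 𝒜 m) :
    cochains 𝒵 𝒜 (m - 1) :=
  ⟨deltaFun ω one D, deltaFun_mem ω one D⟩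

/-- The cyclic brace `D{E, Δ}`, a cochain of degree `|D| + |E| - 1`. -/
noncomputable def cyclicBrace (ω : SymplecticForm 𝒜) (one : 𝒜 (-1)) (D : cochains 𝒵 𝒜 m)
    (E : cochains 𝒵 𝒜 n) : cochains 𝒵 𝒜 (m + n - 1) :=
  ⟨cyclicFun ω one D E, cyclicFun_mem ω one D E⟩

theorem SymplecticForm.form_dual_eq (ω : SymplecticForm 𝒜) {e : ℤ} (φ : Homog 𝒜 → k)
    (hφ : ∀ d, IsLinearMap k (fun a : 𝒜 d => φ ⟨d, a⟩))
    (h0 : ∀ a : Homog 𝒜, e + a.1 + ω.deg ≠ 0 → φ a = 0) (a : Homog 𝒜) :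
    ω.form (ω.dual e (IsLinearMap.mk' _ (hφ _))) a.2 = φ a := by
  obtain ⟨d, a⟩ := a
  by_cases h : e + d + ω.deg = 0
  · obtain rfl : d = -ω.deg - e := by omega
    exact ω.form_dual _ _ a
  · rw [h0 ⟨d, a⟩ h]
    exact ω.form_eq_zero _ _ _ _ h

/-- The equation that defines `Δ D`, for all homogeneous `a₀`. -/
theorem form_bvDelta (ω : SymplecticForm 𝒜) (one : 𝒜 (-1)) (D : cochains 𝒵 𝒜 m)
    (zs : List (Homog 𝒵)) (as : List (Homog 𝒜)) (a₀ : Homog 𝒜) :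
    ω.form ((bvDelta ω one D).1 zs as) a₀.2 = deltaForm ω one D zs as a₀ := by
  refine ω.form_dual_eq (deltaForm ω one D zs as) (deltaForm_linear ω one D zs as)
    (fun a h => ?_) a₀
  refine (Submodule.mem_bot k).1 (splitSum_mem ⊥ _ fun p s hp => units_smul_mem _ _ ?_)
  refine (Submodule.mem_bot k).2 (ω.form_eq_zero _ _ ⟨_, D.2.1 zs (s ++ a :: p)⟩ one ?_)
  subst hp
  simp at h ⊢
  omega

/-- The equation that defines `D{E, Δ}`, for all homogeneous `a₀`. -/
theorem form_cyclicBrace (ω : SymplecticForm 𝒜) (one : 𝒜 (-1)) (D : cochains 𝒵 𝒜 m)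
    (E : cochains 𝒵 𝒜 n) (zs : List (Homog 𝒵)) (as : List (Homog 𝒜)) (a₀ : Homog 𝒜) :
    ω.form ((cyclicBrace ω one D E).1 zs as) a₀.2 = cyclicForm ω one D E zs as a₀ := by
  refine ω.form_dual_eq (cyclicForm ω one D E zs as) (cyclicForm_linear ω one D E zs as)
    (fun a h => ?_) a₀
  refine (Submodule.mem_bot k).1 (shuffleSum_mem ⊥ _ fun J L hJ => splitSum_mem ⊥ _ fun p r hp =>
    splitSum_mem ⊥ _ fun I r' hI => splitSum_mem ⊥ _ fun K I' hK => units_smul_mem _ _ ?_)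
  refine (Submodule.mem_bot k).2 (ω.form_eq_zero _ _
    ⟨_, D.2.1 J (I ++ out E L K :: (I' ++ a :: p))⟩ one ?_)
  subst hp hI hK
  simp [out] at h ⊢
  omega

theorem brace_linear_left (E : cochains 𝒵 𝒜 n) :
    IsLinearMap k (fun D : cochains 𝒵 𝒜 m => (brace D E).1) := by
  have h : ∀ zs as, IsLinearMap k (fun D : cochains 𝒵 𝒜 m => braceFun D E zs as) :=
    fun zs as => shuffleSum_isLinearMap _ fun J L => splitSum_isLinearMap _ fun I r =>
      splitSum_isLinearMap _ fun K I' => isLinearMap_units_smul _ ⟨fun _ _ => rfl, fun _ _ => rfl⟩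
  exact ⟨fun x y => funext fun zs => funext fun as => (h zs as).map_add x y,
    fun c x => funext fun zs => funext fun as => (h zs as).map_smul c x⟩

theorem brace_linear_right (D : cochains 𝒵 𝒜 m) :
    IsLinearMap k (fun E : cochains 𝒵 𝒜 n => (brace D E).1) := by
  have h : ∀ zs as, IsLinearMap k (fun E : cochains 𝒵 𝒜 n => braceFun D E zs as) :=
    fun zs as => shuffleSum_isLinearMap _ fun J L => splitSum_isLinearMap _ fun I r =>
      splitSum_isLinearMap _ fun K I' => isLinearMap_units_smul _
        ⟨fun x y => (D.2.2.2.1 J I I' _).map_add (out x L K).2 (out y L K).2,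
          fun c x => (D.2.2.2.1 J I I' _).map_smul c (out x L K).2⟩
  exact ⟨fun x y => funext fun zs => funext fun as => (h zs as).map_add x y,
    fun c x => funext fun zs => funext fun as => (h zs as).map_smul c x⟩

theorem closed_linear (l : LInfinity 𝒵) :
    IsLinearMap k (fun D : cochains 𝒵 𝒜 n => (closed l D).1) := by
  have h : ∀ zs as, IsLinearMap k (fun D : cochains 𝒵 𝒜 n => closedFun l D zs as) :=
    fun zs as => shuffleSum_isLinearMap _ fun J L => ⟨fun _ _ => rfl, fun _ _ => rfl⟩
  exact ⟨fun x y => funext fun zs => funext fun as => (h zs as).map_add x y,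
    fun c x => funext fun zs => funext fun as => (h zs as).map_smul c x⟩

/-- The open-closed Hochschild differential
`δ D = q{D} - (-1)^{|D|} D{q} + (-1)^{|D|} l̂(D)`. -/
def delta (X : OCHA 𝒵 𝒜) (n : ℤ) : cochains 𝒵 𝒜 n →ₗ[k] cochains 𝒵 𝒜 (n + 1) where
  toFun D := ⟨(brace X.q D).1 - n.negOnePow • (brace D X.q).1 + n.negOnePow • (closed X.l D).1,
    Submodule.add_mem _ (Submodule.sub_mem _ (add_comm 1 n ▸ (brace X.q D).2)
      (units_smul_mem _ _ (brace D X.q).2)) (units_smul_mem _ _ (closed X.l D).2)⟩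
  map_add' D E := Subtype.ext <| by
    simp only [(brace_linear_left X.q).map_add, (brace_linear_right X.q).map_add,
      (closed_linear X.l).map_add, smul_add, Submodule.coe_add]
    abel
  map_smul' c D := Subtype.ext <| by
    simp only [(brace_linear_left X.q).map_smul, (brace_linear_right X.q).map_smul,
      (closed_linear X.l).map_smul, smul_add, smul_sub, Submodule.coe_smul, RingHom.id_apply]
    rw [smul_comm n.negOnePow c, smul_comm n.negOnePow c]

/-- The OCHA is `ω`-cyclic: for `k ≥ 1` inputs `a₁, …, a_k`,
`ω(q(z; a₁, …, a_k), a₀) = (-1)^{|a₀| ∑ |aᵢ|} ω(q(z; a₀, a₁, …, a_{k-1}), a_k)`. -/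
def OCHA.IsCyclic (X : OCHA 𝒵 𝒜) (ω : SymplecticForm 𝒜) : Prop :=
  ∀ (zs : List (Homog 𝒵)) (as : List (Homog 𝒜)) (a a₀ : Homog 𝒜),
    ω.form (X.q.1 zs (as ++ [a])) a₀.2 =
      (a₀.1 * totalDeg (as ++ [a])).negOnePow • ω.form (X.q.1 zs (a₀ :: as)) a.2

/-- `one`, an element of degree `-1`, is a unit of the OCHA. -/
structure OCHA.IsUnit (X : OCHA 𝒵 𝒜) (one : 𝒜 (-1)) : Prop where
  left : ∀ (d : ℤ) (a : 𝒜 d), X.q.1 [] [⟨-1, one⟩, ⟨d, a⟩] = a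
  right : ∀ (d : ℤ) (a : 𝒜 d), (d - 1).negOnePow • X.q.1 [] [⟨d, a⟩, ⟨-1, one⟩] = a
  vanish : ∀ (zs : List (Homog 𝒵)) (as : List (Homog 𝒜)), (⟨-1, one⟩ : Homog 𝒜) ∈ as →
    ¬(zs.length = 0 ∧ as.length = 2) → X.q.1 zs as = 0

/-- The normalized cochains of degree `n`: those that vanish whenever `one` is among the
inputs from `A`. -/
def normalized (𝒵 : ℤ → Submodule k Z) (one : 𝒜 (-1)) (n : ℤ) :
    Submodule k (cochains 𝒵 𝒜 n) where
  carrier := {D | ∀ zs as, (⟨-1, one⟩ : Homog 𝒜) ∈ as → D.1 zs as = 0}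
  add_mem' := fun {f g} hf hg zs as h => by
    change f.1 zs as + g.1 zs as = 0
    rw [hf zs as h, hg zs as h, add_zero]
  zero_mem' := fun _ _ _ => rfl
  smul_mem' := fun c f hf zs as h => by
    change c • f.1 zs as = 0
    rw [hf zs as h, smul_zero]

/-- Normalized cocycles of degree `n`: normalized cochains `D` with `δ D = 0`. -/
def cocycles (X : OCHA 𝒵 𝒜) (one : 𝒜 (-1)) (n : ℤ) :
    Submodule k (List (Homog 𝒵) → List (Homog 𝒜) → A) :=
  (normalized 𝒵 one n ⊓ LinearMap.ker (delta X n)).map (cochains 𝒵 𝒜 n).subtype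

/-- Coboundaries of degree `n`: the `δ B` for normalized cochains `B` of degree `n - 1`. -/
def coboundaries (X : OCHA 𝒵 𝒜) (one : 𝒜 (-1)) (n : ℤ) :
    Submodule k (List (Homog 𝒵) → List (Homog 𝒜) → A) :=
  ((normalized 𝒵 one (n - 1)).map (delta X (n - 1))).map (cochains 𝒵 𝒜 (n - 1 + 1)).subtype

/-- The normalized open-closed Hochschild cohomology in degree `n`: normalized cocycles modulo
coboundaries of normalized cochains. -/
abbrev HH (X : OCHA 𝒵 𝒜) (one : 𝒜 (-1)) (n : ℤ) : Type _ :=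
  cocycles X one n ⧸ (coboundaries X one n).submoduleOf (cocycles X one n)

/-- `x` is the class of `f`; in particular `f` is a normalized cocycle of degree `n`. -/
def IsClassOf {X : OCHA 𝒵 𝒜} {one : 𝒜 (-1)} {n : ℤ} (x : HH X one n)
    (f : List (Homog 𝒵) → List (Homog 𝒜) → A) : Prop :=
  ∃ h : f ∈ cocycles X one n, Submodule.Quotient.mk ⟨f, h⟩ = x

end Cochains

end OpenClosed

set_option linter.unusedSectionVars false

namespace OpenClosed

/-! ### Calculus of sums over cuts and shuffles -/

section Sums

variable {k V W W' : Type*} [CommRing k] [AddCommGroup V] [Module k V] [AddCommGroup W]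
  [Module k W] [AddCommGroup W'] [Module k W'] {α : Type*} {𝒱 : ℤ → Submodule k V}

/-! Since ω is nondegenerate, the cochain identity may be checked after pairing with an arbitrary
homogeneous a₀. The defining equations then turn Δ D and D{E, Δ} into the explicit cyclic sums
`deltaForm` and `cyclicForm`, and everything becomes a signed sum over cuts of the word a and
shuffles of the word z.

Keep the order of D and E fixed and collect q{ΔD, E} + δ(D{E, Δ}) + (δD){E, Δ} + (-1)^{|D|} D{δE,
Δ}. In most terms the unit is paired with the output of D, possibly after rotating an outer q by
cyclicity. Such a term is determined by the relative positions of q, E and a₀ among the inputs of D;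
each position occurs twice, with opposite signs (`cyclic_cancellation`). The terms containing an
operation of the L∞ structure cancel because the closed action is a derivation of the cyclic brace
(`form_closed_cyclicBrace`). Only (q{D}){E, Δ} survives, where the unit is paired with the output of
q. Rotating makes the unit an input of q, so nothing but q_{0,2} contributes
(`OCHA.IsUnit.form_one`). What remains is (-1)^{|ω|} times ω(D{E}, a₀) plus a cross term pairing the
outputs of E and D (`OCHA.IsUnit.cyclicForm_brace`). The same argument computes Δ(q{D, E}) as a
graded difference of the two cross terms (`OCHA.IsUnit.deltaForm_brace₂`). Antisymmetrizing in D and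
E therefore cancels the cross terms and leaves the bracket (`bracketFun_eq`). The factor (-1)^{|ω|}
appears because pairing q_{0,2}(x, y) with the unit gives (-1)^{|x|+|y|} ω(x, y), and |x| + |y| =
-|ω| wherever this is nonzero.

For the operations on cohomology, δ must be compatible with each of them. It anticommutes with Δ by
cyclicity and unitality (`delta_bvDelta`). The pre-Lie identity (`prelie`) makes D{E} a homotopy for
commutativity of the cup product (`delta_brace`), and the cup terms drop out of the antisymmetrized
bracket (`delta_bracket`). The higher identity `brace_brace₂` together with q{q} = l̂(q) gives the
Leibniz rule for the cup product (`delta_cup`). On cocycles the cochain identity becomes the BV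
relation up to δ of (-1)^{|ω|} (D{E, Δ} - (-1)^{|D||E|} E{D, Δ}). This cochain is normalized, and
its (0,0) component vanishes with those of D and E, which gives the third claim.

Each identity between nested sums is proved in the same way: expand both sides, match the terms by
the positions of the inserted cochains, bring the shuffles into the same order, and compare the
exponents of -1 in `ZMod 2`. -/

theorem negOnePow_congr {a b : ℤ} (h : (a : ZMod 2) = b) : a.negOnePow = b.negOnePow := by
  rw [Int.negOnePow_eq_iff]
  have := (ZMod.intCast_eq_intCast_iff_dvd_sub b a 2).1 h.symm
  exact even_iff_two_dvd.2 (by exact_mod_cast this)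

theorem map_units_smul' (F : W →ₗ[k] W') (u : ℤˣ) (x : W) : F (u • x) = u • F x :=
  isLinearMap_map_units_smul F.isLinear u x

theorem map_splitSum (F : W →ₗ[k] W') (g : List α → List α → W) (l : List α) :
    F (splitSum g l) = splitSum (fun p s => F (g p s)) l := by
  induction l generalizing g with
  | nil => rfl
  | cons a l ih => simp only [splitSum, map_add, ih]

theorem map_shuffleSum (F : W →ₗ[k] W') (g : List (Homog 𝒱) → List (Homog 𝒱) → W)
    (l : List (Homog 𝒱)) :
    F (shuffleSum g l) = shuffleSum (fun p s => F (g p s)) l := by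
  induction l generalizing g with
  | nil => rfl
  | cons a l ih => simp only [shuffleSum, map_add, ih, map_units_smul']

theorem splitSum_congr {g g' : List α → List α → W} {l : List α}
    (h : ∀ p s, p ++ s = l → g p s = g' p s) : splitSum g l = splitSum g' l := by
  induction l generalizing g g' with
  | nil => exact h _ _ rfl
  | cons a l ih =>
    simp only [splitSum]
    rw [h _ _ (List.nil_append _), ih fun p s e => h _ _ (by simp [e])]

theorem shuffleSum_congr {g g' : List (Homog 𝒱) → List (Homog 𝒱) → W} {l : List (Homog 𝒱)}
    (h : ∀ J L, totalDeg J + totalDeg L = totalDeg l → g J L = g' J L) :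
    shuffleSum g l = shuffleSum g' l := by
  induction l generalizing g g' with
  | nil => exact h _ _ rfl
  | cons a l ih =>
    simp only [shuffleSum]
    congr 1
    · exact ih fun p s e => h _ _ (by simp; omega)
    · exact ih fun p s e => by rw [h _ _ (by simp; omega)]

theorem splitSum_add (g g' : List α → List α → W) (l : List α) :
    splitSum (fun p s => g p s + g' p s) l = splitSum g l + splitSum g' l := by
  induction l generalizing g g' with
  | nil => rfl
  | cons a l ih => simp only [splitSum, ih]; abel

theorem shuffleSum_add (g g' : List (Homog 𝒱) → List (Homog 𝒱) → W) (l : List (Homog 𝒱)) :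
    shuffleSum (fun p s => g p s + g' p s) l = shuffleSum g l + shuffleSum g' l := by
  induction l generalizing g g' with
  | nil => rfl
  | cons a l ih => simp only [shuffleSum, ih, smul_add]; abel

theorem splitSum_zero (l : List α) : splitSum (fun _ _ => (0 : W)) l = 0 := by
  induction l with
  | nil => rfl
  | cons a l ih => simp only [splitSum, ih, add_zero]

theorem shuffleSum_zero (l : List (Homog 𝒱)) : shuffleSum (fun _ _ => (0 : W)) l = 0 := by
  induction l with
  | nil => rfl
  | cons a l ih => simp only [shuffleSum, ih, add_zero, smul_zero]

theorem splitSum_neg (g : List α → List α → W) (l : List α) :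
    splitSum (fun p s => -g p s) l = -splitSum g l := by
  induction l generalizing g with
  | nil => rfl
  | cons a l ih => simp only [splitSum, ih]; abel

theorem shuffleSum_neg (g : List (Homog 𝒱) → List (Homog 𝒱) → W) (l : List (Homog 𝒱)) :
    shuffleSum (fun p s => -g p s) l = -shuffleSum g l := by
  induction l generalizing g with
  | nil => rfl
  | cons a l ih => simp only [shuffleSum, ih, smul_neg]; abel

theorem splitSum_sub (g g' : List α → List α → W) (l : List α) :
    splitSum (fun p s => g p s - g' p s) l = splitSum g l - splitSum g' l := by
  simp only [sub_eq_add_neg, splitSum_add, splitSum_neg]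

theorem shuffleSum_sub (g g' : List (Homog 𝒱) → List (Homog 𝒱) → W) (l : List (Homog 𝒱)) :
    shuffleSum (fun p s => g p s - g' p s) l = shuffleSum g l - shuffleSum g' l := by
  simp only [sub_eq_add_neg, shuffleSum_add, shuffleSum_neg]

/-- A cut of a word with a distinguished letter is made before or after that letter. -/
theorem splitSum_append_cons (g : List α → List α → W) (l : List α) (x : α) (l' : List α) :
    splitSum g (l ++ x :: l') = splitSum (fun p s => g p (s ++ x :: l')) l +
      splitSum (fun p s => g (l ++ x :: p) s) l' := by
  induction l generalizing g with
  | nil => rfl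
  | cons a l ih =>
    simp only [List.cons_append, splitSum, ih]
    abel

/-- Coassociativity of deconcatenation. The intermediate word r is kept as an argument because the
signs refer to it; on the right it reappears as `p ++ q`. -/
theorem splitSum_assoc (g : List α → List α → List α → List α → W) (l : List α) :
    splitSum (fun r s => splitSum (fun p q => g p q r s) r) l =
      splitSum (fun p t => splitSum (fun q s => g p q (p ++ q) s) t) l := by
  induction l generalizing g with
  | nil => rfl
  | cons a l ih =>
    simp only [splitSum, splitSum_add, ih, List.nil_append, List.cons_append]
    abel

/-- Independent cuts commute. -/
theorem splitSum_comm {β : Type*} (g : List α → List α → List β → List β → W) (l : List α)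
    (l' : List β) :
    splitSum (fun p s => splitSum (fun q t => g p s q t) l') l =
      splitSum (fun q t => splitSum (fun p s => g p s q t) l) l' := by
  induction l generalizing g with
  | nil => rfl
  | cons a l ih => simp only [splitSum, ih, splitSum_add]

theorem splitSum_shuffleSum (g : List α → List α → List (Homog 𝒱) → List (Homog 𝒱) → W)
    (l : List α) (z : List (Homog 𝒱)) :
    splitSum (fun p s => shuffleSum (fun J L => g p s J L) z) l =
      shuffleSum (fun J L => splitSum (fun p s => g p s J L) l) z := by
  induction l generalizing g with
  | nil => rfl
  | cons a l ih => simp only [splitSum, ih, shuffleSum_add]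

/-- Cuts of other words may stand between the two cuts to be re-associated. Being independent of the
inner one, they are first commuted past it; the versions below allow more such cuts, as iterated
braces require. -/
theorem splitSum_assoc_two (g : List α → List α → List α → List α → List α → List α → W)
    (f : List α → List α → List α) (l : List α) :
    splitSum (fun r s => splitSum (fun u v => splitSum (fun p q => g p q u v r s) r) (f r s)) l =
      splitSum (fun p t => splitSum (fun q s => splitSum (fun u v => g p q u v (p ++ q) s)
        (f (p ++ q) s)) t) l := by
  simp only [splitSum_comm _ (f _ _), splitSum_assoc]

theorem splitSum_assoc_three
    (g : List α → List α → List α → List α → List α → List α → List α → List α → W)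
    (f : List α → List α → List α) (f' : List α → List α → List α → List α → List α)
    (l : List α) :
    splitSum (fun r s => splitSum (fun u v => splitSum (fun x y =>
        splitSum (fun p q => g p q x y u v r s) r) (f' u v r s)) (f r s)) l =
      splitSum (fun p t => splitSum (fun q s => splitSum (fun u v => splitSum (fun x y =>
        g p q x y u v (p ++ q) s) (f' u v (p ++ q) s)) (f (p ++ q) s)) t) l := by
  simp only [splitSum_comm _ (f' _ _ _ _), splitSum_assoc_two]

theorem splitSum_assoc_four
    (g : List α → List α → List α → List α → List α → List α → List α → List α → List α →
      List α → W)
    (f : List α → List α → List α) (f' : List α → List α → List α → List α → List α)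
    (f'' : List α → List α → List α → List α → List α → List α → List α)
    (l : List α) :
    splitSum (fun r s => splitSum (fun u v => splitSum (fun x y => splitSum (fun a b =>
        splitSum (fun p q => g p q a b x y u v r s) r) (f'' x y u v r s)) (f' u v r s)) (f r s)) l =
      splitSum (fun p t => splitSum (fun q s => splitSum (fun u v => splitSum (fun x y =>
        splitSum (fun a b => g p q a b x y u v (p ++ q) s) (f'' x y u v (p ++ q) s))
        (f' u v (p ++ q) s)) (f (p ++ q) s)) t) l := by
  simp only [splitSum_comm _ (f'' _ _ _ _ _ _), splitSum_assoc_three]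

theorem splitSum_assoc_five
    (g : List α → List α → List α → List α → List α → List α → List α → List α → List α →
      List α → List α → List α → W)
    (f : List α → List α → List α) (f' : List α → List α → List α → List α → List α)
    (f'' : List α → List α → List α → List α → List α → List α → List α)
    (f₃ : List α → List α → List α → List α → List α → List α → List α → List α → List α)
    (l : List α) :
    splitSum (fun r s => splitSum (fun u v => splitSum (fun x y => splitSum (fun a b =>
        splitSum (fun c d => splitSum (fun p q => g p q c d a b x y u v r s) r)
        (f₃ a b x y u v r s)) (f'' x y u v r s)) (f' u v r s)) (f r s)) l =
      splitSum (fun p t => splitSum (fun q s => splitSum (fun u v => splitSum (fun x y =>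
        splitSum (fun a b => splitSum (fun c d => g p q c d a b x y u v (p ++ q) s)
        (f₃ a b x y u v (p ++ q) s)) (f'' x y u v (p ++ q) s))
        (f' u v (p ++ q) s)) (f (p ++ q) s)) t) l := by
  simp only [splitSum_comm _ (f₃ _ _ _ _ _ _ _ _), splitSum_assoc_four]

theorem shuffleSum_units_smul' (u : ℤˣ) (g : List (Homog 𝒱) → List (Homog 𝒱) → W)
    (l : List (Homog 𝒱)) :
    u • shuffleSum g l = shuffleSum (fun p s => u • g p s) l :=
  (shuffleSum_units_smul u g l).symm

theorem splitSum_units_smul' (u : ℤˣ) (g : List α → List α → W) (l : List α) :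
    u • splitSum g l = splitSum (fun p s => u • g p s) l :=
  (splitSum_units_smul u g l).symm

/-- Koszul signs are symmetric: `z_J ∧ z_L = (-1)^{|z_J||z_L|} z_L ∧ z_J`. -/
theorem shuffleSum_comm (g : List (Homog 𝒱) → List (Homog 𝒱) → W) (l : List (Homog 𝒱)) :
    shuffleSum g l =
      shuffleSum (fun J L => (totalDeg J * totalDeg L).negOnePow • g L J) l := by
  induction l generalizing g with
  | nil => simp [shuffleSum]
  | cons a l ih =>
    simp only [shuffleSum]
    rw [ih (fun J L => g (a :: J) L), ih (fun J L => (a.1 * totalDeg J).negOnePow • g J (a :: L)),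
      add_comm]
    congr 1
    · congr 1
      funext J L
      rw [smul_smul, ← Int.negOnePow_add]
      congr 1
      apply negOnePow_congr
      simp only [totalDeg_cons]
      push_cast
      grind
    · congr 1
      funext J L
      rw [smul_smul, ← Int.negOnePow_add]
      congr 1
      apply negOnePow_congr
      simp only [totalDeg_cons]
      push_cast
      grind

/-- Coassociativity of the shuffle coproduct. -/
theorem shuffleSum_assoc
    (g : List (Homog 𝒱) → List (Homog 𝒱) → List (Homog 𝒱) → W) (l : List (Homog 𝒱)) :
    shuffleSum (fun R M => shuffleSum (fun J L => g J L M) R) l =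
      shuffleSum (fun J R => shuffleSum (fun L M => g J L M) R) l := by
  induction l generalizing g with
  | nil => rfl
  | cons a l ih =>
    simp only [shuffleSum, shuffleSum_add, smul_add, shuffleSum_units_smul', ih, smul_smul,
      ← Int.negOnePow_add]
    rw [add_assoc]
    congr 2
    rw [← ih]
    refine shuffleSum_congr fun R M _ => ?_
    refine shuffleSum_congr fun J L e => ?_
    rw [← e, mul_add, add_comm]

end Sums

/-! ### Linear extension of one input slot -/

section Slots

variable {k V W : Type*} [CommRing k] [AddCommGroup V] [Module k V] [AddCommGroup W]
  [Module k W] {𝒱 : ℤ → Submodule k V} [DirectSum.Decomposition 𝒱]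

/-- A multilinear function, as a function of one letter, extends to a linear map on all of `V`. -/
theorem IsMultilin.exists_linearMap {f : List (Homog 𝒱) → W} (hf : IsMultilin f)
    (pre post : List (Homog 𝒱)) :
    ∃ F : V →ₗ[k] W, ∀ x : Homog 𝒱, f (pre ++ x :: post) = F x.2 := by
  classical
  refine ⟨(DirectSum.toModule k ℤ W fun d => IsLinearMap.mk' _ (hf pre post d)).comp
    (DirectSum.decomposeLinearEquiv 𝒱).toLinearMap, fun x => ?_⟩
  simp [DirectSum.toModule_lof]

end Slots

end OpenClosed

namespace OpenClosed
-- Re-association and exchange in iterated shuffles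
section
variable {k V W : Type*} [CommRing k] [AddCommGroup V] [Module k V] [AddCommGroup W]
  [Module k W] {𝒱 : ℤ → Submodule k V}

/-- `shuffleSum_assoc` with intermediate words that enter through their degrees only. -/
theorem shuffleSum_assoc_eq
    {G : List (Homog 𝒱) → List (Homog 𝒱) → List (Homog 𝒱) → List (Homog 𝒱) → W}
    {g : List (Homog 𝒱) → List (Homog 𝒱) → List (Homog 𝒱) → List (Homog 𝒱) → W}
    {l : List (Homog 𝒱)}
    (h : ∀ R M J L S, totalDeg J + totalDeg L = totalDeg R →
      totalDeg L + totalDeg M = totalDeg S → G R M J L = g J S L M) :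
    shuffleSum (fun R M => shuffleSum (fun J L => G R M J L) R) l =
      shuffleSum (fun J S => shuffleSum (fun L M => g J S L M) S) l := by
  -- The hypothesis holds for every intermediate word of the right degree, so it may be applied with
  -- a concatenation in place of the actual subword; this removes the dependence on R and S and lets
  -- coassociativity apply.
  have h₁ : ∀ R M J L, totalDeg J + totalDeg L = totalDeg R → G R M J L = g J (L ++ M) L M :=
    fun R M J L e => h R M J L _ e (totalDeg_append _ _).symm
  have h₂ : ∀ J S L M, totalDeg L + totalDeg M = totalDeg S → g J (L ++ M) L M = g J S L M :=
    fun J S L M e => by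
      rw [← h₁ (J ++ L) M J L (totalDeg_append _ _).symm]
      exact h _ _ _ _ _ (totalDeg_append _ _).symm e
  calc _ = shuffleSum (fun R M => shuffleSum (fun J L => g J (L ++ M) L M) R) l :=
        shuffleSum_congr fun R M _ => shuffleSum_congr fun J L e => h₁ R M J L e
    _ = shuffleSum (fun J S => shuffleSum (fun L M => g J (L ++ M) L M) S) l :=
        shuffleSum_assoc _ l
    _ = _ := shuffleSum_congr fun J S _ => shuffleSum_congr fun L M e => h₂ J S L M e

/-- `shuffleSum_assoc` followed by an exchange of the last two words. -/
theorem shuffleSum_assoc_swap_eq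
    {G : List (Homog 𝒱) → List (Homog 𝒱) → List (Homog 𝒱) → List (Homog 𝒱) → W}
    {g : List (Homog 𝒱) → List (Homog 𝒱) → List (Homog 𝒱) → List (Homog 𝒱) → W}
    {l : List (Homog 𝒱)}
    (h : ∀ R M J L S, totalDeg J + totalDeg L = totalDeg R →
      totalDeg L + totalDeg M = totalDeg S →
      G R M J L = (totalDeg M * totalDeg L).negOnePow • g J S M L) :
    shuffleSum (fun R M => shuffleSum (fun J L => G R M J L) R) l =
      shuffleSum (fun J S => shuffleSum (fun M L => g J S M L) S) l := by
  rw [shuffleSum_assoc_eq (g := fun J S L M =>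
    (totalDeg M * totalDeg L).negOnePow • g J S M L) h]
  refine shuffleSum_congr fun J S _ => ?_
  rw [shuffleSum_comm (fun M L => g J S M L)]
  exact shuffleSum_congr fun L M _ => by rw [mul_comm]

/-- Exchange of the last two words in an iterated sum over shuffles. -/
theorem shuffleSum_swap_eq
    {G : List (Homog 𝒱) → List (Homog 𝒱) → W} {g : List (Homog 𝒱) → List (Homog 𝒱) → W}
    {l : List (Homog 𝒱)}
    (h : ∀ J L, totalDeg J + totalDeg L = totalDeg l →
      G J L = (totalDeg J * totalDeg L).negOnePow • g L J) :
    shuffleSum G l = shuffleSum g l := by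
  rw [shuffleSum_comm g]
  exact shuffleSum_congr h

/-- Exchange of the first two words in an iterated sum over shuffles. -/
theorem shuffleSum_left_comm_eq
    {G : List (Homog 𝒱) → List (Homog 𝒱) → List (Homog 𝒱) → List (Homog 𝒱) → W}
    {g : List (Homog 𝒱) → List (Homog 𝒱) → List (Homog 𝒱) → List (Homog 𝒱) → W}
    {l : List (Homog 𝒱)}
    (h : ∀ R M J L S, totalDeg J + totalDeg M = totalDeg R →
      totalDeg L + totalDeg M = totalDeg S →
      G J S L M = (totalDeg J * totalDeg L).negOnePow • g L R J M) :
    shuffleSum (fun J S => shuffleSum (fun L M => G J S L M) S) l =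
      shuffleSum (fun L R => shuffleSum (fun J M => g L R J M) R) l := by
  rw [← shuffleSum_assoc_eq (G := fun R M J L => G J (L ++ M) L M) (g := G)
      (fun R M J L S _ e => by
        rw [h (J ++ M) M J L _ (totalDeg_append _ _).symm (totalDeg_append _ _).symm,
          h (J ++ M) M J L S (totalDeg_append _ _).symm e]),
    ← shuffleSum_assoc_eq (G := fun R M L J => g L (J ++ M) J M) (g := g)
      (fun R M L J S _ e => by
        have h₁ := h (J ++ M) M J L (L ++ M) (totalDeg_append _ _).symm (totalDeg_append _ _).symm
        rw [h S M J L (L ++ M) e (totalDeg_append _ _).symm] at h₁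
        exact (smul_left_cancel _ h₁).symm)]
  refine shuffleSum_congr fun R M _ => shuffleSum_swap_eq fun J L _ => ?_
  exact h (J ++ M) M J L (L ++ M) (totalDeg_append _ _).symm (totalDeg_append _ _).symm

end
-- The pre-Lie identity
section
variable {k Z A W : Type*} [CommRing k] [AddCommGroup Z] [Module k Z] [AddCommGroup A] [Module k A]
  [AddCommGroup W] [Module k W]
  {𝒵 : ℤ → Submodule k Z} {𝒜 : ℤ → Submodule k A} [DirectSum.Decomposition 𝒜] {m n p : ℤ}

/-- Multilinearity is linearity within a single degree, whereas the summands of D{E} carry degrees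
that agree only after arithmetic. The extension of the slot to a linear map on all of A lets the sum
be pulled out without comparing degrees. -/
theorem apply_out_brace {f : List (Homog 𝒜) → W} (hf : IsMultilin f) (D : cochains 𝒵 𝒜 m)
    (E : cochains 𝒵 𝒜 n) (pre post : List (Homog 𝒜)) (zs : List (Homog 𝒵))
    (as : List (Homog 𝒜)) :
    f (pre ++ out (brace D E) zs as :: post) =
      shuffleSum (fun J L => splitSum (fun I₀ r => splitSum (fun K I₁ =>
        (totalDeg I₀ * (n + totalDeg L) + totalDeg J * n).negOnePow •
          f (pre ++ out D J (I₀ ++ out E L K :: I₁) :: post)) r) as) zs := by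
  obtain ⟨F, hF⟩ := hf.exists_linearMap pre post
  simp only [hF, out, brace, braceFun, map_shuffleSum, map_splitSum, map_units_smul']

theorem out_fst (D : cochains 𝒵 𝒜 m) (zs : List (Homog 𝒵)) (as : List (Homog 𝒜)) :
    (out D zs as).1 = m + totalDeg zs + totalDeg as := rfl

theorem brace_apply (D : cochains 𝒵 𝒜 m)
    (E : cochains 𝒵 𝒜 n) (zs : List (Homog 𝒵)) (as : List (Homog 𝒜)) :
    (brace D E).1 zs as = shuffleSum (fun J L =>
    splitSum (fun I₀ r =>
      splitSum (fun K I₁ =>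
        (totalDeg I₀ * (n + totalDeg L) + totalDeg J * n).negOnePow •
          D.1 J (I₀ ++ out E L K :: I₁)) r) as) zs := rfl

theorem brace₂_apply (D : cochains 𝒵 𝒜 m) (E : cochains 𝒵 𝒜 n) (F : cochains 𝒵 𝒜 p)
    (zs : List (Homog 𝒵)) (as : List (Homog 𝒜)) : (brace₂ D E F).1 zs as =
  shuffleSum (fun J R =>
    shuffleSum (fun L M =>
      splitSum (fun I₀ r =>
        splitSum (fun K r' =>
          splitSum (fun I₁ r'' =>
            splitSum (fun N I₂ =>
              (totalDeg I₀ * (n + totalDeg L)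
                + (totalDeg I₀ + totalDeg K + totalDeg I₁) * (p + totalDeg M)
                + totalDeg J * n + (totalDeg J + totalDeg L) * p).negOnePow •
                D.1 J (I₀ ++ out E L K :: (I₁ ++ out F M N :: I₂))) r'') r') r) as) R) zs := rfl

/-- When F is inserted into the inputs of D{E}, it lands inside E, after E or before E. These three
positions are the three summands; in the last one F and E have changed order, which costs the sign
(-1)^{|E||F|}. -/
theorem prelie (D : cochains 𝒵 𝒜 m) (E : cochains 𝒵 𝒜 n) (F : cochains 𝒵 𝒜 p) :
    (brace (brace D E) F).1 = (brace D (brace E F)).1 + (brace₂ D E F).1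
      + (n * p).negOnePow • (brace₂ D F E).1 := by
  funext zs as
  simp only [Pi.add_apply, Pi.smul_apply]
  simp only [brace_apply, brace₂_apply, apply_out_brace (D.2.2.2.1 _), splitSum_append_cons,
    splitSum_shuffleSum, splitSum_add, shuffleSum_add, shuffleSum_units_smul',
    splitSum_units_smul', smul_smul, ← Int.negOnePow_add, splitSum_assoc, splitSum_assoc_two,
    smul_add, List.append_assoc, List.cons_append]
  rw [add_comm (shuffleSum _ _) (shuffleSum _ _)]
  refine congrArg₂ (· + ·) (congrArg₂ (· + ·) ?_ ?_) ?_
  · refine shuffleSum_assoc_eq fun R M J L S h1 h2 => ?_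
    refine splitSum_congr fun _ _ _ => splitSum_congr fun _ _ _ => splitSum_congr fun _ _ _ =>
      splitSum_congr fun _ _ _ => ?_
    congr 1
    apply negOnePow_congr
    simp only [totalDeg_append, ← h1, ← h2]
    push_cast
    grind
  · refine shuffleSum_assoc_eq fun R M J L S h1 h2 => ?_
    refine splitSum_congr fun _ _ _ => splitSum_congr fun _ _ _ => splitSum_congr fun _ _ _ =>
      splitSum_congr fun _ _ _ => ?_
    congr 1
    apply negOnePow_congr
    simp only [totalDeg_append, ← h1]
    push_cast
    grind
  · refine shuffleSum_assoc_swap_eq fun R M J L S h1 h2 => ?_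
    simp only [splitSum_units_smul', smul_smul, ← Int.negOnePow_add]
    refine splitSum_congr fun _ _ _ => splitSum_congr fun _ _ _ => splitSum_congr fun _ _ _ =>
      splitSum_congr fun _ _ _ => ?_
    congr 1
    apply negOnePow_congr
    simp only [totalDeg_append, totalDeg_cons, out_fst, ← h1]
    push_cast
    grind
end
end OpenClosed

namespace OpenClosed
-- Shuffles into four words
section
variable {k V W : Type*} [CommRing k] [AddCommGroup V] [Module k V] [AddCommGroup W]
  [Module k W] {𝒱 : ℤ → Submodule k V}

/-- Exchange of the last two words in a left-nested iterated sum over shuffles. -/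
theorem shuffleSum_right_comm_eq
    {G g : List (Homog 𝒱) → List (Homog 𝒱) → List (Homog 𝒱) → List (Homog 𝒱) → W}
    {l : List (Homog 𝒱)}
    (h : ∀ R M J L S, totalDeg J + totalDeg L = totalDeg R →
      totalDeg J + totalDeg M = totalDeg S →
      G R M J L = (totalDeg M * totalDeg L).negOnePow • g S L J M) :
    shuffleSum (fun R M => shuffleSum (fun J L => G R M J L) R) l =
      shuffleSum (fun S L => shuffleSum (fun J M => g S L J M) S) l := by
  rw [shuffleSum_assoc_swap_eq (g := fun J S M L => g (J ++ M) L J M)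
    (fun R M J L S e _ => h R M J L _ e (totalDeg_append _ _).symm)]
  refine (shuffleSum_assoc_eq fun S L J M R e e' => ?_).symm
  have h₁ := h (J ++ L) M J L S (totalDeg_append _ _).symm e
  rw [h (J ++ L) M J L (J ++ M) (totalDeg_append _ _).symm (totalDeg_append _ _).symm] at h₁
  exact (smul_left_cancel _ h₁).symm

/-- Independent sums over shuffles commute. -/
theorem shuffleSum_shuffleSum_comm
    (g : List (Homog 𝒱) → List (Homog 𝒱) → List (Homog 𝒱) → List (Homog 𝒱) → W)
    (l l' : List (Homog 𝒱)) :
    shuffleSum (fun J L => shuffleSum (fun J' L' => g J L J' L') l') l =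
      shuffleSum (fun J' L' => shuffleSum (fun J L => g J L J' L') l) l' := by
  induction l generalizing g with
  | nil => rfl
  | cons a l ih =>
    simp only [shuffleSum, ih, shuffleSum_add, shuffleSum_units_smul']

/-- The sum over all partitions of a word into four ordered pieces, with the Koszul sign. -/
def shuffleSum₄ (c : List (Homog 𝒱) → List (Homog 𝒱) → List (Homog 𝒱) → List (Homog 𝒱) → W)
    (l : List (Homog 𝒱)) : W :=
  shuffleSum (fun J U => shuffleSum (fun P S => shuffleSum (fun L M => c J P L M) S) U) l

variable {G g : List (Homog 𝒱) → List (Homog 𝒱) → List (Homog 𝒱) → List (Homog 𝒱) →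
    List (Homog 𝒱) → List (Homog 𝒱) → W}
  {c : List (Homog 𝒱) → List (Homog 𝒱) → List (Homog 𝒱) → List (Homog 𝒱) → W}
  {l : List (Homog 𝒱)}

/-- The variants that follow are the bracketings of a four-fold shuffle met in braces of braces. If
J, P, L, M are the closed inputs of Q, G, D, E, then `pairs` belongs to (Q{G}){D, E}, `right` to
Q{G{D, E}}, `last` to (Q{D, E}){G}, `middle_left` to Q{G{D}, E} and `middle_right` to Q{D, G{E}}.
The `swap` versions have D{G} or E{G} instead, and `second` splits P off first, as the closed action
does. The sign in each hypothesis is the Koszul sign for moving P to its place. -/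
theorem shuffleSum₄_of_pairs (h : ∀ R S J P L M, totalDeg J + totalDeg P = totalDeg R →
      totalDeg L + totalDeg M = totalDeg S → G R S J P L M = c J P L M) :
    shuffleSum (fun R S => shuffleSum (fun L M => shuffleSum (fun J P => G R S J P L M) R) S) l =
      shuffleSum₄ c l := by
  rw [shuffleSum₄, ← shuffleSum_assoc fun J P S => shuffleSum (fun L M => c J P L M) S]
  refine shuffleSum_congr fun R S _ => ?_
  rw [shuffleSum_shuffleSum_comm]
  exact shuffleSum_congr fun J P e => shuffleSum_congr fun L M e' => h _ _ _ _ _ _ e e'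

theorem shuffleSum₄_of_right (h : ∀ U S J P L M, totalDeg P + totalDeg S = totalDeg U →
      totalDeg L + totalDeg M = totalDeg S → G U S J P L M = c J P L M) :
    shuffleSum (fun J U => shuffleSum (fun P S => shuffleSum (fun L M => G U S J P L M) S) U) l =
      shuffleSum₄ c l :=
  shuffleSum_congr fun _ _ _ => shuffleSum_congr fun _ _ e => shuffleSum_congr fun _ _ e' =>
    h _ _ _ _ _ _ e e'

theorem shuffleSum₄_of_last (h : ∀ R S J P L M, totalDeg J + totalDeg S = totalDeg R →
      totalDeg L + totalDeg M = totalDeg S → G R S J P L M =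
        (totalDeg P * (totalDeg L + totalDeg M)).negOnePow • c J P L M) :
    shuffleSum (fun R P => shuffleSum (fun J S => shuffleSum (fun L M => G R S J P L M) S) R) l =
      shuffleSum₄ c l := by
  rw [shuffleSum₄]
  refine shuffleSum_assoc_swap_eq fun R P J S U e _ => ?_
  rw [shuffleSum_units_smul']
  refine shuffleSum_congr fun L M e' => ?_
  rw [← e', h _ _ _ _ _ _ e e']

theorem shuffleSum₄_of_second (h : ∀ R S J P L M, totalDeg J + totalDeg S = totalDeg R →
      totalDeg L + totalDeg M = totalDeg S → G R S J P L M =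
        (totalDeg J * totalDeg P).negOnePow • c J P L M) :
    shuffleSum (fun P R => shuffleSum (fun J S => shuffleSum (fun L M => G R S J P L M) S) R) l =
      shuffleSum₄ c l := by
  rw [shuffleSum₄]
  refine (shuffleSum_left_comm_eq fun R S J P U e₁ _ => ?_).symm
  rw [shuffleSum_units_smul']
  refine shuffleSum_congr fun L M e' => ?_
  rw [h R S J P L M e₁ e', smul_smul, ← Int.negOnePow_add, Int.negOnePow_even _ ⟨_, rfl⟩,
    one_smul]

theorem shuffleSum₄_of_middle_left (h : ∀ U T J P L M, totalDeg T + totalDeg M = totalDeg U →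
      totalDeg P + totalDeg L = totalDeg T → G U T J P L M = c J P L M) :
    shuffleSum (fun J U => shuffleSum (fun T M => shuffleSum (fun P L => G U T J P L M) T) U) l =
      shuffleSum₄ c l :=
  shuffleSum_congr fun J U _ => by
    rw [← shuffleSum_assoc fun P L M => c J P L M]
    exact shuffleSum_congr fun T M e => shuffleSum_congr fun P L e' => h _ _ _ _ _ _ e e'

theorem shuffleSum₄_of_middle_left_swap
    (h : ∀ U T J P L M, totalDeg T + totalDeg M = totalDeg U →
      totalDeg P + totalDeg L = totalDeg T → G U T J P L M =
        (totalDeg P * totalDeg L).negOnePow • c J P L M) :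
    shuffleSum (fun J U => shuffleSum (fun T M => shuffleSum (fun L P => G U T J P L M) T) U) l =
      shuffleSum₄ c l := by
  refine (shuffleSum_congr fun J U _ => shuffleSum_congr fun T M _ =>
    shuffleSum_swap_eq (g := fun P L => (totalDeg P * totalDeg L).negOnePow • G U T J P L M)
      fun L P _ => ?_).trans
    (shuffleSum₄_of_middle_left fun U T J P L M e e' => ?_)
  · rw [smul_smul, ← Int.negOnePow_add, Int.negOnePow_even _ ⟨totalDeg P * totalDeg L, by ring⟩,
      one_smul]
  · rw [h _ _ _ _ _ _ e e', smul_smul, ← Int.negOnePow_add, Int.negOnePow_even _ ⟨_, rfl⟩,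
      one_smul]

theorem shuffleSum₄_of_middle_right
    (h : ∀ U T J P L M, totalDeg L + totalDeg T = totalDeg U →
      totalDeg P + totalDeg M = totalDeg T → G U T J P L M =
        (totalDeg P * totalDeg L).negOnePow • c J P L M) :
    shuffleSum (fun J U => shuffleSum (fun L T => shuffleSum (fun P M => G U T J P L M) T) U) l =
      shuffleSum₄ c l := by
  refine shuffleSum_congr fun J U e => ?_
  refine (shuffleSum_congr (g' := fun L T => shuffleSum (fun P M =>
    (totalDeg P * totalDeg L).negOnePow • c J P L M) T) fun L T e =>
    shuffleSum_congr fun P M e' => h _ _ _ _ _ _ e e').trans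
    (shuffleSum_left_comm_eq fun _ _ L P _ _ _ => ?_)
  rw [mul_comm]

theorem shuffleSum₄_of_middle_right_swap
    (h : ∀ U T J P L M, totalDeg L + totalDeg T = totalDeg U →
      totalDeg P + totalDeg M = totalDeg T → G U T J P L M =
        (totalDeg P * (totalDeg L + totalDeg M)).negOnePow • c J P L M) :
    shuffleSum (fun J U => shuffleSum (fun L T => shuffleSum (fun M P => G U T J P L M) T) U) l =
      shuffleSum₄ c l := by
  refine (shuffleSum_congr fun J U _ => shuffleSum_congr fun L T _ =>
    shuffleSum_swap_eq (g := fun P M => (totalDeg P * totalDeg M).negOnePow • G U T J P L M)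
      fun M P _ => ?_).trans
    (shuffleSum₄_of_middle_right fun U T J P L M e e' => ?_)
  · rw [smul_smul, ← Int.negOnePow_add, Int.negOnePow_even _ ⟨totalDeg P * totalDeg M, by ring⟩,
      one_smul]
  · rw [h _ _ _ _ _ _ e e', smul_smul, ← Int.negOnePow_add]
    congr 1
    apply negOnePow_congr
    push_cast
    grind

/-- Both bracketings are brought to the normal form `shuffleSum₄`, the common summand being one of
the given ones with concatenations as intermediate words. The hypothesis may be used for this since
it constrains intermediate words only by their degrees. The other comparisons below work alike. -/
theorem shuffleSum_pairs_eq_last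
    (h : ∀ R S R' S' J P L M, totalDeg J + totalDeg P = totalDeg R →
      totalDeg L + totalDeg M = totalDeg S →
      totalDeg J + totalDeg S' = totalDeg R' →
      totalDeg L + totalDeg M = totalDeg S' →
      G R S J P L M =
          (totalDeg P * totalDeg L + totalDeg P * totalDeg M).negOnePow • g R' S' J P L M) :
    shuffleSum (fun R S => shuffleSum (fun L M => shuffleSum (fun J P => G R S J P L M) R) S) l =
      shuffleSum (fun R P => shuffleSum (fun J S => shuffleSum (fun L M => g R S J P L M) S) R) l := by
  refine (shuffleSum₄_of_pairs (c := fun J P L M => G (J ++ P) (L ++ M) J P L M) ?_).trans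
    (shuffleSum₄_of_last ?_).symm
  · intro R S J P L M e₁ e₂
    have h₁ := h R S (J ++ (L ++ M)) (L ++ M) J P L M e₁ e₂ (by simp) (by simp)
    rw [← h (J ++ P) (L ++ M) (J ++ (L ++ M)) (L ++ M) J P L M (by simp)
      (by simp) (by simp) (by simp)] at h₁
    exact h₁
  · intro R S J P L M e₁ e₂
    rw [h (J ++ P) (L ++ M) R S J P L M (by simp) (by simp) e₁ e₂]
    simp only [smul_smul, ← Int.negOnePow_add]
    rw [Int.negOnePow_even _ ⟨totalDeg P * totalDeg L + totalDeg P * totalDeg M, by ring⟩, one_smul]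

theorem shuffleSum_pairs_eq_middle_left
    (h : ∀ R S R' S' J P L M, totalDeg J + totalDeg P = totalDeg R →
      totalDeg L + totalDeg M = totalDeg S →
      totalDeg S' + totalDeg M = totalDeg R' →
      totalDeg P + totalDeg L = totalDeg S' →
      G R S J P L M = g R' S' J P L M) :
    shuffleSum (fun R S => shuffleSum (fun L M => shuffleSum (fun J P => G R S J P L M) R) S) l =
      shuffleSum (fun J R => shuffleSum (fun S M => shuffleSum (fun P L => g R S J P L M) S) R) l := by
  refine (shuffleSum₄_of_pairs (c := fun J P L M => G (J ++ P) (L ++ M) J P L M) ?_).trans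
    (shuffleSum₄_of_middle_left ?_).symm
  · intro R S J P L M e₁ e₂
    have h₁ := h R S ((P ++ L) ++ M) (P ++ L) J P L M e₁ e₂ (by simp [add_assoc]) (by simp)
    rw [← h (J ++ P) (L ++ M) ((P ++ L) ++ M) (P ++ L) J P L M (by simp)
      (by simp) (by simp [add_assoc]) (by simp)] at h₁
    exact h₁
  · intro R S J P L M e₁ e₂
    exact (h (J ++ P) (L ++ M) R S J P L M (by simp) (by simp) e₁ e₂).symm

theorem shuffleSum_pairs_eq_right
    (h : ∀ R S R' S' J P L M, totalDeg J + totalDeg P = totalDeg R →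
      totalDeg L + totalDeg M = totalDeg S →
      totalDeg P + totalDeg S' = totalDeg R' →
      totalDeg L + totalDeg M = totalDeg S' →
      G R S J P L M = g R' S' J P L M) :
    shuffleSum (fun R S => shuffleSum (fun L M => shuffleSum (fun J P => G R S J P L M) R) S) l =
      shuffleSum (fun J R => shuffleSum (fun P S => shuffleSum (fun L M => g R S J P L M) S) R) l := by
  refine (shuffleSum₄_of_pairs (c := fun J P L M => G (J ++ P) (L ++ M) J P L M) ?_).trans
    (shuffleSum₄_of_right ?_).symm
  · intro R S J P L M e₁ e₂
    have h₁ := h R S (P ++ (L ++ M)) (L ++ M) J P L M e₁ e₂ (by simp) (by simp)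
    rw [← h (J ++ P) (L ++ M) (P ++ (L ++ M)) (L ++ M) J P L M (by simp)
      (by simp) (by simp) (by simp)] at h₁
    exact h₁
  · intro R S J P L M e₁ e₂
    exact (h (J ++ P) (L ++ M) R S J P L M (by simp) (by simp) e₁ e₂).symm

theorem shuffleSum_pairs_eq_middle_right
    (h : ∀ R S R' S' J P L M, totalDeg J + totalDeg P = totalDeg R →
      totalDeg L + totalDeg M = totalDeg S →
      totalDeg L + totalDeg S' = totalDeg R' →
      totalDeg P + totalDeg M = totalDeg S' →
      G R S J P L M = (totalDeg P * totalDeg L).negOnePow • g R' S' J P L M) :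
    shuffleSum (fun R S => shuffleSum (fun L M => shuffleSum (fun J P => G R S J P L M) R) S) l =
      shuffleSum (fun J R => shuffleSum (fun L S => shuffleSum (fun P M => g R S J P L M) S) R) l := by
  refine (shuffleSum₄_of_pairs (c := fun J P L M => G (J ++ P) (L ++ M) J P L M) ?_).trans
    (shuffleSum₄_of_middle_right ?_).symm
  · intro R S J P L M e₁ e₂
    have h₁ := h R S (L ++ (P ++ M)) (P ++ M) J P L M e₁ e₂ (by simp) (by simp)
    rw [← h (J ++ P) (L ++ M) (L ++ (P ++ M)) (P ++ M) J P L M (by simp)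
      (by simp) (by simp) (by simp)] at h₁
    exact h₁
  · intro R S J P L M e₁ e₂
    rw [h (J ++ P) (L ++ M) R S J P L M (by simp) (by simp) e₁ e₂]
    simp only [smul_smul, ← Int.negOnePow_add]
    rw [Int.negOnePow_even _ ⟨totalDeg P * totalDeg L, by ring⟩, one_smul]

theorem shuffleSum_middle_left_swap_eq_last
    (h : ∀ R S R' S' J P L M, totalDeg S + totalDeg M = totalDeg R →
      totalDeg P + totalDeg L = totalDeg S →
      totalDeg J + totalDeg S' = totalDeg R' →
      totalDeg L + totalDeg M = totalDeg S' →
      G R S J P L M = (totalDeg P * totalDeg M).negOnePow • g R' S' J P L M) :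
    shuffleSum (fun J R => shuffleSum (fun S M => shuffleSum (fun L P => G R S J P L M) S) R) l =
      shuffleSum (fun R P => shuffleSum (fun J S => shuffleSum (fun L M => g R S J P L M) S) R) l := by
  refine (shuffleSum₄_of_middle_left_swap
      (c := fun J P L M => (totalDeg P * totalDeg L).negOnePow •
        G ((P ++ L) ++ M) (P ++ L) J P L M) ?_).trans
    (shuffleSum₄_of_last ?_).symm
  · intro R S J P L M e₁ e₂
    have h₁ := h R S (J ++ (L ++ M)) (L ++ M) J P L M e₁ e₂ (by simp) (by simp)
    rw [← h ((P ++ L) ++ M) (P ++ L) (J ++ (L ++ M)) (L ++ M) J P L M (by simp [add_assoc])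
      (by simp) (by simp) (by simp)] at h₁
    rw [h₁, smul_smul, ← Int.negOnePow_add,
        Int.negOnePow_even _ ⟨totalDeg P * totalDeg L, by ring⟩, one_smul]
  · intro R S J P L M e₁ e₂
    rw [h ((P ++ L) ++ M) (P ++ L) R S J P L M (by simp [add_assoc]) (by simp) e₁ e₂]
    simp only [smul_smul, ← Int.negOnePow_add]
    rw [Int.negOnePow_even _ ⟨totalDeg P * totalDeg L + totalDeg P * totalDeg M, by ring⟩, one_smul]

theorem shuffleSum_middle_right_swap_eq_last
    (h : ∀ R S R' S' J P L M, totalDeg L + totalDeg S = totalDeg R →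
      totalDeg P + totalDeg M = totalDeg S →
      totalDeg J + totalDeg S' = totalDeg R' →
      totalDeg L + totalDeg M = totalDeg S' →
      G R S J P L M = g R' S' J P L M) :
    shuffleSum (fun J R => shuffleSum (fun L S => shuffleSum (fun M P => G R S J P L M) S) R) l =
      shuffleSum (fun R P => shuffleSum (fun J S => shuffleSum (fun L M => g R S J P L M) S) R) l := by
  refine (shuffleSum₄_of_middle_right_swap
      (c := fun J P L M => (totalDeg P * totalDeg L + totalDeg P * totalDeg M).negOnePow •
        G (L ++ (P ++ M)) (P ++ M) J P L M) ?_).trans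
    (shuffleSum₄_of_last ?_).symm
  · intro R S J P L M e₁ e₂
    have h₁ := h R S (J ++ (L ++ M)) (L ++ M) J P L M e₁ e₂ (by simp) (by simp)
    rw [← h (L ++ (P ++ M)) (P ++ M) (J ++ (L ++ M)) (L ++ M) J P L M (by simp)
      (by simp) (by simp) (by simp)] at h₁
    rw [h₁, smul_smul, ← Int.negOnePow_add,
        Int.negOnePow_even _ ⟨totalDeg P * totalDeg L + totalDeg P * totalDeg M, by ring⟩, one_smul]
  · intro R S J P L M e₁ e₂
    rw [h (L ++ (P ++ M)) (P ++ M) R S J P L M (by simp) (by simp) e₁ e₂]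
    simp only [smul_smul, ← Int.negOnePow_add]
    rw [Int.negOnePow_even _ ⟨totalDeg P * totalDeg L + totalDeg P * totalDeg M, by ring⟩, one_smul]

theorem shuffleSum_middle_left_eq_second
    (h : ∀ R S R' S' J P L M, totalDeg S + totalDeg M = totalDeg R →
      totalDeg P + totalDeg L = totalDeg S →
      totalDeg J + totalDeg S' = totalDeg R' →
      totalDeg L + totalDeg M = totalDeg S' →
      G R S J P L M = (totalDeg J * totalDeg P).negOnePow • g R' S' J P L M) :
    shuffleSum (fun J R => shuffleSum (fun S M => shuffleSum (fun P L => G R S J P L M) S) R) l =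
      shuffleSum (fun P R => shuffleSum (fun J S => shuffleSum (fun L M => g R S J P L M) S) R) l := by
  refine (shuffleSum₄_of_middle_left
      (c := fun J P L M => G ((P ++ L) ++ M) (P ++ L) J P L M) ?_).trans
    (shuffleSum₄_of_second ?_).symm
  · intro R S J P L M e₁ e₂
    have h₁ := h R S (J ++ (L ++ M)) (L ++ M) J P L M e₁ e₂ (by simp) (by simp)
    rw [← h ((P ++ L) ++ M) (P ++ L) (J ++ (L ++ M)) (L ++ M) J P L M (by simp [add_assoc])
      (by simp) (by simp) (by simp)] at h₁
    exact h₁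
  · intro R S J P L M e₁ e₂
    rw [h ((P ++ L) ++ M) (P ++ L) R S J P L M (by simp [add_assoc]) (by simp) e₁ e₂]
    simp only [smul_smul, ← Int.negOnePow_add]
    rw [Int.negOnePow_even _ ⟨totalDeg J * totalDeg P, by ring⟩, one_smul]

theorem shuffleSum_middle_right_eq_second
    (h : ∀ R S R' S' J P L M, totalDeg L + totalDeg S = totalDeg R →
      totalDeg P + totalDeg M = totalDeg S →
      totalDeg J + totalDeg S' = totalDeg R' →
      totalDeg L + totalDeg M = totalDeg S' →
      G R S J P L M =
          (totalDeg J * totalDeg P + totalDeg P * totalDeg L).negOnePow • g R' S' J P L M) :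
    shuffleSum (fun J R => shuffleSum (fun L S => shuffleSum (fun P M => G R S J P L M) S) R) l =
      shuffleSum (fun P R => shuffleSum (fun J S => shuffleSum (fun L M => g R S J P L M) S) R) l := by
  refine (shuffleSum₄_of_middle_right
      (c := fun J P L M => (totalDeg P * totalDeg L).negOnePow •
        G (L ++ (P ++ M)) (P ++ M) J P L M) ?_).trans
    (shuffleSum₄_of_second ?_).symm
  · intro R S J P L M e₁ e₂
    have h₁ := h R S (J ++ (L ++ M)) (L ++ M) J P L M e₁ e₂ (by simp) (by simp)
    rw [← h (L ++ (P ++ M)) (P ++ M) (J ++ (L ++ M)) (L ++ M) J P L M (by simp)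
      (by simp) (by simp) (by simp)] at h₁
    rw [h₁, smul_smul, ← Int.negOnePow_add,
        Int.negOnePow_even _ ⟨totalDeg P * totalDeg L, by ring⟩, one_smul]
  · intro R S J P L M e₁ e₂
    rw [h (L ++ (P ++ M)) (P ++ M) R S J P L M (by simp) (by simp) e₁ e₂]
    simp only [smul_smul, ← Int.negOnePow_add]
    rw [Int.negOnePow_even _ ⟨totalDeg J * totalDeg P + totalDeg P * totalDeg L, by ring⟩, one_smul]

end
-- Braces of braces and the closed action
section
variable {k Z A W : Type*} [CommRing k] [AddCommGroup Z] [Module k Z] [AddCommGroup A] [Module k A]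
  [AddCommGroup W] [Module k W]
  {𝒵 : ℤ → Submodule k Z} {𝒜 : ℤ → Submodule k A} [DirectSum.Decomposition 𝒜] {m n p q : ℤ}

theorem apply_out_closed (l : LInfinity 𝒵) {f : List (Homog 𝒜) → W} (hf : IsMultilin f)
    (D : cochains 𝒵 𝒜 m) (pre post : List (Homog 𝒜)) (zs : List (Homog 𝒵))
    (as : List (Homog 𝒜)) :
    f (pre ++ out (closed l D) zs as :: post) =
      shuffleSum (fun J L => f (pre ++ out D (l.out J :: L) as :: post)) zs := by
  obtain ⟨F, hF⟩ := hf.exists_linearMap pre post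
  simp only [hF, out, closed, closedFun, map_shuffleSum]

theorem apply_out_brace₂ {f : List (Homog 𝒜) → W} (hf : IsMultilin f) (D : cochains 𝒵 𝒜 m)
    (E : cochains 𝒵 𝒜 n) (F : cochains 𝒵 𝒜 p) (pre post : List (Homog 𝒜))
    (zs : List (Homog 𝒵)) (as : List (Homog 𝒜)) :
    f (pre ++ out (brace₂ D E F) zs as :: post) = shuffleSum (fun J R =>
    shuffleSum (fun L M =>
      splitSum (fun I₀ r =>
        splitSum (fun K r' =>
          splitSum (fun I₁ r'' =>
            splitSum (fun N I₂ =>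
              (totalDeg I₀ * (n + totalDeg L)
                + (totalDeg I₀ + totalDeg K + totalDeg I₁) * (p + totalDeg M)
                + totalDeg J * n + (totalDeg J + totalDeg L) * p).negOnePow •
                f (pre ++ out D J (I₀ ++ out E L K :: (I₁ ++ out F M N :: I₂)) :: post))
              r'') r') r) as) R) zs := by
  obtain ⟨H, hH⟩ := hf.exists_linearMap pre post
  simp only [hH, out, brace₂, brace₂Fun, map_shuffleSum, map_splitSum, map_units_smul']

theorem apply_second_out_brace {f : List (Homog 𝒜) → W} (hf : IsMultilin f)
    (D : cochains 𝒵 𝒜 m) (E : cochains 𝒵 𝒜 n) (pre mid post : List (Homog 𝒜)) (x : Homog 𝒜)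
    (zs : List (Homog 𝒵)) (as : List (Homog 𝒜)) :
    f (pre ++ x :: (mid ++ out (brace D E) zs as :: post)) =
      shuffleSum (fun J L => splitSum (fun I₀ r => splitSum (fun K I₁ =>
        (totalDeg I₀ * (n + totalDeg L) + totalDeg J * n).negOnePow •
          f (pre ++ x :: (mid ++ out D J (I₀ ++ out E L K :: I₁) :: post))) r) as) zs := by
  simpa using apply_out_brace hf D E (pre ++ x :: mid) post zs as

theorem apply_second_out_closed (l : LInfinity 𝒵) {f : List (Homog 𝒜) → W} (hf : IsMultilin f)
    (D : cochains 𝒵 𝒜 m) (pre mid post : List (Homog 𝒜)) (x : Homog 𝒜)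
    (zs : List (Homog 𝒵)) (as : List (Homog 𝒜)) :
    f (pre ++ x :: (mid ++ out (closed l D) zs as :: post)) =
      shuffleSum (fun J L => f (pre ++ x :: (mid ++ out D (l.out J :: L) as :: post))) zs := by
  simpa using apply_out_closed l hf D (pre ++ x :: mid) post zs as

theorem closed_apply (l : LInfinity 𝒵) (D : cochains 𝒵 𝒜 m) (zs : List (Homog 𝒵))
    (as : List (Homog 𝒜)) :
    (closed l D).1 zs as = shuffleSum (fun J L => D.1 (l.out J :: L) as) zs := rfl

theorem LInfinity.out_fst (l : LInfinity 𝒵) (zs : List (Homog 𝒵)) :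
    (l.out zs).1 = 1 + totalDeg zs := rfl

theorem shuffleSum_cons (g : List (Homog 𝒵) → List (Homog 𝒵) → W) (z : Homog 𝒵)
    (l : List (Homog 𝒵)) : shuffleSum g (z :: l) = shuffleSum (fun J L => g (z :: J) L) l +
      shuffleSum (fun J L => (z.1 * totalDeg J).negOnePow • g J (z :: L)) l := rfl

/-- The letter l(z_J) is a closed input of D{E}, hence goes to D or to E. In the first case the sign
|z_J||E| of the brace sees the extra degree one of l, whence (-1)^{|E|}. -/
theorem closed_brace (l : LInfinity 𝒵) (D : cochains 𝒵 𝒜 m) (E : cochains 𝒵 𝒜 n) :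
    (closed l (brace D E)).1 = n.negOnePow • (brace (closed l D) E).1
      + (brace D (closed l E)).1 := by
  funext zs as
  simp only [Pi.add_apply, Pi.smul_apply]
  simp only [closed_apply, brace_apply, apply_out_closed l (D.2.2.2.1 _), shuffleSum_cons,
    shuffleSum_add, shuffleSum_units_smul', splitSum_shuffleSum,
    splitSum_units_smul', smul_smul, ← Int.negOnePow_add]
  congr 1
  · refine (shuffleSum_assoc_eq fun R M J L S h1 h2 => ?_).symm
    refine splitSum_congr fun _ _ _ => splitSum_congr fun _ _ _ => ?_
    congr 1
    apply negOnePow_congr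
    simp only [totalDeg_cons, l.out_fst, ← h1]
    push_cast
    grind
  · refine shuffleSum_left_comm_eq fun R M J L S h1 h2 => ?_
    simp only [splitSum_units_smul', smul_smul, ← Int.negOnePow_add]
    refine splitSum_congr fun _ _ _ => splitSum_congr fun _ _ _ => ?_
    congr 1
    apply negOnePow_congr
    simp only [totalDeg_cons, l.out_fst, ← h1]
    push_cast
    grind

theorem add_eq_of_matching₈ {t₁ t₂ t₃ t₄ t₅ t₆ t₇ t₈ r₁ r₂ r₃ r₄ r₅ r₆ r₇ r₈ : W}
    (h₁ : t₁ = r₈) (h₂ : t₂ = r₂) (h₃ : t₃ = r₁) (h₄ : t₄ = r₆) (h₅ : t₅ = r₃) (h₆ : t₆ = r₄)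
    (h₇ : t₇ = r₇) (h₈ : t₈ = r₅) :
    t₁ + (t₂ + (t₃ + (t₄ + (t₅ + (t₆ + (t₇ + t₈)))))) =
      r₁ + (r₂ + (r₃ + (r₄ + (r₅ + (r₆ + (r₇ + r₈)))))) := by
  subst h₁ h₂ h₃ h₄ h₅ h₆ h₇ h₈
  abel

/-- Both sides list the eight relative positions of G, D, E below Q with D before E. On the left, D
and E are each before, inside or after G (six terms), and G may also lie inside D or inside E. On
the right, G contains both, only D or only E, and (Q{D, E}){G} supplies the five positions in which
G contains neither. -/
theorem brace_brace₂ (Q : cochains 𝒵 𝒜 q) (G : cochains 𝒵 𝒜 p) (D : cochains 𝒵 𝒜 m)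
    (E : cochains 𝒵 𝒜 n) :
    (brace₂ (brace Q G) D E).1 + (p * m).negOnePow • (brace₂ Q (brace D G) E).1
      + (p * (m + n)).negOnePow • (brace₂ Q D (brace E G)).1 =
    (brace Q (brace₂ G D E)).1 + (brace₂ Q (brace G D) E).1
      + (p * m).negOnePow • (brace₂ Q D (brace G E)).1
      + (p * (m + n)).negOnePow • (brace (brace₂ Q D E) G).1 := by
  funext zs as
  simp only [Pi.add_apply, Pi.smul_apply]
  simp only [brace_apply, brace₂_apply, apply_out_brace (Q.2.2.2.1 _),
    apply_second_out_brace (Q.2.2.2.1 _), apply_out_brace₂ (Q.2.2.2.1 _),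
    splitSum_append_cons,
    splitSum_shuffleSum, splitSum_add, shuffleSum_add, shuffleSum_units_smul',
    splitSum_units_smul', smul_smul, ← Int.negOnePow_add, splitSum_assoc, splitSum_assoc_two,
    splitSum_assoc_three, splitSum_assoc_four, splitSum_assoc_five, smul_add, List.append_assoc,
    List.cons_append]
  simp only [add_assoc]
  -- Terms are matched by the relative position of G, D and E; each pair then differs only in the
  -- bracketing of its shuffles.
  refine add_eq_of_matching₈ (shuffleSum_pairs_eq_last ?_) (shuffleSum_pairs_eq_middle_left ?_)
    (shuffleSum_pairs_eq_right ?_) (shuffleSum_pairs_eq_last ?_)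
    (shuffleSum_pairs_eq_middle_right ?_) (shuffleSum_pairs_eq_last ?_)
    (shuffleSum_middle_left_swap_eq_last ?_) (shuffleSum_middle_right_swap_eq_last ?_)
  all_goals
    intro R S R' S' J P L M e₁ e₂ e₃ e₄
    try simp only [splitSum_units_smul', smul_smul, ← Int.negOnePow_add]
    refine splitSum_congr fun _ _ _ => splitSum_congr fun _ _ _ => splitSum_congr fun _ _ _ =>
      splitSum_congr fun _ _ _ => splitSum_congr fun _ _ _ => splitSum_congr fun _ _ _ => ?_
    congr 1
    apply negOnePow_congr
    simp only [totalDeg_append, totalDeg_cons, out_fst, ← e₁, ← e₂, ← e₃, ← e₄]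
    push_cast
    grind

theorem closed_brace₂ (l : LInfinity 𝒵) (Q : cochains 𝒵 𝒜 q) (D : cochains 𝒵 𝒜 m)
    (E : cochains 𝒵 𝒜 n) :
    (closed l (brace₂ Q D E)).1 = (m + n).negOnePow • (brace₂ (closed l Q) D E).1
      + (n.negOnePow • (brace₂ Q (closed l D) E).1 + (brace₂ Q D (closed l E)).1) := by
  funext zs as
  simp only [Pi.add_apply, Pi.smul_apply]
  simp only [closed_apply, brace₂_apply, apply_out_closed l (Q.2.2.2.1 _),
    apply_second_out_closed l (Q.2.2.2.1 _), shuffleSum_cons,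
    shuffleSum_add, shuffleSum_units_smul', splitSum_shuffleSum, smul_add,
    splitSum_units_smul', smul_smul, ← Int.negOnePow_add]
  refine congrArg₂ (· + ·) (shuffleSum_pairs_eq_right ?_).symm
    (congrArg₂ (· + ·) (shuffleSum_middle_left_eq_second ?_).symm
      (shuffleSum_middle_right_eq_second ?_).symm)
  all_goals
    intro R S R' S' J P L M e₁ e₂ e₃ e₄
    try simp only [splitSum_units_smul', smul_smul, ← Int.negOnePow_add]
    refine splitSum_congr fun _ _ _ => splitSum_congr fun _ _ _ => splitSum_congr fun _ _ _ =>
      splitSum_congr fun _ _ _ => ?_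
    congr 1
    apply negOnePow_congr
    simp only [totalDeg_cons, l.out_fst, ← e₁, ← e₂]
    push_cast
    grind

/-! ### Pairing with the form and the cyclic cancellation -/

theorem form_brace (ω : SymplecticForm 𝒜) (b : A) (D : cochains 𝒵 𝒜 m)
    (E : cochains 𝒵 𝒜 n) (zs : List (Homog 𝒵)) (as : List (Homog 𝒜)) :
    ω.form ((brace D E).1 zs as) b = shuffleSum (fun J L =>
    splitSum (fun I₀ r =>
      splitSum (fun K I₁ =>
        (totalDeg I₀ * (n + totalDeg L) + totalDeg J * n).negOnePow •
          ω.form (D.1 J (I₀ ++ out E L K :: I₁)) b) r) as) zs := by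
  have h : ∀ x, ω.form x b = ω.form.flip b x := fun _ => rfl
  simp only [h]
  generalize ω.form.flip b = H
  simp only [brace_apply, map_shuffleSum, map_splitSum, map_units_smul']

theorem form_brace₂ (ω : SymplecticForm 𝒜) (b : A) (D : cochains 𝒵 𝒜 m)
    (E : cochains 𝒵 𝒜 n) (F : cochains 𝒵 𝒜 p)
    (zs : List (Homog 𝒵)) (as : List (Homog 𝒜)) : ω.form ((brace₂ D E F).1 zs as) b =
  shuffleSum (fun J R =>
    shuffleSum (fun L M =>
      splitSum (fun I₀ r =>
        splitSum (fun K r' =>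
          splitSum (fun I₁ r'' =>
            splitSum (fun N I₂ =>
              (totalDeg I₀ * (n + totalDeg L)
                + (totalDeg I₀ + totalDeg K + totalDeg I₁) * (p + totalDeg M)
                + totalDeg J * n + (totalDeg J + totalDeg L) * p).negOnePow •
                ω.form (D.1 J (I₀ ++ out E L K :: (I₁ ++ out F M N :: I₂))) b)
              r'') r') r) as) R) zs := by
  have h : ∀ x, ω.form x b = ω.form.flip b x := fun _ => rfl
  simp only [h]
  generalize ω.form.flip b = H
  simp only [brace₂_apply, map_shuffleSum, map_splitSum, map_units_smul']

theorem form_closed (ω : SymplecticForm 𝒜) (b : A) (l : LInfinity 𝒵) (D : cochains 𝒵 𝒜 m)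
    (zs : List (Homog 𝒵)) (as : List (Homog 𝒜)) :
    ω.form ((closed l D).1 zs as) b =
      shuffleSum (fun J L => ω.form (D.1 (l.out J :: L) as) b) zs := by
  have h : ∀ x, ω.form x b = ω.form.flip b x := fun _ => rfl
  simp only [h]
  generalize ω.form.flip b = H
  simp only [closed_apply, map_shuffleSum]

theorem cyclicForm_apply (ω : SymplecticForm 𝒜) (one : 𝒜 (-1)) (D : cochains 𝒵 𝒜 m)
    (E : cochains 𝒵 𝒜 n) (zs : List (Homog 𝒵)) (as : List (Homog 𝒜)) (a₀ : Homog 𝒜) :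
    cyclicForm ω one D E zs as a₀ = shuffleSum (fun J L =>
    splitSum (fun p r =>
      splitSum (fun I r' =>
        splitSum (fun K I' =>
          (totalDeg I * (n + totalDeg L) + totalDeg J * n
            + totalDeg p * (totalDeg r + a₀.1)).negOnePow •
            ω.form (D.1 J (I ++ out E L K :: (I' ++ a₀ :: p))) one) r') r) as) zs := rfl

theorem deltaForm_apply (ω : SymplecticForm 𝒜) (one : 𝒜 (-1)) (D : cochains 𝒵 𝒜 m)
    (zs : List (Homog 𝒵)) (as : List (Homog 𝒜)) (a₀ : Homog 𝒜) :
    deltaForm ω one D zs as a₀ = splitSum (fun p s =>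
    (totalDeg p * (totalDeg s + a₀.1)).negOnePow • ω.form (D.1 zs (s ++ a₀ :: p)) one) as := rfl

theorem SymplecticForm.form_comm (ω : SymplecticForm 𝒜) (x y : Homog 𝒜) :
    ω.form (x.2 : A) y.2 = (x.1 * y.1 + 1).negOnePow • ω.form (y.2 : A) x.2 :=
  ω.skew _ _ _ _

/-- Rotating the inputs of a cyclic operation by several positions. -/
theorem OCHA.IsCyclic.rotate {X : OCHA 𝒵 𝒜} {ω : SymplecticForm 𝒜} (hω : X.IsCyclic ω)
    (zs : List (Homog 𝒵)) (u v : List (Homog 𝒜)) (x y : Homog 𝒜) :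
    ω.form (X.q.1 zs (u ++ x :: v)) y.2 =
      ((totalDeg u + x.1) * (totalDeg v + y.1)).negOnePow •
        ω.form (X.q.1 zs (v ++ y :: u)) x.2 := by
  induction v using List.reverseRecOn generalizing u y with
  | nil =>
    rw [hω]
    simp [mul_comm]
  | append_singleton v b ih =>
    have h := hω zs (u ++ x :: v) b y
    simp only [List.append_assoc, List.cons_append] at h
    have h' := ih (y :: u) b
    simp only [List.cons_append] at h'
    rw [h, h', smul_smul, ← Int.negOnePow_add]
    simp only [List.append_assoc, List.cons_append, List.nil_append]
    congr 1
    apply negOnePow_congr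
    simp only [totalDeg_append, totalDeg_cons, totalDeg_nil]
    push_cast
    grind

/-- Cyclicity turns q around so that the output of Y is paired with the output of q. The latter then
plays the role of a₀ in the defining equation of Y, when Y is Δ D or D{E, Δ}. -/
theorem OCHA.IsCyclic.form_out {X : OCHA 𝒵 𝒜} {ω : SymplecticForm 𝒜} (hω : X.IsCyclic ω)
    (Y : cochains 𝒵 𝒜 m) (zs R : List (Homog 𝒵)) (u v K : List (Homog 𝒜)) (y : Homog 𝒜) :
    ω.form (X.q.1 zs (u ++ out Y R K :: v)) y.2 =
      ((totalDeg u + (m + totalDeg R + totalDeg K)) * (totalDeg v + y.1) +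
        ((m + totalDeg R + totalDeg K) * (1 + totalDeg zs + (totalDeg v + (y.1 + totalDeg u))) + 1)
        ).negOnePow •
        ω.form (Y.1 R K) (out X.q zs (v ++ y :: u)).2 := by
  rw [hω.rotate, Int.negOnePow_add, ← smul_smul]
  congr 1
  refine (ω.form_comm (out X.q zs (v ++ y :: u)) (out Y R K)).trans ?_
  simp only [out_fst, totalDeg_append, totalDeg_cons]
  rw [mul_comm]
  rfl

theorem shuffleSum_left_eq_pairs {V : Type*} [AddCommGroup V] [Module k V]
    {𝒱 : ℤ → Submodule k V}
    {G g : List (Homog 𝒱) → List (Homog 𝒱) → List (Homog 𝒱) → List (Homog 𝒱) → W}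
    {l : List (Homog 𝒱)}
    (h : ∀ R R' J P L, totalDeg J + totalDeg L = totalDeg R →
      totalDeg J + totalDeg P = totalDeg R' →
      G R P J L = (totalDeg J * totalDeg P).negOnePow • g R' L J P) :
    shuffleSum (fun P R => shuffleSum (fun J L => G R P J L) R) l =
      shuffleSum (fun R L => shuffleSum (fun J P => g R L J P) R) l := by
  rw [shuffleSum_assoc_eq (G := fun R L J P => g R L J P)
      (g := fun J S P L => (totalDeg J * totalDeg P).negOnePow •
        G (J ++ L) P J L)
      (fun R M J L S e _ => ?_)]
  · refine shuffleSum_left_comm_eq fun R M P J S _ e => ?_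
    rw [h S (J ++ P) J P M e (totalDeg_append _ _).symm,
      h (J ++ M) (J ++ P) J P M (totalDeg_append _ _).symm (totalDeg_append _ _).symm,
      smul_smul, smul_smul, ← Int.negOnePow_add, ← Int.negOnePow_add]
    congr 1
    apply negOnePow_congr
    push_cast
    grind
  · rw [h (J ++ M) R J L M (totalDeg_append _ _).symm e, smul_smul, ← Int.negOnePow_add,
      Int.negOnePow_even _ ⟨_, rfl⟩, one_smul]

theorem add_eq_of_matching₇ {t₁ t₂ t₃ t₄ t₅ t₆ t₇ r₁ r₂ r₃ r₄ r₅ r₆ r₇ : W}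
    (h₁ : t₁ = r₅) (h₂ : t₂ = r₄) (h₃ : t₃ = r₇) (h₄ : t₄ = r₁) (h₅ : t₅ = r₆) (h₆ : t₆ = r₂)
    (h₇ : t₇ = r₃) :
    t₁ + (t₂ + (t₃ + (t₄ + (t₅ + (t₆ + t₇))))) =
      r₁ + (r₂ + (r₃ + (r₄ + (r₅ + (r₆ + r₇))))) := by
  subst h₁ h₂ h₃ h₄ h₅ h₆ h₇
  abel

/-- After rotating the outer q, every term is ω(D(…), 1) with E, q and a₀ among the nested inputs of
D. On the right, (D{q}){E, Δ} has six positions, as E and a₀ are each before, inside or after q with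
E ahead of a₀, and D{E{q}, Δ} adds the seventh. On the left, q contains only a₀ in q{D{E, Δ}}, only
E in D{q{E}, Δ}, and both in q{ΔD, E}; the four terms of (D{E, Δ}){q} are the positions of q outside
E and a₀ or inside E. -/
theorem cyclic_cancellation {X : OCHA 𝒵 𝒜} {ω : SymplecticForm 𝒜} (hω : X.IsCyclic ω)
    (one : 𝒜 (-1)) (D : cochains 𝒵 𝒜 m) (E : cochains 𝒵 𝒜 n)
    (zs : List (Homog 𝒵)) (as : List (Homog 𝒜)) (a₀ : Homog 𝒜) :
    ω.form ((brace X.q (cyclicBrace ω one D E)).1 zs as) a₀.2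
      + ((m + n).negOnePow • ω.form ((brace (cyclicBrace ω one D E) X.q).1 zs as) a₀.2
      + (m.negOnePow • cyclicForm ω one D (brace X.q E) zs as a₀
      + ω.form ((brace₂ X.q (bvDelta ω one D) E).1 zs as) a₀.2)) =
    m.negOnePow • cyclicForm ω one (brace D X.q) E zs as a₀
      + (m + n).negOnePow • cyclicForm ω one D (brace E X.q) zs as a₀ := by
  have hslot : ∀ J, IsMultilin fun as => ω.form (D.1 J as) (one : A) :=
    fun J => isMultilin_form ω one (D.2.2.2.1 J)
  simp only [form_brace, form_brace₂, hω.form_out, form_cyclicBrace, form_bvDelta,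
    cyclicForm_apply, deltaForm_apply, apply_out_brace (hslot _),
    splitSum_append_cons,
    splitSum_shuffleSum, splitSum_add, shuffleSum_add, shuffleSum_units_smul',
    splitSum_units_smul', smul_smul, ← Int.negOnePow_add, splitSum_assoc, splitSum_assoc_two,
    splitSum_assoc_three, splitSum_assoc_four, smul_add,
    List.append_assoc, List.cons_append]
  simp only [add_assoc]
  -- Terms are matched according to whether q contains E, a₀, both or neither, and in the last case
  -- according to its place.
  refine add_eq_of_matching₇ (shuffleSum_left_eq_pairs ?_) (shuffleSum_right_comm_eq ?_)
    (shuffleSum_assoc_eq ?_) (shuffleSum_right_comm_eq ?_) (shuffleSum_right_comm_eq ?_)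
    (shuffleSum_assoc_eq ?_).symm (shuffleSum_left_eq_pairs ?_)
  all_goals
    intro _ _ _ _ _ e₁ e₂
    try simp only [splitSum_units_smul', smul_smul, ← Int.negOnePow_add]
    refine splitSum_congr fun _ _ h₁ => splitSum_congr fun _ _ h₂ => splitSum_congr fun _ _ h₃ =>
      splitSum_congr fun _ _ h₄ => splitSum_congr fun _ _ h₅ => ?_
    subst h₅ h₄ h₃ h₂ h₁
    congr 1
    apply negOnePow_congr
    simp only [totalDeg_append, totalDeg_cons, out_fst, ← e₁, ← e₂]
    push_cast
    grind

/-- The letter l(z_J) goes to D or to E, exactly as for an ordinary brace; the unit and a₀ play no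
part. -/
theorem form_closed_cyclicBrace (l : LInfinity 𝒵) (ω : SymplecticForm 𝒜) (one : 𝒜 (-1))
    (D : cochains 𝒵 𝒜 m) (E : cochains 𝒵 𝒜 n)
    (zs : List (Homog 𝒵)) (as : List (Homog 𝒜)) (a₀ : Homog 𝒜) :
    ω.form ((closed l (cyclicBrace ω one D E)).1 zs as) a₀.2 =
      n.negOnePow • cyclicForm ω one (closed l D) E zs as a₀
        + cyclicForm ω one D (closed l E) zs as a₀ := by
  have hslot : ∀ J, IsMultilin fun as => ω.form (D.1 J as) (one : A) :=
    fun J => isMultilin_form ω one (D.2.2.2.1 J)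
  simp only [form_closed, form_cyclicBrace, cyclicForm_apply, apply_out_closed l (hslot _),
    shuffleSum_cons, shuffleSum_add, shuffleSum_units_smul', splitSum_shuffleSum,
    splitSum_units_smul', smul_smul, ← Int.negOnePow_add]
  refine congrArg₂ (· + ·) (shuffleSum_assoc_eq ?_).symm (shuffleSum_left_comm_eq ?_)
  all_goals
    intro _ _ _ _ _ e₁ e₂
    try simp only [splitSum_units_smul', smul_smul, ← Int.negOnePow_add]
    refine splitSum_congr fun _ _ _ => splitSum_congr fun _ _ _ => splitSum_congr fun _ _ _ => ?_
    congr 1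
    apply negOnePow_congr
    simp only [totalDeg_cons, l.out_fst, ← e₁]
    push_cast
    grind

/-- `w` if the word is empty, and `0` otherwise. -/
def atNil {α : Type*} : List α → W → W
  | [], w => w
  | _ :: _, _ => 0

/-- The value of `f` at the only letter of a word of length one, and `0` for other words. -/
def onLetter {α : Type*} : List α → (α → W) → W
  | [x], f => f x
  | _, _ => 0

/-! ### Sums supported on empty words or single letters -/

section atNil

variable {α : Type*}

theorem atNil_append_cons (l l' : List α) (x : α) (w : W) : atNil (l ++ x :: l') w = 0 := by
  cases l <;> rfl

theorem onLetter_append_cons (l l' : List α) (x : α) (f : α → W) :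
    onLetter (l ++ x :: l') f = atNil l (atNil l' (f x)) := by
  rcases l with _ | ⟨a, _ | ⟨b, l⟩⟩ <;> cases l' <;> rfl

theorem atNil_zero (l : List α) : atNil l (0 : W) = 0 := by cases l <;> rfl

theorem atNil_add (l : List α) (w w' : W) : atNil l (w + w') = atNil l w + atNil l w' := by
  cases l <;> simp [atNil]

theorem smul_atNil (u : ℤˣ) (l : List α) (w : W) : u • atNil l w = atNil l (u • w) := by
  cases l <;> simp [atNil]

theorem smul_onLetter (u : ℤˣ) (l : List α) (f : α → W) :
    u • onLetter l f = onLetter l (fun x => u • f x) := by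
  rcases l with _ | ⟨a, _ | ⟨b, l⟩⟩ <;> simp [onLetter]

theorem splitSum_atNil_left (g : List α → List α → W) (l : List α) :
    splitSum (fun p s => atNil p (g p s)) l = g [] l := by
  cases l with
  | nil => rfl
  | cons a l =>
    simp only [splitSum, atNil, splitSum_zero, add_zero]

theorem splitSum_atNil_right (g : List α → List α → W) (l : List α) :
    splitSum (fun p s => atNil s (g p s)) l = g l [] := by
  induction l generalizing g with
  | nil => rfl
  | cons a l ih =>
    exact (zero_add _).trans (ih fun p s => g (a :: p) s)

theorem splitSum_atNil_const {β : Type*} (q : List β) (g : List α → List α → W) (l : List α) :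
    splitSum (fun p s => atNil q (g p s)) l = atNil q (splitSum g l) := by
  cases q
  · rfl
  · exact splitSum_zero l

theorem shuffleSum_atNil_const (q : List α) (g : List (Homog 𝒵) → List (Homog 𝒵) → W)
    (l : List (Homog 𝒵)) :
    shuffleSum (fun p s => atNil q (g p s)) l = atNil q (shuffleSum g l) := by
  cases q
  · rfl
  · exact shuffleSum_zero l

theorem shuffleSum_atNil_left (g : List (Homog 𝒵) → List (Homog 𝒵) → W) (l : List (Homog 𝒵)) :
    shuffleSum (fun p s => atNil p (g p s)) l = g [] l := by
  induction l generalizing g with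
  | nil => rfl
  | cons a l ih =>
    simp only [shuffleSum, smul_atNil, ih, totalDeg_nil, mul_zero, Int.negOnePow_zero, one_smul]
    exact (congrArg (· + g [] (a :: l)) (shuffleSum_zero l)).trans (zero_add _)

end atNil

/-! ### Evaluating products against the unit -/

/-- By cyclicity and unitality only the product `q_{0,2}` pairs nontrivially with the unit, as
soon as there is at least one input from `A`. -/
theorem OCHA.IsUnit.form_one {X : OCHA 𝒵 𝒜} {ω : SymplecticForm 𝒜} {one : 𝒜 (-1)}
    (hone : X.IsUnit one) (hω : X.IsCyclic ω) (zs : List (Homog 𝒵)) (u v : List (Homog 𝒜))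
    (x : Homog 𝒜) :
    ω.form (X.q.1 zs (u ++ x :: v)) one =
      atNil zs (atNil v (onLetter u fun y => (y.1 + x.1).negOnePow • ω.form y.2 x.2)
        + atNil u (onLetter v fun y => (x.1 + y.1).negOnePow • ω.form x.2 y.2)) := by
  -- The rotation exchanges the marked input x with the unit, so that unitality controls q. At least
  -- one input is needed for this.
  have h := hω.rotate zs u v x ⟨-1, one⟩
  have two : ∀ y z : Homog 𝒜, ω.form (X.q.1 [] [y, z]) one =
      (y.1 + z.1).negOnePow • ω.form y.2 z.2 := by
    intro y z
    have h := hω.rotate [] [y] [] z ⟨-1, one⟩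
    simp only [List.cons_append, List.nil_append] at h
    rw [h, hone.left]
    congr 1
    apply negOnePow_congr
    simp [add_comm]
  have vanish : ¬(zs.length = 0 ∧ (v ++ (⟨-1, one⟩ : Homog 𝒜) :: u).length = 2) →
      ω.form (X.q.1 zs (u ++ x :: v)) one = 0 := by
    intro hn
    rw [h, hone.vanish _ _ (by simp) hn]
    simp
  rcases zs with _ | ⟨z, zs⟩
  -- q has two inputs precisely when u and v together contain one letter; every other case vanishes.
  · rcases u with _ | ⟨y, _ | ⟨y', u⟩⟩ <;> rcases v with _ | ⟨w, _ | ⟨w', v⟩⟩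
    all_goals first
      | (rw [vanish (by simp)]; simp [atNil, onLetter]; done)
      | simp [atNil, onLetter, two]
  · rw [vanish (by simp)]
    rfl

/-- With two marked inputs already present, q_{0,2} leaves no room for any further input. -/
theorem OCHA.IsUnit.form_one₂ {X : OCHA 𝒵 𝒜} {ω : SymplecticForm 𝒜} {one : 𝒜 (-1)}
    (hone : X.IsUnit one) (hω : X.IsCyclic ω) (zs : List (Homog 𝒵)) (u v w : List (Homog 𝒜))
    (x y : Homog 𝒜) :
    ω.form (X.q.1 zs (u ++ x :: (v ++ y :: w))) one =
      atNil zs (atNil u (atNil v (atNil w ((x.1 + y.1).negOnePow • ω.form x.2 y.2)))) := by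
  rw [hone.form_one hω, atNil_append_cons, zero_add, onLetter_append_cons]

/-- ω(x, y) vanishes unless |x| + |y| + |ω| = 0, so exponents may be changed by this quantity. This
converts the sign (-1)^{|x|+|y|} produced by the unit into (-1)^{|ω|}. -/
theorem SymplecticForm.smul_form_congr (ω : SymplecticForm 𝒜) (x y : Homog 𝒜) {a b : ℤ}
    (h : (a : ZMod 2) = b + (x.1 + y.1 + ω.deg)) :
    a.negOnePow • ω.form (x.2 : A) y.2 = b.negOnePow • ω.form (x.2 : A) y.2 := by
  by_cases e : x.1 + y.1 + ω.deg = 0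
  · congr 1
    apply negOnePow_congr
    rw [h, ← Int.cast_add, ← Int.cast_add, e]
    simp
  · rw [ω.form_eq_zero _ _ _ _ e, smul_zero, smul_zero]

/-- The pairing of `E` with `D`, where the inputs are distributed cyclically and the distinguished
input `a₀` goes to `D`. -/
def crossForm (ω : SymplecticForm 𝒜) (D : cochains 𝒵 𝒜 m) (E : cochains 𝒵 𝒜 n)
    (zs : List (Homog 𝒵)) (as : List (Homog 𝒜)) (a₀ : Homog 𝒜) : k :=
  shuffleSum (fun J L => splitSum (fun p r => splitSum (fun K I =>
    (totalDeg J * n + totalDeg p * (totalDeg r + a₀.1)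
      + (n + totalDeg L + totalDeg K) * (m + totalDeg J)).negOnePow •
      ω.form ((out E L K).2 : A) (out D J (I ++ a₀ :: p)).2) r) as) zs

/-- Only q_{0,2} contributes, so D takes every entry of the cyclic word except its first or its
last. If the omitted entry is a plain input, the two possibilities cancel. Since E always precedes
a₀, the only other omitted entries are a₀ at the end, which gives D{E}, and E at the beginning,
which gives the cross term. -/
theorem OCHA.IsUnit.cyclicForm_brace {X : OCHA 𝒵 𝒜} {ω : SymplecticForm 𝒜} {one : 𝒜 (-1)}
    (hone : X.IsUnit one) (hω : X.IsCyclic ω)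
    (D : cochains 𝒵 𝒜 m) (E : cochains 𝒵 𝒜 n)
    (zs : List (Homog 𝒵)) (as : List (Homog 𝒜)) (a₀ : Homog 𝒜) :
    cyclicForm ω one (brace X.q D) E zs as a₀ = ω.deg.negOnePow •
      (ω.form ((brace D E).1 zs as) a₀.2 + crossForm ω D E zs as a₀) := by
  simp only [cyclicForm_apply, crossForm, form_brace, hone.form_one hω,
    splitSum_append_cons, atNil_append_cons, onLetter_append_cons, atNil_zero, add_zero, zero_add,
    splitSum_zero, smul_atNil, smul_onLetter, atNil_add,
    splitSum_add, shuffleSum_add, shuffleSum_units_smul',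
    splitSum_units_smul', smul_smul, ← Int.negOnePow_add, splitSum_assoc_two,
    splitSum_assoc_three, smul_add,
    splitSum_atNil_const, splitSum_atNil_left,
    splitSum_atNil_right, shuffleSum_atNil_left]
  have cancel : ∀ {t₁ t₂ t₃ t₄ r₁ r₂ : k}, t₁ = -t₃ → t₂ = r₁ → t₄ = r₂ →
      t₁ + (t₂ + t₃) + t₄ = r₁ + r₂ := by
    intro t₁ t₂ t₃ t₄ r₁ r₂ h₁ h₂ h₃
    rw [h₁, h₂, h₃]
    abel
  -- The first goal is the cancellation: an input between the two parts of the cyclic word is either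
  -- the last letter after a₀ or the first letter before E. Skew symmetry of ω relates the two by a
  -- minus sign.
  refine cancel ?_ ?_ ?_
  · rw [← shuffleSum_neg]
    refine shuffleSum_congr fun _ _ e => ?_
    simp only [← splitSum_neg]
    refine splitSum_congr fun _ _ h₁ => splitSum_congr fun q _ h₂ => splitSum_congr fun _ _ h₃ =>
      splitSum_congr fun _ _ h₄ => ?_
    subst h₄ h₃ h₂ h₁
    rcases q with _ | ⟨x, _ | ⟨y, q⟩⟩
    · simp [onLetter]
    · simp only [onLetter]
      rw [ω.form_comm, smul_smul, ← Int.negOnePow_add, ← Units.neg_smul, ← Int.negOnePow_succ]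
      congr 1
      apply negOnePow_congr
      simp only [totalDeg_append, totalDeg_cons, totalDeg_nil, out_fst]
      push_cast
      grind
    · simp [onLetter]
  · refine shuffleSum_congr fun _ _ e =>
      splitSum_congr fun _ _ h₁ => splitSum_congr fun _ _ h₂ => ?_
    subst h₂ h₁
    refine ω.smul_form_congr (out D _ _) _ ?_
    simp only [totalDeg_append, totalDeg_cons, totalDeg_nil, out_fst]
    push_cast
    grind
  · refine shuffleSum_congr fun _ _ e =>
      splitSum_congr fun _ _ h₁ => splitSum_congr fun _ _ h₂ => ?_
    subst h₂ h₁
    refine ω.smul_form_congr _ _ ?_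
    simp only [totalDeg_append, totalDeg_cons, totalDeg_nil, out_fst]
    push_cast
    grind

/-- Pairing q{D, E} with the unit leaves q_{0,2}(D(…), E(…)) with every input consumed by D or E.
The two summands correspond to a₀ being an input of E or of D. -/
theorem OCHA.IsUnit.deltaForm_brace₂ {X : OCHA 𝒵 𝒜} {ω : SymplecticForm 𝒜} {one : 𝒜 (-1)}
    (hone : X.IsUnit one) (hω : X.IsCyclic ω)
    (D : cochains 𝒵 𝒜 m) (E : cochains 𝒵 𝒜 n)
    (zs : List (Homog 𝒵)) (as : List (Homog 𝒜)) (a₀ : Homog 𝒜) :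
    deltaForm ω one (brace₂ X.q D E) zs as a₀ = ω.deg.negOnePow •
      ((m * n).negOnePow • crossForm ω E D zs as a₀ - crossForm ω D E zs as a₀) := by
  simp only [deltaForm_apply, crossForm, form_brace₂, hone.form_one₂ hω,
    splitSum_append_cons, atNil_append_cons, atNil_zero, add_zero, splitSum_zero, smul_atNil,
    atNil_add,
    splitSum_shuffleSum, splitSum_add, shuffleSum_add, shuffleSum_units_smul',
    splitSum_units_smul', smul_smul, ← Int.negOnePow_add, splitSum_assoc, smul_add, smul_sub,
    splitSum_atNil_const, splitSum_atNil_left,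
    splitSum_atNil_right, shuffleSum_atNil_left, shuffleSum_atNil_const]
  rw [sub_eq_add_neg, ← shuffleSum_neg]
  -- If a₀ goes to E, the pairing is already in the order of `crossForm`, but its closed words must
  -- be exchanged. If a₀ goes to D, the closed words are in order and skew symmetry exchanges the
  -- arguments of ω.
  refine congrArg₂ (· + ·) (shuffleSum_swap_eq fun _ _ e => ?_) (shuffleSum_congr fun _ _ e => ?_)
  · simp only [splitSum_units_smul', smul_smul, ← Int.negOnePow_add]
    refine splitSum_congr fun _ _ h₁ => splitSum_congr fun _ _ h₂ => ?_
    subst h₂ h₁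
    refine ω.smul_form_congr _ _ ?_
    simp only [totalDeg_append, totalDeg_cons, totalDeg_nil, out_fst]
    push_cast
    grind
  · simp only [← splitSum_neg]
    refine splitSum_congr fun _ _ h₁ => splitSum_congr fun _ _ h₂ => ?_
    subst h₂ h₁
    rw [ω.form_comm, smul_smul, ← Int.negOnePow_add, ← Units.neg_smul, ← Int.negOnePow_succ]
    refine ω.smul_form_congr _ _ ?_
    simp only [totalDeg_append, totalDeg_cons, totalDeg_nil, out_fst]
    push_cast
    grind

/-! ### The cochain-level identity -/

theorem form_units_smul (ω : SymplecticForm 𝒜) (u : ℤˣ) (x y : A) :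
    ω.form (u • x) y = u • ω.form x y := by
  rw [map_units_smul']
  rcases Int.units_eq_one_or u with rfl | rfl <;> simp

theorem delta_apply (X : OCHA 𝒵 𝒜) (D : cochains 𝒵 𝒜 m) (zs : List (Homog 𝒵))
    (as : List (Homog 𝒜)) :
    (delta X m D).1 zs as = (brace X.q D).1 zs as - m.negOnePow • (brace D X.q).1 zs as
      + m.negOnePow • (closed X.l D).1 zs as := rfl

theorem form_delta (X : OCHA 𝒵 𝒜) (ω : SymplecticForm 𝒜) (b : A) (D : cochains 𝒵 𝒜 m)
    (zs : List (Homog 𝒵)) (as : List (Homog 𝒜)) :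
    ω.form ((delta X m D).1 zs as) b = ω.form ((brace X.q D).1 zs as) b
      - m.negOnePow • ω.form ((brace D X.q).1 zs as) b
      + m.negOnePow • ω.form ((closed X.l D).1 zs as) b := by
  simp only [delta_apply, map_add, map_sub, LinearMap.add_apply, LinearMap.sub_apply,
    form_units_smul]

theorem apply_out_delta {f : List (Homog 𝒜) → W} (hf : IsMultilin f) (X : OCHA 𝒵 𝒜)
    (D : cochains 𝒵 𝒜 m) (pre post : List (Homog 𝒜)) (zs : List (Homog 𝒵))
    (as : List (Homog 𝒜)) :
    f (pre ++ out (delta X m D) zs as :: post) = f (pre ++ out (brace X.q D) zs as :: post)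
      - m.negOnePow • f (pre ++ out (brace D X.q) zs as :: post)
      + m.negOnePow • f (pre ++ out (closed X.l D) zs as :: post) := by
  obtain ⟨F, hF⟩ := hf.exists_linearMap pre post
  simp only [hF, out, delta_apply, map_add, map_sub, map_units_smul']

theorem cyclicForm_delta_left (X : OCHA 𝒵 𝒜) (ω : SymplecticForm 𝒜) (one : 𝒜 (-1))
    (D : cochains 𝒵 𝒜 m) (E : cochains 𝒵 𝒜 n)
    (zs : List (Homog 𝒵)) (as : List (Homog 𝒜)) (a₀ : Homog 𝒜) :
    cyclicForm ω one (delta X m D) E zs as a₀ = cyclicForm ω one (brace X.q D) E zs as a₀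
      - m.negOnePow • cyclicForm ω one (brace D X.q) E zs as a₀
      + m.negOnePow • cyclicForm ω one (closed X.l D) E zs as a₀ := by
  simp only [cyclicForm_apply, form_delta, smul_add, smul_sub, splitSum_add, splitSum_sub,
    shuffleSum_add, shuffleSum_sub, ← shuffleSum_units_smul, ← splitSum_units_smul,
    smul_comm m.negOnePow]

theorem cyclicForm_delta_right (X : OCHA 𝒵 𝒜) (ω : SymplecticForm 𝒜) (one : 𝒜 (-1))
    (D : cochains 𝒵 𝒜 m) (E : cochains 𝒵 𝒜 n)
    (zs : List (Homog 𝒵)) (as : List (Homog 𝒜)) (a₀ : Homog 𝒜) :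
    cyclicForm ω one D (delta X n E) zs as a₀ = cyclicForm ω one D (brace X.q E) zs as a₀
      - n.negOnePow • cyclicForm ω one D (brace E X.q) zs as a₀
      + n.negOnePow • cyclicForm ω one D (closed X.l E) zs as a₀ := by
  have hslot : ∀ J, IsMultilin fun as => ω.form (D.1 J as) (one : A) :=
    fun J => isMultilin_form ω one (D.2.2.2.1 J)
  simp only [cyclicForm_apply, apply_out_delta (hslot _), smul_add, smul_sub, splitSum_add,
    splitSum_sub, shuffleSum_add, shuffleSum_sub, ← shuffleSum_units_smul, ← splitSum_units_smul,
    smul_comm n.negOnePow, add_comm 1 n]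

/-- Pairing the sum of all terms in which `D` precedes `E` leaves only the brace `D{E}` and the
terms that cancel against `Δ(q{D, E})`. -/
theorem OCHA.IsUnit.form_cyclicBrace_relation {X : OCHA 𝒵 𝒜} {ω : SymplecticForm 𝒜} {one : 𝒜 (-1)}
    (hone : X.IsUnit one) (hω : X.IsCyclic ω) (D : cochains 𝒵 𝒜 m) (E : cochains 𝒵 𝒜 n)
    (zs : List (Homog 𝒵)) (as : List (Homog 𝒜)) (a₀ : Homog 𝒜) :
    ω.form ((brace₂ X.q (bvDelta ω one D) E).1 zs as) a₀.2
      + ω.form ((delta X _ (cyclicBrace ω one D E)).1 zs as) a₀.2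
      + cyclicForm ω one (delta X m D) E zs as a₀
      + m.negOnePow • cyclicForm ω one D (delta X n E) zs as a₀ =
    ω.deg.negOnePow • (ω.form ((brace D E).1 zs as) a₀.2 + crossForm ω D E zs as a₀) := by
  -- Once the differentials are expanded and the closed terms cancel, this accounts for everything
  -- except (q{D}){E, Δ}.
  have h₁ := cyclic_cancellation hω one D E zs as a₀
  rw [form_delta, form_closed_cyclicBrace, cyclicForm_delta_left, cyclicForm_delta_right,
    hone.cyclicForm_brace hω]
  rw [Int.negOnePow_sub, Int.negOnePow_one]
  rw [Int.negOnePow_add] at h₁ ⊢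
  rcases Int.units_eq_one_or m.negOnePow with hm | hm <;>
    rcases Int.units_eq_one_or n.negOnePow with hn | hn <;>
    simp only [hm, hn, Units.neg_smul, one_smul, neg_neg, mul_neg, mul_one] at h₁ ⊢ <;>
    linear_combination h₁

/-- This is the relation for the order D, E minus (-1)^{|D||E|} times the relation for E, D. The
leftover cross terms are exactly those of Δ(q{D, E}), with opposite sign. -/
theorem bracketFun_eq {X : OCHA 𝒵 𝒜} {ω : SymplecticForm 𝒜} (hω : X.IsCyclic ω)
    {one : 𝒜 (-1)} (hone : X.IsUnit one) (D : cochains 𝒵 𝒜 m) (E : cochains 𝒵 𝒜 n) :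
    bracketFun D E = ω.deg.negOnePow •
        ((bvDelta ω one (brace₂ X.q D E)).1
          + (brace₂ X.q (bvDelta ω one D) E).1
          - (m * n).negOnePow • (brace₂ X.q (bvDelta ω one E) D).1
          + (delta X _ (cyclicBrace ω one D E)).1
          - (m * n).negOnePow • (delta X _ (cyclicBrace ω one E D)).1
          + (cyclicBrace ω one (delta X _ D) E).1
          - (m * n).negOnePow • (cyclicBrace ω one (delta X _ E) D).1
          + m.negOnePow • (cyclicBrace ω one D (delta X _ E)).1
          - (n + m * n).negOnePow • (cyclicBrace ω one E (delta X _ D)).1) := by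
  funext zs as
  -- Nondegeneracy separates elements of one graded piece only. All summands take values in the same
  -- piece, although their degrees are written differently.
  have mem : ∀ {r : ℤ} (Y : cochains 𝒵 𝒜 r), r = m + n →
      Y.1 zs as ∈ 𝒜 (m + n + totalDeg zs + totalDeg as) := by
    rintro r Y rfl
    exact Y.2.1 zs as
  refine ω.eq_of_form_eq (e := m + n + totalDeg zs + totalDeg as) ?_ ?_ fun a => ?_
  · exact sub_mem (mem _ rfl) (units_smul_mem _ _ (mem (brace E D) (add_comm _ _)))
  · refine units_smul_mem _ _ (sub_mem (add_mem (sub_mem (add_mem (sub_mem (add_mem (sub_mem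
      (add_mem (mem (bvDelta ω one (brace₂ X.q D E)) ?_)
      (mem (brace₂ X.q (bvDelta ω one D) E) ?_)) (units_smul_mem _ _
      (mem (brace₂ X.q (bvDelta ω one E) D) ?_)))
      (mem (delta X _ (cyclicBrace ω one D E)) ?_)) (units_smul_mem _ _
      (mem (delta X _ (cyclicBrace ω one E D)) ?_)))
      (mem (cyclicBrace ω one (delta X _ D) E) ?_)) (units_smul_mem _ _
      (mem (cyclicBrace ω one (delta X _ E) D) ?_)))
      (units_smul_mem _ _ (mem (cyclicBrace ω one D (delta X _ E)) ?_)))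
      (units_smul_mem _ _ (mem (cyclicBrace ω one E (delta X _ D)) ?_))) <;> ring
  · have h₁ := hone.form_cyclicBrace_relation hω D E zs as ⟨_, a⟩
    have h₂ := hone.form_cyclicBrace_relation hω E D zs as ⟨_, a⟩
    have h₃ := hone.deltaForm_brace₂ hω D E zs as ⟨_, a⟩
    simp only [bracketFun, Pi.add_apply, Pi.sub_apply, Pi.smul_apply, map_add, map_sub,
      LinearMap.add_apply, LinearMap.sub_apply, form_units_smul]
    rw [form_bvDelta ω one _ zs as ⟨_, a⟩, form_cyclicBrace ω one _ _ zs as ⟨_, a⟩,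
      form_cyclicBrace ω one _ _ zs as ⟨_, a⟩, form_cyclicBrace ω one _ _ zs as ⟨_, a⟩,
      form_cyclicBrace ω one _ _ zs as ⟨_, a⟩, Int.negOnePow_add]
    rcases Int.units_eq_one_or n.negOnePow with hn | hn <;>
      rcases Int.units_eq_one_or (m * n).negOnePow with hmn | hmn <;>
      rcases Int.units_eq_one_or ω.deg.negOnePow with hd | hd <;>
      simp only [hn, hmn, hd, Units.neg_smul, one_smul, neg_neg, mul_neg,
        mul_one] at h₁ h₂ h₃ ⊢
    -- The four combinations correspond to the four values of the pair (-1)^{|ω|}, (-1)^{|D||E|}.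
    all_goals first
      | linear_combination h₂ - h₁ - h₃
      | linear_combination -h₂ - h₁ - h₃
      | linear_combination h₁ + h₃ - h₂
      | linear_combination h₁ + h₃ + h₂

/-! ### The differential and the three operations -/

theorem deltaForm_delta (X : OCHA 𝒵 𝒜) (ω : SymplecticForm 𝒜) (one : 𝒜 (-1))
    (D : cochains 𝒵 𝒜 m) (zs : List (Homog 𝒵)) (as : List (Homog 𝒜)) (a₀ : Homog 𝒜) :
    deltaForm ω one (delta X m D) zs as a₀ = deltaForm ω one (brace X.q D) zs as a₀
      - m.negOnePow • deltaForm ω one (brace D X.q) zs as a₀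
      + m.negOnePow • deltaForm ω one (closed X.l D) zs as a₀ := by
  simp only [deltaForm_apply, form_delta, smul_add, smul_sub, splitSum_add, splitSum_sub,
    ← splitSum_units_smul, smul_comm m.negOnePow]

theorem form_closed_bvDelta (l : LInfinity 𝒵) (ω : SymplecticForm 𝒜) (one : 𝒜 (-1))
    (D : cochains 𝒵 𝒜 m) (zs : List (Homog 𝒵)) (as : List (Homog 𝒜)) (a₀ : Homog 𝒜) :
    ω.form ((closed l (bvDelta ω one D)).1 zs as) a₀.2 =
      deltaForm ω one (closed l D) zs as a₀ := by
  simp only [form_closed, form_bvDelta, deltaForm_apply, splitSum_shuffleSum,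
    shuffleSum_units_smul']

theorem add_eq_of_matching₃ {t₁ t₂ t₃ r₁ r₂ r₃ : W} (h₁ : t₁ = r₂) (h₂ : t₂ = r₁) (h₃ : t₃ = r₃) :
    t₁ + (t₂ + t₃) = r₁ + (r₂ + r₃) := by
  subst h₁ h₂ h₃
  abel

/-- In Δ(D{q}) the inserted q either contains a₀ or lies on one of its two sides. The first case is
q{ΔD} after rotating q; the other two make up (ΔD){q}. -/
theorem form_brace_bvDelta {X : OCHA 𝒵 𝒜} {ω : SymplecticForm 𝒜} (hω : X.IsCyclic ω)
    (one : 𝒜 (-1)) (D : cochains 𝒵 𝒜 m)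
    (zs : List (Homog 𝒵)) (as : List (Homog 𝒜)) (a₀ : Homog 𝒜) :
    ω.form ((brace X.q (bvDelta ω one D)).1 zs as) a₀.2
      + m.negOnePow • ω.form ((brace (bvDelta ω one D) X.q).1 zs as) a₀.2
      = m.negOnePow • deltaForm ω one (brace D X.q) zs as a₀ := by
  have hslot : ∀ J, IsMultilin fun as => ω.form (D.1 J as) (one : A) :=
    fun J => isMultilin_form ω one (D.2.2.2.1 J)
  simp only [form_brace, hω.form_out, form_bvDelta,
    deltaForm_apply, splitSum_append_cons,
    splitSum_shuffleSum, splitSum_add, shuffleSum_add, shuffleSum_units_smul',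
    splitSum_units_smul', smul_smul, ← Int.negOnePow_add, splitSum_assoc, splitSum_assoc_two,
    smul_add,
    List.append_assoc, List.cons_append]
  simp only [add_assoc]
  refine add_eq_of_matching₃ (shuffleSum_swap_eq ?_) (shuffleSum_congr ?_) (shuffleSum_congr ?_)
  all_goals
    intro _ _ e
    try simp only [splitSum_units_smul', smul_smul, ← Int.negOnePow_add]
    refine splitSum_congr fun _ _ h₁ => splitSum_congr fun _ _ h₂ => splitSum_congr fun _ _ h₃ => ?_
    subst h₃ h₂ h₁
    congr 1
    apply negOnePow_congr
    simp only [totalDeg_append, totalDeg_cons, out_fst]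
    push_cast
    grind

/-- Against the unit, q{D} becomes q_{0,2} of D and one remaining entry of the cyclic word. That
entry can stand on either side of D, and the two contributions are opposite by skew symmetry of ω.
-/
theorem OCHA.IsUnit.deltaForm_brace {X : OCHA 𝒵 𝒜} {ω : SymplecticForm 𝒜} {one : 𝒜 (-1)}
    (hone : X.IsUnit one) (hω : X.IsCyclic ω) (D : cochains 𝒵 𝒜 m)
    (zs : List (Homog 𝒵)) (as : List (Homog 𝒜)) (a₀ : Homog 𝒜) :
    deltaForm ω one (brace X.q D) zs as a₀ = 0 := by
  simp only [deltaForm_apply, form_brace, hone.form_one hω,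
    splitSum_append_cons, atNil_append_cons, onLetter_append_cons, atNil_zero, add_zero,
    smul_atNil, smul_onLetter, atNil_add,
    splitSum_add, shuffleSum_add, splitSum_units_smul', smul_smul, ← Int.negOnePow_add,
    splitSum_assoc, smul_add,
    splitSum_atNil_const, splitSum_atNil_left,
    splitSum_atNil_right, shuffleSum_atNil_left]
  have cancel : ∀ {t₁ t₂ t₃ t₄ : k}, t₁ = -t₃ → t₂ = -t₄ → t₁ + (t₂ + t₃) + t₄ = 0 := by
    intro t₁ t₂ t₃ t₄ h₁ h₂
    rw [h₁, h₂]
    abel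
  -- The entry left over by D is an ordinary input in the first goal and a₀ in the second.
  refine cancel ?_ ?_
  · simp only [← splitSum_neg]
    refine splitSum_congr fun _ _ h₁ => splitSum_congr fun q _ h₂ => ?_
    subst h₂ h₁
    rcases q with _ | ⟨x, _ | ⟨y, q⟩⟩
    · simp [onLetter]
    · simp only [onLetter]
      rw [ω.form_comm, smul_smul, ← Int.negOnePow_add, ← Units.neg_smul, ← Int.negOnePow_succ]
      congr 1
      apply negOnePow_congr
      simp only [totalDeg_append, totalDeg_cons, totalDeg_nil, out_fst]
      push_cast
      grind
    · simp [onLetter]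
  · rw [ω.form_comm (out D zs as), smul_smul, ← Int.negOnePow_add, ← Units.neg_smul,
      ← Int.negOnePow_succ]
    congr 1
    apply negOnePow_congr
    simp only [totalDeg_cons, totalDeg_nil, List.nil_append, out_fst]
    push_cast
    grind

/-- The BV operator anticommutes with the Hochschild differential. -/
theorem delta_bvDelta {X : OCHA 𝒵 𝒜} {ω : SymplecticForm 𝒜} (hω : X.IsCyclic ω)
    {one : 𝒜 (-1)} (hone : X.IsUnit one) (D : cochains 𝒵 𝒜 m) :
    (delta X _ (bvDelta ω one D)).1 = -(bvDelta ω one (delta X m D)).1 := by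
  funext zs as
  refine ω.eq_of_form_eq (e := m + totalDeg zs + totalDeg as) ?_ (neg_mem ?_) fun a => ?_
  · simpa using (delta X _ (bvDelta ω one D)).2.1 zs as
  · simpa using (bvDelta ω one (delta X m D)).2.1 zs as
  · have h := form_brace_bvDelta hω one D zs as ⟨_, a⟩
    simp only [Pi.neg_apply, map_neg, LinearMap.neg_apply]
    rw [form_bvDelta ω one _ zs as ⟨_, a⟩, form_delta, deltaForm_delta,
      form_closed_bvDelta X.l ω one D zs as ⟨_, a⟩, hone.deltaForm_brace hω, Int.negOnePow_sub,
      Int.negOnePow_one]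
    simp only [mul_neg, mul_one, Units.neg_smul]
    linear_combination h

theorem brace_delta_left (X : OCHA 𝒵 𝒜) (D : cochains 𝒵 𝒜 m) (E : cochains 𝒵 𝒜 n) :
    (brace (delta X m D) E).1 = (brace (brace X.q D) E).1
      - m.negOnePow • (brace (brace D X.q) E).1 + m.negOnePow • (brace (closed X.l D) E).1 := by
  funext zs as
  simp only [Pi.add_apply, Pi.sub_apply, Pi.smul_apply, brace_apply (delta X m D),
    brace_apply (brace X.q D), brace_apply (brace D X.q), brace_apply (closed X.l D), delta_apply,
    smul_add, smul_sub, splitSum_add, splitSum_sub, shuffleSum_add, shuffleSum_sub,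
    ← shuffleSum_units_smul, ← splitSum_units_smul, smul_comm m.negOnePow]

theorem brace_delta_right (X : OCHA 𝒵 𝒜) (D : cochains 𝒵 𝒜 m) (E : cochains 𝒵 𝒜 n) :
    (brace D (delta X n E)).1 = (brace D (brace X.q E)).1
      - n.negOnePow • (brace D (brace E X.q)).1 + n.negOnePow • (brace D (closed X.l E)).1 := by
  funext zs as
  simp only [Pi.add_apply, Pi.sub_apply, Pi.smul_apply, brace_apply D,
    apply_out_delta (D.2.2.2.1 _),
    smul_add, smul_sub, splitSum_add, splitSum_sub, shuffleSum_add, shuffleSum_sub,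
    ← shuffleSum_units_smul, ← splitSum_units_smul, smul_comm n.negOnePow, add_comm 1 n]

theorem brace₂_delta_left (X : OCHA 𝒵 𝒜) (Q : cochains 𝒵 𝒜 p) (D : cochains 𝒵 𝒜 m)
    (E : cochains 𝒵 𝒜 n) :
    (brace₂ Q (delta X m D) E).1 = (brace₂ Q (brace X.q D) E).1
      - m.negOnePow • (brace₂ Q (brace D X.q) E).1
      + m.negOnePow • (brace₂ Q (closed X.l D) E).1 := by
  funext zs as
  simp only [Pi.add_apply, Pi.sub_apply, Pi.smul_apply, brace₂_apply Q,
    apply_out_delta (Q.2.2.2.1 _),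
    smul_add, smul_sub, splitSum_add, splitSum_sub, shuffleSum_add, shuffleSum_sub,
    ← shuffleSum_units_smul, ← splitSum_units_smul, smul_comm m.negOnePow, add_comm 1 m]

theorem brace₂_delta_right (X : OCHA 𝒵 𝒜) (Q : cochains 𝒵 𝒜 p) (D : cochains 𝒵 𝒜 m)
    (E : cochains 𝒵 𝒜 n) :
    (brace₂ Q D (delta X n E)).1 = (brace₂ Q D (brace X.q E)).1
      - n.negOnePow • (brace₂ Q D (brace E X.q)).1
      + n.negOnePow • (brace₂ Q D (closed X.l E)).1 := by
  have hQ : ∀ (zs : List (Homog 𝒵)) (u v w : List (Homog 𝒜)) (x : Homog 𝒜) (L : List (Homog 𝒵))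
      (K : List (Homog 𝒜)),
      Q.1 zs (u ++ x :: (v ++ out (delta X n E) L K :: w)) =
        Q.1 zs (u ++ x :: (v ++ out (brace X.q E) L K :: w))
        - n.negOnePow • Q.1 zs (u ++ x :: (v ++ out (brace E X.q) L K :: w))
        + n.negOnePow • Q.1 zs (u ++ x :: (v ++ out (closed X.l E) L K :: w)) := by
    intro zs u v w x L K
    simpa using apply_out_delta (Q.2.2.2.1 zs) X E (u ++ x :: v) w L K
  funext zs as
  simp only [Pi.add_apply, Pi.sub_apply, Pi.smul_apply, brace₂_apply Q, hQ,
    smul_add, smul_sub, splitSum_add, splitSum_sub, shuffleSum_add, shuffleSum_sub,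
    ← shuffleSum_units_smul, ← splitSum_units_smul, smul_comm n.negOnePow, add_comm 1 n]

/-- The brace is a homotopy for the graded commutativity of the cup product `q{D, E}`. -/
theorem delta_brace (X : OCHA 𝒵 𝒜) (D : cochains 𝒵 𝒜 m) (E : cochains 𝒵 𝒜 n) :
    (delta X _ (brace D E)).1 = (brace (delta X m D) E).1
      + m.negOnePow • (brace D (delta X n E)).1
      - ((brace₂ X.q D E).1 + (m * n).negOnePow • (brace₂ X.q E D).1) := by
  -- This identity is the source of the cup terms. The double braces D{q, E} and D{E, q} of the next
  -- two cancel against each other.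
  have h₁ := prelie X.q D E
  have h₂ := prelie D X.q E
  have h₃ := prelie D E X.q
  have h₄ := closed_brace X.l D E
  rw [brace_delta_left, brace_delta_right]
  change (brace X.q (brace D E)).1 - (m + n).negOnePow • (brace (brace D E) X.q).1
    + (m + n).negOnePow • (closed X.l (brace D E)).1 = _
  rw [h₁, h₂, h₃, h₄, mul_one, one_mul, Int.negOnePow_add]
  rcases Int.units_eq_one_or m.negOnePow with hm | hm <;>
    rcases Int.units_eq_one_or n.negOnePow with hn | hn <;>
    simp only [hm, hn, Units.neg_smul, one_smul, neg_neg, mul_neg, mul_one] <;>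
    abel

/-- The Hochschild differential is a derivation of the cup product. -/
theorem delta_cup (X : OCHA 𝒵 𝒜) (D : cochains 𝒵 𝒜 m) (E : cochains 𝒵 𝒜 n) :
    (delta X _ (brace₂ X.q D E)).1 =
      -((brace₂ X.q (delta X m D) E).1 + m.negOnePow • (brace₂ X.q D (delta X n E)).1) := by
  have h₁ := brace_brace₂ X.q X.q D E
  have h₂ := closed_brace₂ X.l X.q D E
  -- Here the OCHA relation enters: (q{q}){D, E} becomes (l̂(q)){D, E}, which cancels the part of
  -- l̂(q{D, E}) where the closed operation feeds into q.
  rw [show brace X.q X.q = closed X.l X.q from Subtype.ext X.q_rel] at h₁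
  rw [brace₂_delta_left, brace₂_delta_right]
  change (brace X.q (brace₂ X.q D E)).1
    - (1 + m + n).negOnePow • (brace (brace₂ X.q D E) X.q).1
    + (1 + m + n).negOnePow • (closed X.l (brace₂ X.q D E)).1 = _
  rw [h₂, show (1 + m + n).negOnePow = -(m + n).negOnePow by
    rw [add_assoc, add_comm, Int.negOnePow_succ]]
  rw [one_mul, one_mul] at h₁
  rw [Int.negOnePow_add] at h₁ ⊢
  rcases Int.units_eq_one_or m.negOnePow with hm | hm <;>
    rcases Int.units_eq_one_or n.negOnePow with hn | hn <;>
    simp only [hm, hn, Units.neg_smul, one_smul, neg_neg, mul_neg, mul_one]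
      at h₁ ⊢ <;>
    linear_combination (norm := module) -h₁

/-- The Hochschild differential is a derivation of the Gerstenhaber bracket. -/
theorem delta_bracket (X : OCHA 𝒵 𝒜) (D : cochains 𝒵 𝒜 m) (E : cochains 𝒵 𝒜 n) :
    (delta X _ (brace D E)).1 - (m * n).negOnePow • (delta X _ (brace E D)).1 =
      bracketFun (delta X m D) E + m.negOnePow • bracketFun D (delta X n E) := by
  -- The combination q{D, E} + (-1)^{|D||E|} q{E, D} is graded symmetric, so it disappears on
  -- antisymmetrizing.
  rw [delta_brace, delta_brace, bracketFun, bracketFun, mul_comm n m, add_mul, mul_add, one_mul,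
    mul_one, Int.negOnePow_add, Int.negOnePow_add]
  rcases Int.units_eq_one_or m.negOnePow with hm | hm <;>
    rcases Int.units_eq_one_or n.negOnePow with hn | hn <;>
    rcases Int.units_eq_one_or (m * n).negOnePow with hmn | hmn <;>
    simp only [hm, hn, hmn, Units.neg_smul, one_smul, neg_neg, mul_neg,
      mul_one] <;>
    abel

/-! ### Normalization and linearity of the operations -/

theorem apply_out_eq_zero {f : List (Homog 𝒜) → W} (hf : IsMultilin f) {D : cochains 𝒵 𝒜 m}
    {zs : List (Homog 𝒵)} {as : List (Homog 𝒜)} (h : D.1 zs as = 0) (pre post : List (Homog 𝒜)) :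
    f (pre ++ out D zs as :: post) = 0 := by
  obtain ⟨F, hF⟩ := hf.exists_linearMap pre post
  simp [hF, out, h]

theorem splitSum_eq_zero {α : Type*} {g : List α → List α → W} {l : List α}
    (h : ∀ p s, p ++ s = l → g p s = 0) : splitSum g l = 0 :=
  (splitSum_congr h).trans (splitSum_zero l)

theorem shuffleSum_eq_zero {g : List (Homog 𝒵) → List (Homog 𝒵) → W} {l : List (Homog 𝒵)}
    (h : ∀ p s, g p s = 0) : shuffleSum g l = 0 :=
  (shuffleSum_congr fun p s _ => h p s).trans (shuffleSum_zero l)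

variable {one : 𝒜 (-1)} {D : cochains 𝒵 𝒜 m} {E : cochains 𝒵 𝒜 n}

theorem brace_mem_normalized (hD : D ∈ normalized 𝒵 one m) (hE : E ∈ normalized 𝒵 one n) :
    brace D E ∈ normalized 𝒵 one (m + n) := by
  intro zs as h
  rw [brace_apply]
  refine shuffleSum_eq_zero fun J L =>
      splitSum_eq_zero fun I r e => splitSum_eq_zero fun K I' e' => ?_
  subst e' e
  simp only [List.mem_append] at h
  rcases h with h | h | h
  · rw [hD _ _ (by simp [h]), smul_zero]
  · rw [apply_out_eq_zero (D.2.2.2.1 J) (hE _ _ h), smul_zero]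
  · rw [hD _ _ (by simp [h]), smul_zero]

/-- The structure q is not itself normalized, because of q_{0,2}. But a unit occurring outside the
inputs of D and E is at least a third input of q, and there q vanishes. -/
theorem cup_mem_normalized {X : OCHA 𝒵 𝒜} (hone : X.IsUnit one) (hD : D ∈ normalized 𝒵 one m)
    (hE : E ∈ normalized 𝒵 one n) : brace₂ X.q D E ∈ normalized 𝒵 one (1 + m + n) := by
  intro zs as h
  rw [brace₂_apply]
  refine shuffleSum_eq_zero fun J R => shuffleSum_eq_zero fun L M =>
    splitSum_eq_zero fun I r e => splitSum_eq_zero fun K r' e' => splitSum_eq_zero fun I' r'' e'' =>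
    splitSum_eq_zero fun N I'' e''' => ?_
  subst e''' e'' e' e
  have vanish : (⟨-1, one⟩ : Homog 𝒜) ∈ I ++ (I' ++ I'') →
      X.q.1 J (I ++ out D L K :: (I' ++ out E M N :: I'')) = 0 := by
    intro h
    have := List.length_pos_of_mem h
    refine hone.vanish _ _ ?_ ?_
    · simp only [List.mem_append, List.mem_cons] at h ⊢
      tauto
    · simp only [List.length_append, List.length_cons] at this ⊢
      omega
  simp only [List.mem_append] at h vanish
  rcases h with h | h | h | h | h
  · rw [vanish (by tauto), smul_zero]
  · rw [apply_out_eq_zero (X.q.2.2.2.1 J) (hD _ _ h), smul_zero]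
  · rw [vanish (by tauto), smul_zero]
  · have := apply_out_eq_zero (X.q.2.2.2.1 J) (hE M _ h) (I ++ out D L K :: I') I''
    simp only [List.append_assoc, List.cons_append] at this
    rw [this, smul_zero]
  · rw [vanish (by tauto), smul_zero]

theorem SymplecticForm.eq_zero_of_form_eq_zero (ω : SymplecticForm 𝒜) {e : ℤ} {x : A} (hx : x ∈ 𝒜 e)
    (h : ∀ a : Homog 𝒜, ω.form x a.2 = 0) : x = 0 :=
  ω.eq_of_form_eq hx (𝒜 e).zero_mem fun a => by simpa using h ⟨_, a⟩

theorem bvDelta_mem_normalized (ω : SymplecticForm 𝒜) (hD : D ∈ normalized 𝒵 one m) :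
    bvDelta ω one D ∈ normalized 𝒵 one (m - 1) := by
  intro zs as h
  refine ω.eq_zero_of_form_eq_zero ((bvDelta ω one D).2.1 zs as) fun a => ?_
  rw [form_bvDelta, deltaForm_apply]
  refine splitSum_eq_zero fun p s e => ?_
  subst e
  simp only [List.mem_append] at h
  rw [hD _ _ (by simp only [List.mem_append, List.mem_cons]; tauto), map_zero,
    LinearMap.zero_apply, smul_zero]

theorem cyclicBrace_mem_normalized (ω : SymplecticForm 𝒜) (hD : D ∈ normalized 𝒵 one m)
    (hE : E ∈ normalized 𝒵 one n) : cyclicBrace ω one D E ∈ normalized 𝒵 one (m + n - 1) := by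
  intro zs as h
  refine ω.eq_zero_of_form_eq_zero ((cyclicBrace ω one D E).2.1 zs as) fun a => ?_
  rw [form_cyclicBrace, cyclicForm_apply]
  refine shuffleSum_eq_zero fun J L => splitSum_eq_zero fun p r e => splitSum_eq_zero fun I r' e' =>
    splitSum_eq_zero fun K I' e'' => ?_
  subst e'' e' e
  have vanish : D.1 J (I ++ out E L K :: (I' ++ a :: p)) = 0 := by
    simp only [List.mem_append] at h
    by_cases hK : (⟨-1, one⟩ : Homog 𝒜) ∈ K
    · exact apply_out_eq_zero (D.2.2.2.1 J) (hE _ _ hK) _ _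
    · exact hD _ _ (by simp only [List.mem_append, List.mem_cons]; tauto)
  rw [vanish, map_zero, LinearMap.zero_apply, smul_zero]

/-- Without inputs the defining sum is the single term ω(D(E(), a₀), 1), which contains the (0,0)
component of E. -/
theorem cyclicBrace_nil (ω : SymplecticForm 𝒜) (one : 𝒜 (-1)) (D : cochains 𝒵 𝒜 m)
    (hE : E.1 [] [] = 0) : (cyclicBrace ω one D E).1 [] [] = 0 := by
  refine ω.eq_zero_of_form_eq_zero ((cyclicBrace ω one D E).2.1 [] []) fun a => ?_
  rw [form_cyclicBrace, cyclicForm_apply]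
  simp only [shuffleSum, splitSum]
  rw [apply_out_eq_zero (D.2.2.2.1 []) hE, map_zero, LinearMap.zero_apply, smul_zero]

theorem cyclicBrace_zero_left (ω : SymplecticForm 𝒜) (one : 𝒜 (-1)) (E : cochains 𝒵 𝒜 n) :
    (cyclicBrace ω one (0 : cochains 𝒵 𝒜 m) E).1 = 0 := by
  funext zs as
  refine ω.eq_zero_of_form_eq_zero ((cyclicBrace ω one _ E).2.1 zs as) fun a => ?_
  rw [form_cyclicBrace, cyclicForm_apply]
  exact shuffleSum_eq_zero fun _ _ => splitSum_eq_zero fun _ _ _ => splitSum_eq_zero fun _ _ _ =>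
    splitSum_eq_zero fun _ _ _ => by simp

theorem cyclicBrace_zero_right (ω : SymplecticForm 𝒜) (one : 𝒜 (-1)) (D : cochains 𝒵 𝒜 m) :
    (cyclicBrace ω one D (0 : cochains 𝒵 𝒜 n)).1 = 0 := by
  funext zs as
  refine ω.eq_zero_of_form_eq_zero ((cyclicBrace ω one D _).2.1 zs as) fun a => ?_
  rw [form_cyclicBrace, cyclicForm_apply]
  refine shuffleSum_eq_zero fun J _ => splitSum_eq_zero fun _ _ _ => splitSum_eq_zero fun _ _ _ =>
    splitSum_eq_zero fun _ _ _ => ?_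
  rw [apply_out_eq_zero (D.2.2.2.1 J) rfl, map_zero, LinearMap.zero_apply, smul_zero]

theorem bvDelta_linear (ω : SymplecticForm 𝒜) (one : 𝒜 (-1)) :
    IsLinearMap k (fun D : cochains 𝒵 𝒜 m => (bvDelta ω one D).1) := by
  constructor
  · intro D E
    funext zs as
    refine ω.eq_of_form_eq ((bvDelta ω one (D + E)).2.1 zs as)
      (add_mem ((bvDelta ω one D).2.1 zs as) ((bvDelta ω one E).2.1 zs as)) fun a => ?_
    simp only [Pi.add_apply, map_add, LinearMap.add_apply]
    rw [form_bvDelta ω one _ zs as ⟨_, a⟩, form_bvDelta ω one _ zs as ⟨_, a⟩,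
      form_bvDelta ω one _ zs as ⟨_, a⟩]
    simp only [deltaForm_apply, Submodule.coe_add, Pi.add_apply, map_add, LinearMap.add_apply,
      smul_add, splitSum_add]
  · intro c D
    funext zs as
    refine ω.eq_of_form_eq ((bvDelta ω one (c • D)).2.1 zs as)
      (Submodule.smul_mem _ c ((bvDelta ω one D).2.1 zs as)) fun a => ?_
    simp only [Pi.smul_apply, map_smul, LinearMap.smul_apply]
    rw [form_bvDelta ω one _ zs as ⟨_, a⟩, form_bvDelta ω one _ zs as ⟨_, a⟩]
    have h : IsLinearMap k fun D : cochains 𝒵 𝒜 m => deltaForm ω one D zs as ⟨_, a⟩ :=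
      splitSum_isLinearMap _ fun p s => isLinearMap_units_smul _
        ⟨fun _ _ => by simp, fun _ _ => by simp⟩
    exact h.map_smul c D

theorem brace₂_linear_left (Q : cochains 𝒵 𝒜 p) (E : cochains 𝒵 𝒜 n) :
    IsLinearMap k (fun D : cochains 𝒵 𝒜 m => (brace₂ Q D E).1) := by
  have h : ∀ zs as, IsLinearMap k (fun D : cochains 𝒵 𝒜 m => brace₂Fun Q D E zs as) :=
    fun zs as => shuffleSum_isLinearMap _ fun J R => shuffleSum_isLinearMap _ fun L M =>
      splitSum_isLinearMap _ fun I r => splitSum_isLinearMap _ fun K r' =>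
      splitSum_isLinearMap _ fun I' r'' => splitSum_isLinearMap _ fun N I'' =>
      isLinearMap_units_smul _
        ⟨fun x y => (Q.2.2.2.1 J I (I' ++ out E M N :: I'') _).map_add (out x L K).2 (out y L K).2,
          fun c x => (Q.2.2.2.1 J I (I' ++ out E M N :: I'') _).map_smul c (out x L K).2⟩
  exact ⟨fun x y => funext fun zs => funext fun as => (h zs as).map_add x y,
    fun c x => funext fun zs => funext fun as => (h zs as).map_smul c x⟩

theorem brace₂_linear_right (Q : cochains 𝒵 𝒜 p) (D : cochains 𝒵 𝒜 m) :
    IsLinearMap k (fun E : cochains 𝒵 𝒜 n => (brace₂ Q D E).1) := by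
  have hQ : ∀ J L M I K I' N I'', IsLinearMap k fun E : cochains 𝒵 𝒜 n =>
      Q.1 J (I ++ out D L K :: (I' ++ out E M N :: I'')) := by
    intro J L M I K I' N I''
    have h := Q.2.2.2.1 J (I ++ out D L K :: I') I'' (n + totalDeg M + totalDeg N)
    simp only [List.append_assoc, List.cons_append] at h
    exact ⟨fun x y => h.map_add (out x M N).2 (out y M N).2,
      fun c x => h.map_smul c (out x M N).2⟩
  have h : ∀ zs as, IsLinearMap k (fun E : cochains 𝒵 𝒜 n => brace₂Fun Q D E zs as) :=
    fun zs as => shuffleSum_isLinearMap _ fun J R => shuffleSum_isLinearMap _ fun L M =>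
      splitSum_isLinearMap _ fun I r => splitSum_isLinearMap _ fun K r' =>
      splitSum_isLinearMap _ fun I' r'' => splitSum_isLinearMap _ fun N I'' =>
      isLinearMap_units_smul _ (hQ J L M I K I' N I'')
  exact ⟨fun x y => funext fun zs => funext fun as => (h zs as).map_add x y,
    fun c x => funext fun zs => funext fun as => (h zs as).map_smul c x⟩

theorem LinearMap.exists_bilin_quotient {P Q R : Type*} [AddCommGroup P] [Module k P]
    [AddCommGroup Q] [Module k Q] [AddCommGroup R] [Module k R] {p : Submodule k P}
    {q : Submodule k Q} {r : Submodule k R} (F : P →ₗ[k] Q →ₗ[k] R)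
    (hp : ∀ x ∈ p, ∀ y, F x y ∈ r) (hq : ∀ x, ∀ y ∈ q, F x y ∈ r) :
    ∃ G : P ⧸ p →ₗ[k] Q ⧸ q →ₗ[k] R ⧸ r, ∀ x y,
      G (Submodule.Quotient.mk x) (Submodule.Quotient.mk y) = Submodule.Quotient.mk (F x y) := by
  let F₁ : P ⧸ p →ₗ[k] Q →ₗ[k] R ⧸ r := p.liftQ (F.compr₂ r.mkQ) fun x hx =>
    LinearMap.ext fun y => (Submodule.Quotient.mk_eq_zero r).2 (hp x hx y)
  have hF₁ : ∀ x y, F₁ (Submodule.Quotient.mk x) y = Submodule.Quotient.mk (F x y) :=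
    fun x y => rfl
  let G : Q ⧸ q →ₗ[k] P ⧸ p →ₗ[k] R ⧸ r := q.liftQ F₁.flip fun y hy =>
    LinearMap.ext fun x => by
      induction x using Submodule.Quotient.induction_on with
      | _ x => exact (Submodule.Quotient.mk_eq_zero r).2 (hq x y hy)
  exact ⟨G.flip, fun x y => rfl⟩

theorem coe_units_smul (u : ℤˣ) (D : cochains 𝒵 𝒜 m) : (u • D).1 = u • D.1 := by
  rcases Int.units_eq_one_or u with rfl | rfl <;> simp

/-- Degrees such as n + m and m + n index different types of cochains, while the underlying
functions share one type. Transport is therefore expressed through equality of underlying functions,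
here and in the congruence lemmas below. -/
theorem exists_coe_eq (h : m = n) (D : cochains 𝒵 𝒜 m) : ∃ D' : cochains 𝒵 𝒜 n, D'.1 = D.1 := by
  subst h
  exact ⟨D, rfl⟩

theorem delta_eq_of_eq (X : OCHA 𝒵 𝒜) (h : m = n) {D : cochains 𝒵 𝒜 m} {E : cochains 𝒵 𝒜 n}
    (e : D.1 = E.1) : (delta X m D).1 = (delta X n E).1 := by
  subst h
  rw [Subtype.ext e]

/-! ### Descent to cohomology -/

section Cocycles

variable {X : OCHA 𝒵 𝒜} {one : 𝒜 (-1)}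

theorem mem_cocycles {D : cochains 𝒵 𝒜 m} (h : m = n) (hD : D ∈ normalized 𝒵 one m)
    (hδ : (delta X m D).1 = 0) : D.1 ∈ cocycles X one n := by
  subst h
  exact ⟨D, ⟨hD, Subtype.ext hδ⟩, rfl⟩

theorem mem_coboundaries {B : cochains 𝒵 𝒜 m} (h : m + 1 = n) (hB : B ∈ normalized 𝒵 one m) :
    (delta X m B).1 ∈ coboundaries X one n := by
  obtain rfl : m = n - 1 := by omega
  exact ⟨_, ⟨B, hB, rfl⟩, rfl⟩

theorem exists_of_mem_coboundaries {f : List (Homog 𝒵) → List (Homog 𝒜) → A}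
    (hf : f ∈ coboundaries X one n) : ∃ B ∈ normalized 𝒵 one (n - 1), (delta X _ B).1 = f := by
  obtain ⟨_, ⟨B, hB, rfl⟩, rfl⟩ := hf
  exact ⟨B, hB, rfl⟩

theorem normalized_of_mem_cocycles {D : cochains 𝒵 𝒜 n} (h : D.1 ∈ cocycles X one n) :
    D ∈ normalized 𝒵 one n := by
  obtain ⟨D', h', e⟩ := h
  obtain rfl : D' = D := Subtype.ext e
  exact h'.1

theorem delta_of_mem_cocycles {D : cochains 𝒵 𝒜 n} (h : D.1 ∈ cocycles X one n) :
    delta X n D = 0 := by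
  obtain ⟨D', h', e⟩ := h
  obtain rfl : D' = D := Subtype.ext e
  exact h'.2

/-- The cochain underlying a normalized cocycle. -/
def cocycleCochain (X : OCHA 𝒵 𝒜) (one : 𝒜 (-1)) (n : ℤ)
    : cocycles X one n →ₗ[k] cochains 𝒵 𝒜 n where
  toFun f := ⟨f.1, by obtain ⟨D, _, e⟩ := f.2; exact e ▸ D.2⟩
  map_add' _ _ := rfl
  map_smul' _ _ := rfl

theorem delta_cocycleCochain (f : cocycles X one n) : delta X n (cocycleCochain X one n f) = 0 :=
  delta_of_mem_cocycles (D := cocycleCochain X one n f) f.2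

theorem cocycleCochain_mem_normalized (f : cocycles X one n) :
    cocycleCochain X one n f ∈ normalized 𝒵 one n :=
  normalized_of_mem_cocycles (D := cocycleCochain X one n f) f.2

theorem IsClassOf.eq_of_sub_mem {x y : HH X one n} {f g : List (Homog 𝒵) → List (Homog 𝒜) → A}
    (hx : IsClassOf x f) (hy : IsClassOf y g) (h : f - g ∈ coboundaries X one n) : x = y := by
  obtain ⟨hf, rfl⟩ := hx
  obtain ⟨hg, rfl⟩ := hy
  exact (Submodule.Quotient.eq _).2 h

theorem IsClassOf.add {x y : HH X one n} {f g : List (Homog 𝒵) → List (Homog 𝒜) → A}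
    (hx : IsClassOf x f) (hy : IsClassOf y g) : IsClassOf (x + y) (f + g) := by
  obtain ⟨hf, rfl⟩ := hx
  obtain ⟨hg, rfl⟩ := hy
  exact ⟨add_mem hf hg, rfl⟩

theorem IsClassOf.sub {x y : HH X one n} {f g : List (Homog 𝒵) → List (Homog 𝒜) → A}
    (hx : IsClassOf x f) (hy : IsClassOf y g) : IsClassOf (x - y) (f - g) := by
  obtain ⟨hf, rfl⟩ := hx
  obtain ⟨hg, rfl⟩ := hy
  exact ⟨sub_mem hf hg, rfl⟩

theorem IsClassOf.units_smul {x : HH X one n} {f : List (Homog 𝒵) → List (Homog 𝒜) → A}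
    (hx : IsClassOf x f) (u : ℤˣ) : IsClassOf (u • x) (u • f) := by
  obtain ⟨hf, rfl⟩ := hx
  rcases Int.units_eq_one_or u with rfl | rfl
  · exact ⟨by simpa using hf, by simp⟩
  · refine ⟨by simpa using hf, ?_⟩
    simp only [Units.neg_smul, one_smul, ← Submodule.Quotient.mk_neg]
    rfl

/-- A bilinear operation on cochains descends to cohomology if it preserves normalized cocycles
and sends a coboundary and a cocycle to a coboundary. -/
theorem exists_bilin_HH {e : ℤ} (F : cochains 𝒵 𝒜 m → cochains 𝒵 𝒜 n →
      List (Homog 𝒵) → List (Homog 𝒜) → A)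
    (hl : ∀ E, IsLinearMap k fun D => F D E) (hr : ∀ D, IsLinearMap k (F D))
    (mem : ∀ D E, D ∈ normalized 𝒵 one m → E ∈ normalized 𝒵 one n → delta X m D = 0 →
      delta X n E = 0 → F D E ∈ cocycles X one e)
    (left : ∀ B ∈ normalized 𝒵 one (m - 1), ∀ D E, D.1 = (delta X _ B).1 →
      E ∈ normalized 𝒵 one n → delta X n E = 0 → F D E ∈ coboundaries X one e)
    (right : ∀ B ∈ normalized 𝒵 one (n - 1), ∀ D E, E.1 = (delta X _ B).1 →
      D ∈ normalized 𝒵 one m → delta X m D = 0 → F D E ∈ coboundaries X one e) :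
    ∃ G : HH X one m →ₗ[k] HH X one n →ₗ[k] HH X one e, ∀ x y D E, IsClassOf x D.1 →
      IsClassOf y E.1 → IsClassOf (G x y) (F D E) := by
  let f := cocycleCochain X one m
  let g := cocycleCochain X one n
  have hm : ∀ x y, F (f x) (g y) ∈ cocycles X one e := fun x y =>
    mem _ _ (cocycleCochain_mem_normalized x) (cocycleCochain_mem_normalized y)
      (delta_cocycleCochain x) (delta_cocycleCochain y)
  let F' : cocycles X one m →ₗ[k] cocycles X one n →ₗ[k] cocycles X one e :=
    LinearMap.mk₂ k (fun x y => ⟨F (f x) (g y), hm x y⟩)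
      (fun x x' y => Subtype.ext (((hl (g y)).map_add (f x) (f x'))))
      (fun c x y => Subtype.ext (((hl (g y)).map_smul c (f x))))
      (fun x y y' => Subtype.ext (((hr (f x)).map_add (g y) (g y'))))
      (fun c x y => Subtype.ext (((hr (f x)).map_smul c (g y))))
  have hp : ∀ x ∈ (coboundaries X one m).submoduleOf (cocycles X one m), ∀ y,
      F' x y ∈ (coboundaries X one e).submoduleOf (cocycles X one e) := by
    intro x hx y
    obtain ⟨B, hB, h⟩ := exists_of_mem_coboundaries (X := X) (one := one) hx
    exact left B hB (f x) (g y) h.symm (cocycleCochain_mem_normalized y) (delta_cocycleCochain y)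
  have hq : ∀ x, ∀ y ∈ (coboundaries X one n).submoduleOf (cocycles X one n),
      F' x y ∈ (coboundaries X one e).submoduleOf (cocycles X one e) := by
    intro x y hy
    obtain ⟨B, hB, h⟩ := exists_of_mem_coboundaries (X := X) (one := one) hy
    exact right B hB (f x) (g y) h.symm (cocycleCochain_mem_normalized x) (delta_cocycleCochain x)
  obtain ⟨G, hG⟩ := LinearMap.exists_bilin_quotient F' hp hq
  refine ⟨G, ?_⟩
  rintro _ _ D E ⟨hD, rfl⟩ ⟨hE, rfl⟩
  exact ⟨hm ⟨D.1, hD⟩ ⟨E.1, hE⟩, (hG ⟨D.1, hD⟩ ⟨E.1, hE⟩).symm⟩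

theorem exists_linear_HH {e : ℤ} (F : cochains 𝒵 𝒜 n → List (Homog 𝒵) → List (Homog 𝒜) → A)
    (hF : IsLinearMap k F)
    (mem : ∀ D, D ∈ normalized 𝒵 one n → delta X n D = 0 → F D ∈ cocycles X one e)
    (cobdry : ∀ B ∈ normalized 𝒵 one (n - 1), ∀ D, D.1 = (delta X _ B).1 →
      F D ∈ coboundaries X one e) :
    ∃ G : HH X one n →ₗ[k] HH X one e, ∀ x D, IsClassOf x D.1 → IsClassOf (G x) (F D) := by
  let f := cocycleCochain X one n
  have hm : ∀ x, F (f x) ∈ cocycles X one e := fun x =>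
    mem _ (cocycleCochain_mem_normalized x) (delta_cocycleCochain x)
  let F' : cocycles X one n →ₗ[k] cocycles X one e :=
    { toFun := fun x => ⟨F (f x), hm x⟩
      map_add' := fun x x' => Subtype.ext (hF.map_add (f x) (f x'))
      map_smul' := fun c x => Subtype.ext (hF.map_smul c (f x)) }
  refine ⟨Submodule.mapQ _ _ F' fun x hx => ?_, ?_⟩
  · obtain ⟨B, hB, h⟩ := exists_of_mem_coboundaries (X := X) (one := one) hx
    exact cobdry B hB (f x) h.symm
  · rintro _ D ⟨hD, rfl⟩
    exact ⟨hm ⟨D.1, hD⟩, rfl⟩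

theorem brace₂_congr {m' n' : ℤ} (Q : cochains 𝒵 𝒜 p) {D : cochains 𝒵 𝒜 m} {D' : cochains 𝒵 𝒜 m'}
    (hm : m = m') (hD : D.1 = D'.1) {E : cochains 𝒵 𝒜 n} {E' : cochains 𝒵 𝒜 n'} (hn : n = n')
    (hE : E.1 = E'.1) : (brace₂ Q D E).1 = (brace₂ Q D' E').1 := by
  subst hm hn
  rw [Subtype.ext hD, Subtype.ext hE]

theorem bracketFun_congr {m' n' : ℤ} {D : cochains 𝒵 𝒜 m} {D' : cochains 𝒵 𝒜 m'} (hm : m = m')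
    (hD : D.1 = D'.1) {E : cochains 𝒵 𝒜 n} {E' : cochains 𝒵 𝒜 n'} (hn : n = n')
    (hE : E.1 = E'.1) : bracketFun D E = bracketFun D' E' := by
  subst hm hn
  rw [Subtype.ext hD, Subtype.ext hE]

theorem bvDelta_congr (ω : SymplecticForm 𝒜) {m' : ℤ} {D : cochains 𝒵 𝒜 m}
    {D' : cochains 𝒵 𝒜 m'} (hm : m = m') (hD : D.1 = D'.1) :
    (bvDelta ω one D).1 = (bvDelta ω one D').1 := by
  subst hm
  rw [Subtype.ext hD]

/-- The two halves D{E} and E{D} of the bracket lie in cochain spaces indexed by m + n and n + m.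
The bracket is assembled in one of them so that δ and normalization can be applied to it as a single
cochain. -/
theorem exists_bracket (X : OCHA 𝒵 𝒜) (D : cochains 𝒵 𝒜 m) (E : cochains 𝒵 𝒜 n) :
    ∃ F : cochains 𝒵 𝒜 (m + n), F.1 = bracketFun D E ∧
      (D ∈ normalized 𝒵 one m → E ∈ normalized 𝒵 one n → F ∈ normalized 𝒵 one (m + n)) ∧
      (delta X _ F).1 = bracketFun (delta X m D) E + m.negOnePow • bracketFun D (delta X n E) := by
  obtain ⟨G, hG⟩ : ∃ G : cochains 𝒵 𝒜 (m + n), G.1 = (brace E D).1 :=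
    exists_coe_eq (add_comm n m) _
  have h : (brace D E - (m * n).negOnePow • G).1 = bracketFun D E := by
    rw [Submodule.coe_sub, coe_units_smul, hG]
    rfl
  refine ⟨_, h, fun hD hE zs as ha => ?_, ?_⟩
  · rw [h]
    change (brace D E).1 zs as - (m * n).negOnePow • (brace E D).1 zs as = 0
    rw [brace_mem_normalized hD hE zs as ha, brace_mem_normalized hE hD zs as ha, smul_zero,
      sub_zero]
  · rw [← delta_bracket, map_sub, map_units_smul', Submodule.coe_sub, coe_units_smul,
      delta_eq_of_eq X (add_comm m n) hG]

theorem bracketFun_comm (D : cochains 𝒵 𝒜 m) (E : cochains 𝒵 𝒜 n) :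
    bracketFun D E = -((m * n).negOnePow • bracketFun E D) := by
  rw [bracketFun, bracketFun, mul_comm n m, smul_sub, smul_smul, ← Int.negOnePow_add,
    Int.negOnePow_even _ ⟨m * n, rfl⟩, one_smul, neg_sub]

theorem bracketFun_linear_right (D : cochains 𝒵 𝒜 m) :
    IsLinearMap k (fun E : cochains 𝒵 𝒜 n => bracketFun D E) := by
  simp only [bracketFun, sub_eq_add_neg, ← Units.neg_smul]
  exact isLinearMap_add (brace_linear_right D) (isLinearMap_units_smul _ (brace_linear_left D))

theorem bracketFun_linear_left (E : cochains 𝒵 𝒜 n) :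
    IsLinearMap k (fun D : cochains 𝒵 𝒜 m => bracketFun D E) := by
  simp only [bracketFun_comm _ E, ← Units.neg_smul]
  exact isLinearMap_units_smul _ (bracketFun_linear_right E)

theorem exists_bracket_HH (X : OCHA 𝒵 𝒜) (one : 𝒜 (-1)) (m n e : ℤ) (h : m + n = e) :
    ∃ G : HH X one m →ₗ[k] HH X one n →ₗ[k] HH X one e, ∀ x y (D : cochains 𝒵 𝒜 m)
      (E : cochains 𝒵 𝒜 n), IsClassOf x D.1 → IsClassOf y E.1 →
      IsClassOf (G x y) (bracketFun D E) := by
  -- If δE = 0, then [δB, E] = δ[B, E]. The degrees are quantified anew so that the statement also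
  -- serves with the two arguments exchanged.
  have left : ∀ {m n : ℤ}, m + n = e → ∀ B ∈ normalized 𝒵 one (m - 1),
      ∀ (D : cochains 𝒵 𝒜 m) (E : cochains 𝒵 𝒜 n), D.1 = (delta X _ B).1 →
      E ∈ normalized 𝒵 one n → delta X n E = 0 → bracketFun D E ∈ coboundaries X one e := by
    intro m n h B hB D E hD hE hE'
    obtain ⟨F, _, hn, hδ⟩ := exists_bracket (one := one) X B E
    rw [hE', (bracketFun_linear_right B).map_zero, smul_zero, add_zero] at hδ
    rw [bracketFun_congr (by omega) hD rfl rfl, ← hδ]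
    exact mem_coboundaries (by omega) (hn hB hE)
  refine exists_bilin_HH _ bracketFun_linear_left bracketFun_linear_right ?_ (left h) ?_
  · intro D E hD hE hD' hE'
    obtain ⟨F, hF, hn, hδ⟩ := exists_bracket (one := one) X D E
    rw [hD', hE', (bracketFun_linear_left E).map_zero, (bracketFun_linear_right D).map_zero,
      smul_zero, add_zero] at hδ
    rw [← hF]
    exact mem_cocycles h (hn hD hE) hδ
  · intro B hB D E hE hD hD'
    -- Graded antisymmetry reduces a coboundary in the second argument to one in the first.
    rw [bracketFun_comm]
    exact neg_mem (units_smul_mem _ _ (left (by omega) B hB E D hE hD hD'))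

theorem exists_cup_HH {X : OCHA 𝒵 𝒜} {one : 𝒜 (-1)} (hone : X.IsUnit one) (m n e : ℤ)
    (h : m + n + 1 = e) :
    ∃ G : HH X one m →ₗ[k] HH X one n →ₗ[k] HH X one e, ∀ x y (D : cochains 𝒵 𝒜 m)
      (E : cochains 𝒵 𝒜 n), IsClassOf x D.1 → IsClassOf y E.1 →
      IsClassOf (G x y) (brace₂ X.q D E).1 := by
  refine exists_bilin_HH _ (brace₂_linear_left X.q) (brace₂_linear_right X.q) ?_ ?_ ?_
  · intro D E hD hE hD' hE'
    refine mem_cocycles (by omega) (cup_mem_normalized hone hD hE) ?_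
    rw [delta_cup, hD', hE', (brace₂_linear_left X.q E).map_zero,
      (brace₂_linear_right X.q D).map_zero, smul_zero, add_zero, neg_zero]
  · intro B hB D E hD hE hE'
    have h₁ := mem_coboundaries (X := X) (n := e) (by omega) (cup_mem_normalized hone hB hE)
    rw [delta_cup, hE', (brace₂_linear_right X.q B).map_zero, smul_zero, add_zero] at h₁
    rw [brace₂_congr X.q (by omega) hD rfl rfl]
    exact (Submodule.neg_mem_iff _).1 h₁
  · intro B hB D E hE hD hD'
    have h₁ := mem_coboundaries (X := X) (n := e) (by omega) (cup_mem_normalized hone hD hB)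
    rw [delta_cup, hD', (brace₂_linear_left X.q B).map_zero, zero_add] at h₁
    rw [brace₂_congr X.q rfl rfl (by omega) hE]
    have h₂ := units_smul_mem _ m.negOnePow ((Submodule.neg_mem_iff _).1 h₁)
    rwa [smul_smul, ← Int.negOnePow_add, Int.negOnePow_even _ ⟨m, rfl⟩, one_smul] at h₂

theorem exists_bvDelta_HH {X : OCHA 𝒵 𝒜} {ω : SymplecticForm 𝒜} (hω : X.IsCyclic ω)
    {one : 𝒜 (-1)} (hone : X.IsUnit one) (n e : ℤ) (h : n - 1 = e) :
    ∃ G : HH X one n →ₗ[k] HH X one e, ∀ x (D : cochains 𝒵 𝒜 n), IsClassOf x D.1 →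
      IsClassOf (G x) (bvDelta ω one D).1 := by
  refine exists_linear_HH _ (bvDelta_linear ω one) ?_ ?_
  · intro D hD hD'
    refine mem_cocycles h (bvDelta_mem_normalized ω hD) ?_
    rw [delta_bvDelta hω hone, hD', (bvDelta_linear ω one).map_zero, neg_zero]
  · intro B hB D hD
    have h₁ := mem_coboundaries (X := X) (n := e) (by omega) (bvDelta_mem_normalized ω hB)
    rw [delta_bvDelta hω hone] at h₁
    rw [bvDelta_congr ω (by omega) hD]
    exact (Submodule.neg_mem_iff _).1 h₁

/-- For normalized cocycles the relation holds up to an explicit normalized coboundary. -/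
theorem exists_bracketFun_eq_add_delta {ω : SymplecticForm 𝒜} (hω : X.IsCyclic ω)
    (hone : X.IsUnit one) {D : cochains 𝒵 𝒜 m} {E : cochains 𝒵 𝒜 n}
    (hD : D.1 ∈ cocycles X one m) (hE : E.1 ∈ cocycles X one n) :
    ∃ B ∈ normalized 𝒵 one (m + n - 1), (D.1 [] [] = 0 → E.1 [] [] = 0 → B.1 [] [] = 0) ∧
        bracketFun D E = ω.deg.negOnePow •
          ((bvDelta ω one (brace₂ X.q D E)).1
            + (brace₂ X.q (bvDelta ω one D) E).1
            - (m * n).negOnePow • (brace₂ X.q (bvDelta ω one E) D).1)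
          + (delta X _ B).1 := by
  -- E{D, Δ} is indexed by n + m - 1 and has to be moved next to D{E, Δ} before the two can be
  -- subtracted.
  obtain ⟨G, hG⟩ : ∃ G : cochains 𝒵 𝒜 (m + n - 1), G.1 = (cyclicBrace ω one E D).1 :=
    exists_coe_eq (by rw [add_comm]) _
  have h : (ω.deg.negOnePow • (cyclicBrace ω one D E - (m * n).negOnePow • G)).1 =
      ω.deg.negOnePow • ((cyclicBrace ω one D E).1
        - (m * n).negOnePow • (cyclicBrace ω one E D).1) := by
    rw [coe_units_smul, Submodule.coe_sub, coe_units_smul, hG]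
  -- The witness collects the two δ-exact terms of the cochain identity; every remaining correction
  -- contains δD or δE and vanishes on cocycles.
  refine ⟨ω.deg.negOnePow • (cyclicBrace ω one D E - (m * n).negOnePow • G),
    fun zs as ha => ?_, fun hD₀ hE₀ => ?_, ?_⟩
  · rw [h]
    have hD' := normalized_of_mem_cocycles hD
    have hE' := normalized_of_mem_cocycles hE
    simp only [Pi.smul_apply, Pi.sub_apply, cyclicBrace_mem_normalized ω hD' hE' zs as ha,
      cyclicBrace_mem_normalized ω hE' hD' zs as ha, smul_zero, sub_zero]
  · rw [h]
    simp only [Pi.smul_apply, Pi.sub_apply, cyclicBrace_nil ω one D hE₀,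
      cyclicBrace_nil ω one E hD₀, smul_zero, sub_zero]
  · rw [bracketFun_eq hω hone, delta_of_mem_cocycles hD, delta_of_mem_cocycles hE,
      map_units_smul', map_sub, map_units_smul', coe_units_smul, Submodule.coe_sub, coe_units_smul,
      delta_eq_of_eq X (by rw [add_comm m n]) hG]
    simp only [cyclicBrace_zero_left, cyclicBrace_zero_right, smul_zero, add_zero, sub_zero]
    rw [← smul_add, add_sub_assoc]

end Cocycles
end
end OpenClosed

/-! ### The theorem -/

open OpenClosed in

theorem theorem4p6 {k Z A : Type*} [CommRing k] [AddCommGroup Z] [Module k Z]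
    [AddCommGroup A] [Module k A]
    (𝒵 : ℤ → Submodule k Z) [DirectSum.Decomposition 𝒵]
    (𝒜 : ℤ → Submodule k A) [DirectSum.Decomposition 𝒜]
    (X : OCHA 𝒵 𝒜) (ω : SymplecticForm 𝒜) (hω : X.IsCyclic ω)
    (one : 𝒜 (-1)) (hone : X.IsUnit one) :
    -- the cochain-level identity
    (∀ (m n : ℤ) (D : cochains 𝒵 𝒜 m) (E : cochains 𝒵 𝒜 n),
      bracketFun D E = ω.deg.negOnePow •
        ((bvDelta ω one (brace₂ X.q D E)).1
          + (brace₂ X.q (bvDelta ω one D) E).1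
          - (m * n).negOnePow • (brace₂ X.q (bvDelta ω one E) D).1
          + (delta X _ (cyclicBrace ω one D E)).1
          - (m * n).negOnePow • (delta X _ (cyclicBrace ω one E D)).1
          + (cyclicBrace ω one (delta X _ D) E).1
          - (m * n).negOnePow • (cyclicBrace ω one (delta X _ E) D).1
          + m.negOnePow • (cyclicBrace ω one D (delta X _ E)).1
          - (n + m * n).negOnePow • (cyclicBrace ω one E (delta X _ D)).1)) ∧
    -- the operations induced on cohomology, and the relation between them
    (∃ (bracket : ∀ m n e : ℤ, m + n = e →
          HH X one m →ₗ[k] HH X one n →ₗ[k] HH X one e)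
        (cup : ∀ m n e : ℤ, m + n + 1 = e →
          HH X one m →ₗ[k] HH X one n →ₗ[k] HH X one e)
        (Δ : ∀ n e : ℤ, n - 1 = e → HH X one n →ₗ[k] HH X one e),
      (∀ (m n e : ℤ) (h : m + n = e) (x : HH X one m) (y : HH X one n)
          (D : cochains 𝒵 𝒜 m) (E : cochains 𝒵 𝒜 n), IsClassOf x D.1 → IsClassOf y E.1 →
        IsClassOf (bracket m n e h x y) (bracketFun D E)) ∧
      (∀ (m n e : ℤ) (h : m + n + 1 = e) (x : HH X one m) (y : HH X one n)
          (D : cochains 𝒵 𝒜 m) (E : cochains 𝒵 𝒜 n), IsClassOf x D.1 → IsClassOf y E.1 →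
        IsClassOf (cup m n e h x y) (brace₂ X.q D E).1) ∧
      (∀ (n e : ℤ) (h : n - 1 = e) (x : HH X one n) (D : cochains 𝒵 𝒜 n), IsClassOf x D.1 →
        IsClassOf (Δ n e h x) (bvDelta ω one D).1) ∧
      ∀ (m n : ℤ) (x : HH X one m) (y : HH X one n),
        bracket m n (m + n) rfl x y = ω.deg.negOnePow •
          (Δ (m + n + 1) (m + n) (by ring) (cup m n (m + n + 1) rfl x y)
            + cup (m - 1) n (m + n) (by ring) (Δ m (m - 1) rfl x) y
            - (m * n).negOnePow •
              cup (n - 1) m (m + n) (by ring) (Δ n (n - 1) rfl y) x)) ∧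
    -- the relation also holds in the cohomology of the normalized cochains whose component
    -- without any inputs vanishes
    (∀ (m n : ℤ) (D : cochains 𝒵 𝒜 m) (E : cochains 𝒵 𝒜 n),
      D.1 ∈ cocycles X one m → E.1 ∈ cocycles X one n → D.1 [] [] = 0 → E.1 [] [] = 0 →
      ∃ B ∈ normalized 𝒵 one (m + n - 1), B.1 [] [] = 0 ∧
        bracketFun D E = ω.deg.negOnePow •
          ((bvDelta ω one (brace₂ X.q D E)).1
            + (brace₂ X.q (bvDelta ω one D) E).1
            - (m * n).negOnePow • (brace₂ X.q (bvDelta ω one E) D).1)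
          + (delta X _ B).1) := by
  refine ⟨fun m n D E => bracketFun_eq hω hone D E, ?_, ?_⟩
  · choose bracket hbracket using exists_bracket_HH X one
    choose cup hcup using exists_cup_HH hone
    choose Δ hΔ using exists_bvDelta_HH hω hone
    refine ⟨bracket, cup, Δ, hbracket, hcup, hΔ, fun m n x y => ?_⟩
    obtain ⟨D, hD⟩ : ∃ D : cochains 𝒵 𝒜 m, IsClassOf x D.1 := by
      obtain ⟨f, rfl⟩ := Submodule.Quotient.mk_surjective _ x
      exact ⟨cocycleCochain X one m f, f.2, rfl⟩
    obtain ⟨E, hE⟩ : ∃ E : cochains 𝒵 𝒜 n, IsClassOf y E.1 := by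
      obtain ⟨f, rfl⟩ := Submodule.Quotient.mk_surjective _ y
      exact ⟨cocycleCochain X one n f, f.2, rfl⟩
    obtain ⟨B, hB, -, h⟩ := exists_bracketFun_eq_add_delta hω hone hD.fst hE.fst
    have h₁ := hcup m n _ rfl x y D E hD hE
    -- As a brace the cup product has degree 1 + m + n, while its class is taken in degree m + n +
    -- 1; C is the same cochain with the second index.
    obtain ⟨C, hC⟩ : ∃ C : cochains 𝒵 𝒜 (m + n + 1), C.1 = (brace₂ X.q D E).1 :=
      exists_coe_eq (by ring) _
    have h₂ := hΔ (m + n + 1) (m + n) (by ring) _ C (hC ▸ h₁)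
    rw [bvDelta_congr ω (by ring) hC] at h₂
    have h₃ := hcup (m - 1) n (m + n) (by ring) _ y _ E (hΔ m (m - 1) rfl x D hD) hE
    have h₄ := hcup (n - 1) m (m + n) (by ring) _ x _ D (hΔ n (n - 1) rfl y E hE) hD
    refine (hbracket m n _ rfl x y D E hD hE).eq_of_sub_mem
      (((h₂.add h₃).sub (h₄.units_smul _)).units_smul _) ?_
    rw [h, add_sub_cancel_left]
    exact mem_coboundaries (by ring) hB
  · intro m n D E hD hE hD₀ hE₀
    obtain ⟨B, hB, hB₀, h⟩ := exists_bracketFun_eq_add_delta hω hone hD hE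
    exact ⟨B, hB, hB₀ hD₀ hE₀, h⟩
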